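/- Let $\rho,\kappa>0$ with $\rho\kappa>\pi$. Put $$w_e(r)=\frac{1}{4\cosh\big(\frac{\pi}{\rho}(r+\frac{i\pi}{2\kappa})\big)\cosh\big(\frac{\pi}{\rho}(r-\frac{i\pi}{2\kappa})\big)},\qquad \Psi_e(r)=w_e(r)^{1/2}\qquad(r\in\mathbb R),$$ where $w_e$ is positive on $\mathbb R$ and the positive square root is taken, and, for $\sigma\in\{+,-\}$ and $r,k\in\mathbb R$, $$\Psi_\sigma(r,k)=\frac{w_e(r)^{1/2}}{\sinh\big(\frac{\pi}{\kappa}(k-\frac{i\pi}{\rho})\big)}\Big(e^{irk}\Big[e^{-\pi r/\rho}\sinh\big(\tfrac{\pi}{\kappa}(k-\tfrac{i\pi}{\rho})\big)+e^{\pi r/\rho}\sinh\big(\tfrac{\pi}{\kappa}k\big)\Big]+\sigma e^{-irk}e^{-\pi r/\rho}\sinh\big(\tfrac{i\pi^2}{\rho\kappa}\big)\Big).$$ Let $\mathcal H=L^2(\mathbb R,dr)$ with inner product $(\cdot,\cdot)_1$ and $\hat{\mathcal H}=L^2((0,\infty),dk)\otimes\mathbb C^2$, with inner products conjugate linear in the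 first argument. For $f=(f_+,f_-)\in C_0^\infty((0,\infty))^2$ set $$(\mathcal F_\sigma f)(r)=\frac{1}{\sqrt{2\pi}}\int_0^\infty\big(\Psi_\sigma(r,k)f_+(k)-\Psi_\sigma(-r,k)f_-(k)\big)\,dk .$$ Then, for $\sigma=+,-$, $\mathcal F_\sigma$ extends uniquely to a bounded operator $\mathcal F_\sigma(\phi_e):\hat{\mathcal H}\to\mathcal H$ (the label is $\phi_e=\frac{\pi^2}{2\rho\kappa}+\frac{\pi}{2}$). The operator $\mathcal F_-(\phi_e)$ is unitary. Moreover $\Psi_e\in\mathcal H$, with $$(\Psi_e,\Psi_e)_1=\frac{\pi}{2\kappa\sin(\pi^2/\rho\kappa)},$$ and $\mathcal F_+(\phi_e)$ is isometric and satisfies $$\mathcal F_+(\phi_e)\mathcal F_+(\phi_e)^*=\mathbf 1_{\mathcal H}-\Psi_e\otimes\Psi_e/(\Psi_e,\Psi_e)_1,$$ where $(\Psi_e\otimes\Psi_e)h=(\Psi_e,h)_1\Psi_e$. -/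

import Mathlib

open MeasureTheory Set
open scoped ContDiff ComplexConjugate

noncomputable section

/-- The position space `L²(ℝ, dr)`. Mathlib's inner product is conjugate linear in the first slot. -/
abbrev PositionSpace : Type := Lp ℂ 2 (volume : Measure ℝ)

/-- The space `L²((0,∞), dk)`. -/
abbrev HalfLineSpace : Type := Lp ℂ 2 (volume.restrict (Ioi (0 : ℝ)))

/-- The momentum space `L²((0,∞), dk) ⊗ ℂ²`, realized as the Hilbert space direct sum of two copies
of `L²((0,∞), dk)`; the two components of `f` are `f₊` and `f₋`. -/
abbrev MomentumSpace : Type := WithLp 2 (HalfLineSpace × HalfLineSpace)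

/-- Complex-valued smooth functions with compact support contained in `(0,∞)`. -/
structure IsHalfLineTest (f : ℝ → ℂ) : Prop where
  smooth : ContDiff ℝ ∞ f
  compact : HasCompactSupport f
  support : tsupport f ⊆ Ioi 0

theorem IsHalfLineTest.memLp {f : ℝ → ℂ} (hf : IsHalfLineTest f) :
    MemLp f 2 (volume.restrict (Ioi (0 : ℝ))) :=
  (hf.smooth.continuous.memLp_of_hasCompactSupport hf.compact).restrict _

/-- The element `(f₊, f₋)` of the momentum space given by two test functions. -/
def testPair {f g : ℝ → ℂ} (hf : IsHalfLineTest f) (hg : IsHalfLineTest g) : MomentumSpace :=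
  WithLp.toLp 2 (hf.memLp.toLp f, hg.memLp.toLp g)

/-- The integral transform of `(f₊, f₋)` attached to a function `Ψ(r,k)`: its two kernels are
`F₊(r,k) = Ψ(r,k)` and `F₋(r,k) = -Ψ(-r,k)`. -/
def integralTransform (Ψ : ℝ → ℝ → ℂ) (fp fm : ℝ → ℂ) (r : ℝ) : ℂ :=
  ((1 / √(2 * Real.pi) : ℝ) : ℂ) * ∫ k in Ioi (0 : ℝ), (Ψ r k * fp k + -Ψ (-r) k * fm k)

/-- The bounded operator `F` extends the integral transform attached to `Ψ`, which is defined at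
first on pairs of test functions. -/
def ExtendsTransform (Ψ : ℝ → ℝ → ℂ) (F : MomentumSpace →L[ℂ] PositionSpace) : Prop :=
  ∀ (fp fm : ℝ → ℂ) (hp : IsHalfLineTest fp) (hm : IsHalfLineTest fm),
    (F (testPair hp hm) : ℝ → ℂ) =ᵐ[volume] integralTransform Ψ fp fm

/-- The weight function `w_e(r) = 1 / (4 cosh((π/ρ)(r + iπ/2κ)) cosh((π/ρ)(r - iπ/2κ)))`. -/
def weightE (ρ κ r : ℝ) : ℂ :=
  1 / (4 * Complex.cosh ((Real.pi / ρ) * (r + Complex.I * (Real.pi / (2 * κ))))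
    * Complex.cosh ((Real.pi / ρ) * (r - Complex.I * (Real.pi / (2 * κ)))))

/-- The function `Ψ_e(r) = w_e(r)^{1/2}`. The weight is real and positive, see `weightE_eq` and
`weightE_pos`, and the positive square root is taken. -/
def sqrtWeightE (ρ κ r : ℝ) : ℝ := √ (weightE ρ κ r).re

/-- The function `Ψ(r,k)` that defines the transform `F_σ(φ_e)`, `σ = ±1`. -/
def kernelE (ρ κ σ r k : ℝ) : ℂ :=
  sqrtWeightE ρ κ r / Complex.sinh ((Real.pi / κ) * (k - Complex.I * Real.pi / ρ)) *
    (Complex.exp (Complex.I * r * k) *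
        (Complex.exp (-(Real.pi * r / ρ)) *
            Complex.sinh ((Real.pi / κ) * (k - Complex.I * Real.pi / ρ))
          + Complex.exp (Real.pi * r / ρ) * Complex.sinh ((Real.pi / κ) * k))
      + σ * Complex.exp (-(Complex.I * r * k)) * Complex.exp (-(Real.pi * r / ρ)) *
          Complex.sinh (Complex.I * Real.pi ^ 2 / (ρ * κ)))

theorem weightE_eq (ρ κ r : ℝ) :
    weightE ρ κ r = ((1 / (4 * Complex.normSq
      (Complex.cosh ((Real.pi / ρ) * (r + Complex.I * (Real.pi / (2 * κ))))))) : ℝ) := by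
  have h : Complex.cosh ((Real.pi / ρ) * (r - Complex.I * (Real.pi / (2 * κ)))) =
      conj (Complex.cosh ((Real.pi / ρ) * (r + Complex.I * (Real.pi / (2 * κ))))) := by
    rw [← Complex.cosh_conj]
    congr 1
    simp [sub_eq_add_neg, Complex.conj_ofNat]
  rw [weightE, h, mul_assoc, Complex.mul_conj]
  push_cast
  ring

theorem weightE_pos {ρ κ : ℝ} (hρ : 0 < ρ) (hκ : 0 < κ) (h : Real.pi < ρ * κ) (r : ℝ) :
    0 < (weightE ρ κ r).re := by
  rw [weightE_eq, Complex.ofReal_re]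
  have hz : ((Real.pi / ρ : ℂ) * (r + Complex.I * (Real.pi / (2 * κ)))) =
      ((Real.pi * r / ρ : ℝ) : ℂ) + ((Real.pi * (Real.pi / (ρ * κ)) / 2 : ℝ) : ℂ) * Complex.I := by
    push_cast
    field_simp
  have hlt : Real.pi / (ρ * κ) < 1 := (div_lt_one (by positivity)).2 h
  have hpos : 0 < Real.pi / (ρ * κ) := by positivity
  have hcos : 0 < Real.cos (Real.pi * (Real.pi / (ρ * κ)) / 2) := by
    apply Real.cos_pos_of_mem_Ioo
    constructor <;> nlinarith [Real.pi_pos]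
  have hne : Complex.cosh ((Real.pi / ρ) * (r + Complex.I * (Real.pi / (2 * κ)))) ≠ 0 := by
    intro h0
    have h1 := congrArg Complex.re h0
    rw [hz, Complex.cosh_add, Complex.cosh_mul_I, Complex.sinh_mul_I, ← Complex.ofReal_cosh,
      ← Complex.ofReal_sinh, ← Complex.ofReal_cos, ← Complex.ofReal_sin] at h1
    simp only [Complex.add_re, Complex.mul_re, Complex.ofReal_re, Complex.ofReal_im, Complex.mul_im,
      Complex.I_re, Complex.I_im, Complex.zero_re, mul_zero, zero_mul, mul_one, add_zero, sub_zero,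
      mul_eq_zero] at h1
    rcases h1 with h1 | h1
    · exact (Real.cosh_pos _).ne' h1
    · exact hcos.ne' h1
  have := Complex.normSq_pos.2 hne
  positivity

end

/-! Put θ = π²/(ρκ), ν = π/ρ, η = π/(2κ), so that 2νη = θ < π. Write `kap` for cosh (δ = 1) or sinh
(δ = -1) and split `kap δ (x + iθ/2)` into its modulus `den` and its phase `phaseFn`. Let U be the
unitary Fourier transform and N the reflection. For ε = ±1 let S_ε = `scatOp` = ½(u U a_ε + ε ū U
a_ε(-·)), with u the phase of cosh(νr + iθ/2) and a_ε(k) = e^{ηk} / |kap ε (ηk + iθ/2)|.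

S_ε is tested on Gaussians multiplied by `den`: the weight cancels the denominator of a_ε, and U
shifts the parameter of the Gaussians. In the Gram matrix of the images
(`integral_conj_scatGauss_mul`) the diagonal terms are handled by Plancherel. The cross terms are
integrals over the lines Im z = ±η of a Gaussian times kap(νz ∓ iθ)/kap(νz). Moving both contours to
a common line and adding gives 2 cos θ times a Gaussian integral, which is the cos θ term of `den`².
For cosh there is no pole in the strip, hence S_ε*S_ε = 1.

The adjoint S_ε* maps weighted Gaussians to functions of the same type with (1, ν) and (ε, η)
exchanged (`adjoint_scatOp_weightedGauss`). So S_1S_1* = 1, while for ε = -1 the pole of 1/sinh at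
the origin adds a term that is a multiple of conj(e^{a²/2}) e^{b²/2}. This is the matrix of a rank
one operator on the bound state Ψ_e. Its coefficient is not found from the residue but from
S_{-1}*Ψ_e = 0 (`scatOp_adjoint_boundState`). The norm of Ψ_e comes from an arctangent primitive.

Let X_ε be extension by zero from the half line times a phase, and C_ε = S_ε(1 - σN)X_ε. Then
C_ε*C_ε = 2, the range of C_ε has parity -εσ, and C_εC_ε* = (1 - σεN)S_εS_ε*. The transform is ½(C_1
+ C_{-1})f₊ + (σ/2)(C_1 - C_{-1})f₋, so F*F = 1 and FF* = ½(C_1C_1* + C_{-1}C_{-1}*). As Ψ_e is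
even, the defect of S_{-1} survives with factor (1 + σ)/2: fully for σ = +, not at all for σ = -.
That the integral kernels agree is a rational identity in exponentials (`kernelE_eq`). -/

noncomputable section

/-! ### Contour shifts for Gaussian integrals -/

/-- The complex Gaussian `exp (-α z² + c z)`. -/
def cgauss (α : ℝ) (c z : ℂ) : ℂ := Complex.exp (-α * z ^ 2 + c * z)

theorem norm_cgauss_le (α : ℝ) (c z : ℂ) :
    ‖cgauss α c z‖ ≤ Real.exp (-α * z.re ^ 2 + α * z.im ^ 2 + ‖c‖ * |z.re| + ‖c‖ * |z.im|) := by
  rw [cgauss, Complex.norm_exp]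
  apply Real.exp_le_exp.2
  have h1 : (-α * z ^ 2 + c * z : ℂ).re = -α * z.re ^ 2 + α * z.im ^ 2 + (c * z).re := by
    simp [pow_two]; ring
  have h2 : (c * z).re ≤ ‖c‖ * ‖z‖ := by
    rw [← norm_mul]; exact Complex.re_le_norm _
  have h3 : ‖c‖ * ‖z‖ ≤ ‖c‖ * (|z.re| + |z.im|) :=
    mul_le_mul_of_nonneg_left (Complex.norm_le_abs_re_add_abs_im z) (norm_nonneg _)
  rw [h1]; linarith

theorem continuous_cgauss (α : ℝ) (c : ℂ) : Continuous (cgauss α c) := by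
  unfold cgauss; fun_prop

theorem differentiable_cgauss (α : ℝ) (c : ℂ) : Differentiable ℂ (cgauss α c) := by
  unfold cgauss; fun_prop

theorem cgauss_line (α : ℝ) (c : ℂ) (x y : ℝ) :
    cgauss α c (x + y * Complex.I) =
      Complex.exp (α * y ^ 2 + c * y * Complex.I) * cgauss α (c - 2 * α * y * Complex.I) x := by
  rw [cgauss, cgauss, ← Complex.exp_add]
  congr 1
  linear_combination (-α * y ^ 2 : ℂ) * Complex.I_sq

theorem integrable_cgauss {α : ℝ} (hα : 0 < α) (c : ℂ) (y : ℝ) :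
    Integrable fun x : ℝ => cgauss α c (x + y * Complex.I) := by
  simp_rw [cgauss_line]
  refine Integrable.const_mul ?_ _
  have := integrable_cexp_quadratic (b := α) (by simpa using hα) (c - 2 * α * y * Complex.I) 0
  simpa [cgauss] using this

theorem integrable_cgauss_mul {α : ℝ} (hα : 0 < α) (c : ℂ) (y M : ℝ) {m : ℂ → ℂ}
    (hm : Continuous fun x : ℝ => m (x + y * Complex.I))
    (hM : ∀ x : ℝ, ‖m (x + y * Complex.I)‖ ≤ M) :
    Integrable fun x : ℝ => cgauss α c (x + y * Complex.I) * m (x + y * Complex.I) :=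
  (integrable_cgauss hα c y).mul_bdd hm.aestronglyMeasurable (ae_of_all _ hM)

open Filter Topology in
theorem tendsto_vertical_bound {α : ℝ} (hα : 0 < α) (C M : ℝ) :
    Tendsto (fun T : ℝ => Real.exp (-α * T ^ 2 + C * T + C) * M) atTop (𝓝 0) := by
  rw [← zero_mul M]
  refine Tendsto.mul_const _ (Real.tendsto_exp_atBot.comp ?_)
  have h : Tendsto (fun T : ℝ => T * (-α * T + C) + C) atTop atBot := by
    refine tendsto_atBot_add_const_right _ _ ?_
    refine tendsto_id.atTop_mul_atBot₀ ?_
    exact tendsto_atBot_add_const_right _ _ (tendsto_id.const_mul_atTop_of_neg (by linarith))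
  refine h.congr fun T => by ring

theorem abs_le_of_mem_uIcc {a b y : ℝ} (hy : y ∈ uIcc a b) : |y| ≤ |a| + |b| := by
  rw [mem_uIcc] at hy
  rw [abs_le]
  have := neg_abs_le a
  have := neg_abs_le b
  have := le_abs_self a
  have := le_abs_self b
  have := abs_nonneg a
  have := abs_nonneg b
  rcases hy with hy | hy <;> constructor <;> linarith [hy.1, hy.2]

/-- One constant serves both as linear coefficient and as additive constant, the shape required by
`tendsto_vertical_bound`. The bound K is kept apart from ‖c‖ so that Gaussians with different c can
share one majorant. -/
theorem norm_cgauss_le_of_strip {α : ℝ} (hα : 0 < α) {c : ℂ} {R K : ℝ} (hK : ‖c‖ ≤ K) {z : ℂ}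
    (hz : |z.im| ≤ R) : ‖cgauss α c z‖ ≤ Real.exp (-α * |z.re| ^ 2 +
      (K + α * R ^ 2 + K * R) * |z.re| + (K + α * R ^ 2 + K * R)) := by
  refine (norm_cgauss_le α c z).trans (Real.exp_le_exp.2 ?_)
  have hR : 0 ≤ R := (abs_nonneg _).trans hz
  have hK0 : 0 ≤ K := (norm_nonneg _).trans hK
  have h1 : z.im ^ 2 ≤ R ^ 2 := by rw [← sq_abs]; gcongr
  have h2 : α * z.im ^ 2 ≤ α * R ^ 2 := by gcongr
  have h3 : ‖c‖ * |z.im| ≤ K * R := by gcongr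
  have h4 : 0 ≤ (α * R ^ 2 + K * R) * |z.re| := by positivity
  have h5 : ‖c‖ * |z.re| ≤ K * |z.re| := by gcongr
  rw [sq_abs]
  linarith

open Filter Topology in
/-- Shift of the line of integration for a function that is holomorphic on a closed horizontal strip
and bounded by a Gaussian near its ends. -/
theorem integral_line_shift {α : ℝ} (hα : 0 < α) {a b C M : ℝ} {f : ℂ → ℂ}
    (hm : DifferentiableOn ℂ f {z | z.im ∈ uIcc a b})
    (hM : ∀ z : ℂ, z.im ∈ uIcc a b → 1 ≤ |z.re| →
      ‖f z‖ ≤ Real.exp (-α * |z.re| ^ 2 + C * |z.re| + C) * M)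
    (ha : Integrable fun x : ℝ => f (x + a * Complex.I))
    (hb : Integrable fun x : ℝ => f (x + b * Complex.I)) :
    ∫ x : ℝ, f (x + a * Complex.I) = ∫ x : ℝ, f (x + b * Complex.I) := by
  have hrect : ∀ T : ℝ, (∫ x in (-T)..T, f (x + a * Complex.I)) -
      (∫ x in (-T)..T, f (x + b * Complex.I)) + Complex.I • (∫ y in a..b, f (T + y * Complex.I)) -
      Complex.I • (∫ y in a..b, f ((-T : ℝ) + y * Complex.I)) = 0 := by
    intro T
    have := Complex.integral_boundary_rect_eq_zero_of_differentiableOn f (-T + a * Complex.I)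
      (T + b * Complex.I) ?_
    · simpa using this
    · refine hm.mono ?_
      intro z hz
      have := hz.2
      simpa using this
  -- The sign σ treats the two vertical sides of the rectangle at once.
  have hvert : ∀ σ : ℝ, |σ| = 1 →
      Tendsto (fun T : ℝ => ∫ y in a..b, f ((σ * T : ℝ) + y * Complex.I)) atTop (𝓝 0) := by
    intro σ hσ
    refine squeeze_zero_norm' (a := fun T : ℝ =>
      Real.exp (-α * T ^ 2 + C * T + C) * (M * |b - a|)) ?_ (tendsto_vertical_bound hα C _)
    -- The bound is needed only far out, where the vertical sides end up; near the origin it would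
    -- fail to follow for quotients by sinh.
    filter_upwards [eventually_ge_atTop 1] with T hT
    have hT' : |σ * T| = T := by rw [abs_mul, hσ, one_mul, abs_of_pos (by linarith)]
    rw [← mul_assoc]
    refine intervalIntegral.norm_integral_le_of_norm_le_const fun y hy => ?_
    have := hM ((σ * T : ℝ) + y * Complex.I) (by simpa using uIoc_subset_uIcc hy) (by
      simpa [-Complex.ofReal_mul, hT'] using hT)
    simpa [-Complex.ofReal_mul, hT'] using this
  have hlim := (((intervalIntegral_tendsto_integral ha tendsto_neg_atTop_atBot tendsto_id).sub
    (intervalIntegral_tendsto_integral hb tendsto_neg_atTop_atBot tendsto_id)).add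
    ((hvert 1 (by simp)).const_smul Complex.I)).sub ((hvert (-1) (by simp)).const_smul Complex.I)
  have h0 := tendsto_nhds_unique (hlim.congr fun T => by
    have := hrect T
    simpa using this) tendsto_const_nhds
  simpa [sub_eq_zero] using h0

/-- Shift of the line of integration for a Gaussian times a bounded holomorphic function. -/
theorem integral_cgauss_mul_shift {α : ℝ} (hα : 0 < α) (c : ℂ) {a b M : ℝ} {m : ℂ → ℂ}
    (hm : DifferentiableOn ℂ m {z | z.im ∈ uIcc a b})
    (hM : ∀ z : ℂ, z.im ∈ uIcc a b → ‖m z‖ ≤ M) :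
    ∫ x : ℝ, cgauss α c (x + a * Complex.I) * m (x + a * Complex.I) =
      ∫ x : ℝ, cgauss α c (x + b * Complex.I) * m (x + b * Complex.I) := by
  have hline : ∀ y ∈ uIcc a b,
      Integrable fun x : ℝ => cgauss α c (x + y * Complex.I) * m (x + y * Complex.I) := by
    intro y hy
    refine integrable_cgauss_mul hα c y M ?_ fun x => hM _ (by simpa using hy)
    exact hm.continuousOn.comp_continuous (by fun_prop) fun x => by simpa using hy
  refine integral_line_shift (f := fun z => cgauss α c z * m z) (M := M)
    (C := ‖c‖ + α * (|a| + |b|) ^ 2 + ‖c‖ * (|a| + |b|)) hα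
    ((differentiable_cgauss α c).differentiableOn.mul hm) (fun z hz _ => ?_)
    (hline a left_mem_uIcc) (hline b right_mem_uIcc)
  rw [norm_mul]
  exact mul_le_mul (norm_cgauss_le_of_strip hα le_rfl (abs_le_of_mem_uIcc hz)) (hM z hz)
    (norm_nonneg _) (Real.exp_pos _).le

/-! ### Bounds for cosh and sinh in a strip -/

theorem normSq_cosh_add_mul_I (x y : ℝ) :
    ‖Complex.cosh (x + y * Complex.I)‖ ^ 2 = Real.cosh x ^ 2 - Real.sin y ^ 2 := by
  rw [Complex.cosh_add, Complex.cosh_mul_I, Complex.sinh_mul_I, ← Complex.ofReal_cosh,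
    ← Complex.ofReal_sinh, ← Complex.ofReal_cos, ← Complex.ofReal_sin, ← Complex.normSq_eq_norm_sq,
    Complex.normSq_apply]
  simp only [Complex.add_re, Complex.mul_re, Complex.ofReal_re, Complex.ofReal_im, Complex.I_re,
    Complex.I_im, Complex.add_im, Complex.mul_im]
  linear_combination Real.cosh x ^ 2 * Real.cos_sq_add_sin_sq y - Real.sin y ^ 2 * Real.cosh_sq x

theorem normSq_sinh_add_mul_I (x y : ℝ) :
    ‖Complex.sinh (x + y * Complex.I)‖ ^ 2 = Real.cosh x ^ 2 - Real.cos y ^ 2 := by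
  rw [Complex.sinh_add, Complex.cosh_mul_I, Complex.sinh_mul_I, ← Complex.ofReal_cosh,
    ← Complex.ofReal_sinh, ← Complex.ofReal_cos, ← Complex.ofReal_sin, ← Complex.normSq_eq_norm_sq,
    Complex.normSq_apply]
  simp only [Complex.add_re, Complex.mul_re, Complex.ofReal_re, Complex.ofReal_im, Complex.I_re,
    Complex.I_im, Complex.add_im, Complex.mul_im]
  linear_combination Real.cosh x ^ 2 * Real.cos_sq_add_sin_sq y - Real.cos y ^ 2 * Real.cosh_sq x

theorem norm_cosh_le (x y : ℝ) : ‖Complex.cosh (x + y * Complex.I)‖ ≤ Real.cosh x := by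
  refine le_of_sq_le_sq ?_ (Real.cosh_pos x).le
  rw [normSq_cosh_add_mul_I]
  nlinarith [sq_nonneg (Real.sin y)]

theorem norm_sinh_le (x y : ℝ) : ‖Complex.sinh (x + y * Complex.I)‖ ≤ Real.cosh x := by
  refine le_of_sq_le_sq ?_ (Real.cosh_pos x).le
  rw [normSq_sinh_add_mul_I]
  nlinarith [sq_nonneg (Real.cos y)]

/-- The difference of the squares is sin²y sinh²x. -/
theorem abs_cos_mul_cosh_le (x y : ℝ) :
    |Real.cos y| * Real.cosh x ≤ ‖Complex.cosh (x + y * Complex.I)‖ := by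
  refine le_of_sq_le_sq ?_ (norm_nonneg _)
  rw [normSq_cosh_add_mul_I, mul_pow, sq_abs]
  nlinarith [Real.cos_sq_add_sin_sq y, Real.one_le_cosh x, sq_nonneg (Real.sin y),
    mul_nonneg (sq_nonneg (Real.sin y)) (sq_nonneg (Real.sinh x)), Real.cosh_sq x]

theorem abs_sin_mul_cosh_le (x y : ℝ) :
    |Real.sin y| * Real.cosh x ≤ ‖Complex.sinh (x + y * Complex.I)‖ := by
  refine le_of_sq_le_sq ?_ (norm_nonneg _)
  rw [normSq_sinh_add_mul_I, mul_pow, sq_abs]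
  nlinarith [Real.cos_sq_add_sin_sq y, Real.one_le_cosh x, sq_nonneg (Real.cos y),
    mul_nonneg (sq_nonneg (Real.cos y)) (sq_nonneg (Real.sinh x)), Real.cosh_sq x]

theorem abs_sinh_le_norm_sinh (x y : ℝ) :
    |Real.sinh x| ≤ ‖Complex.sinh (x + y * Complex.I)‖ := by
  refine le_of_sq_le_sq ?_ (norm_nonneg _)
  rw [normSq_sinh_add_mul_I, sq_abs]
  nlinarith [Real.cos_sq_add_sin_sq y, Real.cosh_sq x, sq_nonneg (Real.sin y)]

theorem mul_eq_re_add_im (ν : ℝ) (z : ℂ) :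
    (ν * z : ℂ) = ((ν * z.re : ℝ) : ℂ) + ((ν * z.im : ℝ) : ℂ) * Complex.I := by
  conv_lhs => rw [← Complex.re_add_im z]
  push_cast; ring

theorem cos_le_cos_of_abs_le {ν y t : ℝ} (hν : 0 < ν) (hνy : ν * y < Real.pi / 2)
    (ht : |t| ≤ y) : Real.cos (ν * y) ≤ Real.cos (ν * t) := by
  rw [← Real.cos_abs (ν * t)]
  refine Real.cos_le_cos_of_nonneg_of_le_pi (abs_nonneg _) (by linarith [Real.pi_pos]) ?_
  rw [abs_mul, abs_of_pos hν]
  gcongr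

theorem cos_mul_cosh_le_norm_cosh {ν y : ℝ} (hν : 0 < ν) (hνy : ν * y < Real.pi / 2)
    {z : ℂ} (hz : |z.im| ≤ y) :
    Real.cos (ν * y) * Real.cosh (ν * z.re) ≤ ‖Complex.cosh (ν * z)‖ := by
  rw [mul_eq_re_add_im]
  refine le_trans ?_ (abs_cos_mul_cosh_le _ _)
  gcongr
  exact (cos_le_cos_of_abs_le hν hνy hz).trans (le_abs_self _)

theorem cosh_mul_ne_zero {ν y : ℝ} (hν : 0 < ν) (hνy : ν * y < Real.pi / 2)
    {z : ℂ} (hz : |z.im| ≤ y) : Complex.cosh (ν * z) ≠ 0 := by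
  have hc : 0 < Real.cos (ν * y) := Real.cos_pos_of_mem_Ioo
    ⟨by nlinarith [Real.pi_pos, (abs_nonneg _).trans hz], hνy⟩
  have := cos_mul_cosh_le_norm_cosh hν hνy hz
  rw [← norm_pos_iff]
  exact (mul_pos hc (Real.cosh_pos _)).trans_le this

/-- An imaginary shift of the numerator leaves its bound cosh(ν Re z) unchanged, and the denominator
is at least cos(νy) times the same quantity. -/
theorem norm_cosh_add_div_cosh_le {ν y : ℝ} (hν : 0 < ν) (hνy : ν * y < Real.pi / 2) (t : ℝ)
    {z : ℂ} (hz : |z.im| ≤ y) :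
    ‖Complex.cosh (ν * z + t * Complex.I) / Complex.cosh (ν * z)‖ ≤ 1 / Real.cos (ν * y) := by
  have hc : 0 < Real.cos (ν * y) := Real.cos_pos_of_mem_Ioo
    ⟨by nlinarith [Real.pi_pos, (abs_nonneg _).trans hz], hνy⟩
  have h1 := cos_mul_cosh_le_norm_cosh hν hνy hz
  have h2 : ‖Complex.cosh (ν * z + t * Complex.I)‖ ≤ Real.cosh (ν * z.re) := by
    rw [mul_eq_re_add_im, add_assoc, ← add_mul, ← Complex.ofReal_add]
    exact norm_cosh_le _ _
  have h3 := Real.cosh_pos (ν * z.re)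
  rw [norm_div, div_le_div_iff₀ ((mul_pos hc h3).trans_le h1) hc]
  nlinarith

theorem abs_le_of_mem_uIcc_zero {y t : ℝ} (ht : t ∈ uIcc y 0) : |t| ≤ |y| := by
  simpa using abs_le_of_mem_uIcc ht

/-! ### Integrals of Gaussians against quotients of cosh and of sinh -/

theorem integral_cgauss_line {α : ℝ} (hα : 0 < α) (c : ℂ) (y : ℝ) :
    ∫ x : ℝ, cgauss α c (x + y * Complex.I) = ∫ x : ℝ, cgauss α c x := by
  have := integral_cgauss_mul_shift hα c (a := y) (b := 0) (M := 1) (m := fun _ => 1)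
    (by fun_prop) (by simp)
  simpa using this

theorem integral_cgauss_mul_cosh_div_cosh {α : ℝ} (hα : 0 < α) (c : ℂ) {ν y : ℝ} (hν : 0 < ν)
    (hνy : ν * |y| < Real.pi / 2) (t : ℝ) :
    ∫ x : ℝ, cgauss α c (x + y * Complex.I) *
      (Complex.cosh (ν * (x + y * Complex.I) + t * Complex.I) /
        Complex.cosh (ν * (x + y * Complex.I))) =
    ∫ x : ℝ, cgauss α c x * (Complex.cosh (ν * x + t * Complex.I) / Complex.cosh (ν * x)) := by
  have := integral_cgauss_mul_shift hα c (a := y) (b := 0) (M := 1 / Real.cos (ν * |y|))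
    (m := fun z => Complex.cosh (ν * z + t * Complex.I) / Complex.cosh (ν * z))
    (fun z hz => ?_)
    fun z hz => norm_cosh_add_div_cosh_le hν hνy t (abs_le_of_mem_uIcc_zero hz)
  · simpa using this
  · have := cosh_mul_ne_zero hν hνy (abs_le_of_mem_uIcc_zero hz)
    refine DifferentiableAt.differentiableWithinAt ?_
    fun_prop (disch := assumption)

theorem integral_cgauss_div_cosh {α : ℝ} (hα : 0 < α) (c : ℂ) {ν y : ℝ} (hν : 0 < ν)
    (hνy : ν * |y| < Real.pi / 2) :
    ∫ x : ℝ, cgauss α c (x + y * Complex.I) / Complex.cosh (ν * (x + y * Complex.I)) =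
    ∫ x : ℝ, cgauss α c x / Complex.cosh (ν * x) := by
  have hc : 0 < Real.cos (ν * |y|) := Real.cos_pos_of_mem_Ioo
    ⟨by nlinarith [Real.pi_pos, abs_nonneg y], hνy⟩
  have := integral_cgauss_mul_shift hα c (a := y) (b := 0) (M := 1 / Real.cos (ν * |y|))
    (m := fun z => 1 / Complex.cosh (ν * z)) (fun z hz => ?_) fun z hz => ?_
  · simpa [div_eq_mul_inv] using this
  · have := cosh_mul_ne_zero hν hνy (abs_le_of_mem_uIcc_zero hz)
    refine DifferentiableAt.differentiableWithinAt ?_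
    fun_prop (disch := assumption)
  · have h1 := cos_mul_cosh_le_norm_cosh hν hνy (abs_le_of_mem_uIcc_zero hz)
    rw [norm_div, norm_one]
    refine one_div_le_one_div_of_le hc (le_trans ?_ h1)
    exact le_mul_of_one_le_right hc.le (Real.one_le_cosh _)

/-- The two integrals with the phases `cosh (w ∓ iτ) / cosh (w ± iτ)`, `w = ν x`, `τ = ν y`, on
shifted lines add up to a multiple of the Gaussian integral. -/
theorem integral_cross_cosh {α : ℝ} (hα : 0 < α) (c : ℂ) {ν y : ℝ} (hν : 0 < ν)
    (hνy : ν * |y| < Real.pi / 2) :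
    (∫ x : ℝ, cgauss α c (x + y * Complex.I) *
      (Complex.cosh (ν * x - (ν * y : ℝ) * Complex.I) /
        Complex.cosh (ν * x + (ν * y : ℝ) * Complex.I))) +
    (∫ x : ℝ, cgauss α c (x - y * Complex.I) *
      (Complex.cosh (ν * x + (ν * y : ℝ) * Complex.I) /
        Complex.cosh (ν * x - (ν * y : ℝ) * Complex.I))) =
    2 * Complex.cos ((2 * (ν * y) : ℝ)) * ∫ x : ℝ, cgauss α c x := by
  -- With z = x ± iy the quotients become cosh(νz ∓ 2iνy)/cosh(νz), holomorphic for |Im z| ≤ y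
  -- because νy < π/2, so both lines can be moved to the real axis.
  have h1 := integral_cgauss_mul_cosh_div_cosh hα c hν hνy (-(2 * (ν * y)))
  have h2 := integral_cgauss_mul_cosh_div_cosh hα c (y := -y) hν (by simpa using hνy)
    (2 * (ν * y))
  have e1 : ∀ x : ℝ, (ν * x - (ν * y : ℝ) * Complex.I : ℂ) =
      ν * (x + y * Complex.I) + (-(2 * (ν * y)) : ℝ) * Complex.I := fun x => by push_cast; ring
  have e2 : ∀ x : ℝ, (ν * x + (ν * y : ℝ) * Complex.I : ℂ) = ν * (x + y * Complex.I) :=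
    fun x => by push_cast; ring
  have e3 : ∀ x : ℝ, (ν * x + (ν * y : ℝ) * Complex.I : ℂ) =
      ν * (x + (-y : ℝ) * Complex.I) + (2 * (ν * y) : ℝ) * Complex.I := fun x => by push_cast; ring
  have e4 : ∀ x : ℝ, (ν * x - (ν * y : ℝ) * Complex.I : ℂ) = ν * (x + (-y : ℝ) * Complex.I) :=
    fun x => by push_cast; ring
  have e5 : ∀ x : ℝ, (x - y * Complex.I : ℂ) = x + (-y : ℝ) * Complex.I :=
    fun x => by push_cast; ring
  have hint : ∀ t : ℝ, Integrable fun x : ℝ => cgauss α c x *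
      (Complex.cosh (ν * x + t * Complex.I) / Complex.cosh (ν * x)) := by
    intro t
    have := integrable_cgauss_mul hα c 0 (1 / Real.cos (ν * 0))
      (m := fun z => Complex.cosh (ν * z + t * Complex.I) / Complex.cosh (ν * z)) ?_
      fun x => norm_cosh_add_div_cosh_le hν (by simp [Real.pi_pos]) t (by simp)
    · simpa using this
    · refine Continuous.div (by fun_prop) (by fun_prop) fun x => ?_
      exact cosh_mul_ne_zero hν (y := 0) (by simp [Real.pi_pos]) (by simp)
  calc _ = (∫ x : ℝ, cgauss α c x *
        (Complex.cosh (ν * x + (-(2 * (ν * y)) : ℝ) * Complex.I) / Complex.cosh (ν * x))) +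
      ∫ x : ℝ, cgauss α c x *
        (Complex.cosh (ν * x + (2 * (ν * y) : ℝ) * Complex.I) / Complex.cosh (ν * x)) := by
        rw [← h1, ← h2]
        congr 2 <;> funext x
        · rw [e1, e2]
        · rw [e4, ← e3, e5]
    _ = _ := by
        rw [← integral_add (hint _) (hint _), ← integral_const_mul]
        congr 1 with x
        have : Complex.cosh (ν * x) ≠ 0 :=
          cosh_mul_ne_zero hν (y := 0) (by simp [Real.pi_pos]) (by simp)
        -- The sinh terms of the two addition formulas have opposite signs and cancel.
        rw [Complex.cosh_add, Complex.cosh_add]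
        push_cast
        rw [neg_mul, Complex.cosh_neg, Complex.sinh_neg, Complex.cosh_mul_I]
        field_simp
        ring

/-- Since |sinh(x + iy)|² = sinh²x + sin²y, the origin is the only zero in this strip. -/
theorem sinh_mul_ne_zero {ν : ℝ} {z : ℂ} (hν : 0 < ν) (hz : ν * |z.im| < Real.pi / 2)
    (h0 : z ≠ 0) : Complex.sinh (ν * z) ≠ 0 := by
  intro h
  have h1 := normSq_sinh_add_mul_I (ν * z.re) (ν * z.im)
  rw [← mul_eq_re_add_im, h, norm_zero, zero_pow two_ne_zero] at h1
  have h2 := Real.cos_sq_add_sin_sq (ν * z.im)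
  have h3 := Real.cosh_sq (ν * z.re)
  have h4 : Real.sinh (ν * z.re) = 0 := by
    nlinarith [sq_nonneg (Real.sinh (ν * z.re)), sq_nonneg (Real.sin (ν * z.im))]
  have h5 : Real.sin (ν * z.im) = 0 := by nlinarith [sq_nonneg (Real.sin (ν * z.im))]
  rw [Real.sinh_eq_zero] at h4
  have hz' : |ν * z.im| < Real.pi / 2 := by rwa [abs_mul, abs_of_pos hν]
  rw [Real.sin_eq_zero_iff_of_lt_of_lt (by linarith [(abs_lt.1 hz').1, Real.pi_pos])
    (by linarith [(abs_lt.1 hz').2, Real.pi_pos])] at h5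
  apply h0
  apply Complex.ext
  · simpa [hν.ne'] using h4
  · simpa [hν.ne'] using h5

theorem norm_sinh_add_le (ν t : ℝ) (z : ℂ) :
    ‖Complex.sinh (ν * z + t * Complex.I)‖ ≤ Real.cosh (ν * z.re) := by
  rw [mul_eq_re_add_im, add_assoc, ← add_mul, ← Complex.ofReal_add]
  exact norm_sinh_le _ _

/-- Here cosh ≤ |sinh| + 1, and the 1 is at most |sinh(νx)|/sinh ν once |x| ≥ 1. -/
theorem cosh_le_mul_abs_sinh {ν x : ℝ} (hν : 0 < ν) (hx : 1 ≤ |x|) :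
    Real.cosh (ν * x) ≤ (1 + 1 / Real.sinh ν) * |Real.sinh (ν * x)| := by
  have hs : 0 < Real.sinh ν := Real.sinh_pos_iff.2 hν
  have h1 : Real.sinh ν ≤ |Real.sinh (ν * x)| := by
    rw [Real.abs_sinh, Real.sinh_le_sinh, abs_mul, abs_of_pos hν]
    nlinarith
  have h2 : Real.cosh (ν * x) ≤ |Real.sinh (ν * x)| + 1 := by
    refine le_of_sq_le_sq ?_ (by positivity)
    rw [Real.cosh_sq, ← sq_abs (Real.sinh _)]
    nlinarith [abs_nonneg (Real.sinh (ν * x))]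
  have h3 : 1 ≤ 1 / Real.sinh ν * |Real.sinh (ν * x)| := by
    rw [div_mul_eq_mul_div, one_mul, one_le_div hs]
    exact h1
  linarith

/-- The analogue of `integral_cross_cosh` with `sinh`: the pole at the origin contributes a term that
does not depend on the linear part of the exponent. -/
theorem integral_cross_sinh {α : ℝ} (hα : 0 < α) {ν y : ℝ} (hν : 0 < ν) (hy : 0 < y)
    (hνy : ν * y < Real.pi / 2) : ∃ l : ℂ, ∀ c : ℂ,
    (∫ x : ℝ, cgauss α c (x + y * Complex.I) *
      (Complex.sinh (ν * x - (ν * y : ℝ) * Complex.I) /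
        Complex.sinh (ν * x + (ν * y : ℝ) * Complex.I))) +
    (∫ x : ℝ, cgauss α c (x - y * Complex.I) *
      (Complex.sinh (ν * x + (ν * y : ℝ) * Complex.I) /
        Complex.sinh (ν * x - (ν * y : ℝ) * Complex.I))) =
    2 * Complex.cos ((2 * (ν * y) : ℝ)) * (∫ x : ℝ, cgauss α c x) + l := by
  set m : ℝ → ℂ → ℂ := fun t z => Complex.sinh (ν * z + t * Complex.I) / Complex.sinh (ν * z)
    with hm
  set τ : ℝ := 2 * (ν * y) with hτ
  have habs : ∀ σ : ℝ, |σ| = 1 → |σ * y| = y := fun σ hσ => by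
    rw [abs_mul, hσ, one_mul, abs_of_pos hy]
  have hsin : 0 < Real.sin (ν * y) := Real.sin_pos_of_pos_of_lt_pi (by positivity) (by
    linarith [Real.pi_pos])
  have hne : ∀ σ : ℝ, |σ| = 1 → ∀ x : ℝ,
      Complex.sinh (ν * (x + (σ * y : ℝ) * Complex.I)) ≠ 0 := by
    intro σ hσ x
    refine sinh_mul_ne_zero hν (by simpa [-Complex.ofReal_mul, habs σ hσ] using hνy) fun h => ?_
    have h1 := congrArg Complex.im h
    have h2 := habs σ hσ
    simp only [Complex.add_im, Complex.mul_im, Complex.ofReal_re, Complex.ofReal_im, Complex.I_re,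
      Complex.I_im, Complex.zero_im, mul_one, mul_zero, zero_add, add_zero] at h1
    rw [h1, abs_zero] at h2
    exact hy.ne h2
  have hint : ∀ (c : ℂ) (σ t : ℝ), |σ| = 1 → Integrable fun x : ℝ =>
      cgauss α c (x + (σ * y : ℝ) * Complex.I) * m t (x + (σ * y : ℝ) * Complex.I) := by
    intro c σ t hσ
    refine integrable_cgauss_mul hα c _ (1 / Real.sin (ν * y)) ?_ fun x => ?_
    · exact Continuous.div (by fun_prop) (by fun_prop) (hne σ hσ)
    · rw [hm, norm_div]
      have h1 := norm_sinh_add_le ν t (x + (σ * y : ℝ) * Complex.I)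
      have h2 := abs_sin_mul_cosh_le (ν * x) (ν * (σ * y))
      have h3 : |Real.sin (ν * (σ * y))| = Real.sin (ν * y) := by
        rcases eq_or_eq_neg_of_abs_eq hσ with rfl | rfl <;> simp [abs_of_pos hsin]
      rw [h3] at h2
      have h4 : (ν * (x + (σ * y : ℝ) * Complex.I) : ℂ) =
          (ν * x : ℝ) + (ν * (σ * y) : ℝ) * Complex.I := by push_cast; ring
      rw [← h4] at h2
      have h5 := Real.cosh_pos (ν * x)
      simp only [Complex.add_re, Complex.mul_re, Complex.ofReal_re, Complex.ofReal_im, Complex.I_re,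
        Complex.I_im, mul_zero, mul_one, sub_zero, add_zero] at h1
      rw [div_le_div_iff₀ ((mul_pos hsin h5).trans_le h2) hsin]
      nlinarith
  -- Subtracting the Gaussian with c = 0 produces a zero at the origin that cancels the pole of
  -- 1/sinh. The line Im z = y can then be moved to Im z = -y without a residue.
  have hshift : ∀ c : ℂ,
      ∫ x : ℝ, (cgauss α c (x + y * Complex.I) - cgauss α 0 (x + y * Complex.I)) *
        m (-τ) (x + y * Complex.I) =
      ∫ x : ℝ, (cgauss α c (x + (-y : ℝ) * Complex.I) - cgauss α 0 (x + (-y : ℝ) * Complex.I)) *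
        m (-τ) (x + (-y : ℝ) * Complex.I) := by
    intro c
    set g : ℂ → ℂ := fun z => cgauss α c z - cgauss α 0 z with hg
    set S : ℂ → ℂ := fun z => Complex.sinh (ν * z) with hS
    -- The quotient of the difference quotients of g and sinh(ν·) fills in the removable
    -- singularity.
    set f : ℂ → ℂ := fun z => dslope g 0 z / dslope S 0 z *
      Complex.sinh (ν * z + (-τ : ℝ) * Complex.I) with hf
    have hfm : ∀ z : ℂ, z ≠ 0 → f z = g z * m (-τ) z := by
      intro z hz
      have hg0 : g 0 = 0 := by simp [hg, cgauss]
      have hS0 : S 0 = 0 := by simp [hS]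
      rw [hf]
      simp only [dslope_of_ne _ hz, slope_def_field, hg0, hS0, sub_zero, hm]
      rw [div_div_div_cancel_right₀ hz]
      ring
    have hline : ∀ σ : ℝ, |σ| = 1 → ∀ x : ℝ, (x + (σ * y : ℝ) * Complex.I : ℂ) ≠ 0 := by
      intro σ hσ x h
      exact hne σ hσ x (by rw [h]; simp)
    have hcong : ∀ σ : ℝ, |σ| = 1 → (fun x : ℝ => f (x + (σ * y : ℝ) * Complex.I)) =
        fun x : ℝ => g (x + (σ * y : ℝ) * Complex.I) * m (-τ) (x + (σ * y : ℝ) * Complex.I) :=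
      fun σ hσ => funext fun x => hfm _ (hline σ hσ x)
    have hI : ∀ σ : ℝ, |σ| = 1 → Integrable fun x : ℝ => f (x + (σ * y : ℝ) * Complex.I) := by
      intro σ hσ
      rw [hcong σ hσ]
      simp only [hg, sub_mul]
      exact (hint c σ _ hσ).sub (hint 0 σ _ hσ)
    have h1 := hcong 1 (by simp)
    have h2 := hcong (-1) (by simp)
    have h3 := hI 1 (by simp)
    have h4 := hI (-1) (by simp)
    simp only [one_mul, neg_one_mul] at h1 h2 h3 h4
    refine (congrArg (fun F : ℝ → ℂ => ∫ x, F x) h1).symm.trans (Eq.trans ?_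
      (congrArg (fun F : ℝ → ℂ => ∫ x, F x) h2))
    have hstrip : ∀ z : ℂ, z.im ∈ uIcc y (-y) → |z.im| ≤ y := by
      intro z hz
      rw [uIcc_of_ge (by linarith)] at hz
      exact abs_le.2 hz
    refine integral_line_shift (M := 2 * (1 + 1 / Real.sinh ν))
      (C := ‖c‖ + α * y ^ 2 + ‖c‖ * y) hα ?_ (fun z hz h1 => ?_) h3 h4
    · intro z hz
      have hd : ∀ F : ℂ → ℂ, Differentiable ℂ F → DifferentiableAt ℂ (dslope F 0) z := by
        intro F hF
        exact ((Complex.differentiableOn_dslope (s := univ) Filter.univ_mem).2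
          hF.differentiableOn).differentiableAt Filter.univ_mem
      have hSz : dslope S 0 z ≠ 0 := by
        rcases eq_or_ne z 0 with rfl | h0
        · have : HasDerivAt S (Complex.cosh (ν * 0) * (ν * 1)) 0 :=
            ((hasDerivAt_id (0 : ℂ)).const_mul (ν : ℂ)).csinh
          rw [dslope_same, this.deriv]
          simpa using hν.ne'
        · rw [dslope_of_ne _ h0, slope_def_field]
          simp only [hS, mul_zero, Complex.sinh_zero, sub_zero]
          refine div_ne_zero (sinh_mul_ne_zero hν (lt_of_le_of_lt ?_ hνy) h0) h0
          gcongr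
          exact hstrip z hz
      have hgd : Differentiable ℂ g :=
        (differentiable_cgauss α c).sub (differentiable_cgauss α 0)
      have hSd : Differentiable ℂ S := by fun_prop
      refine DifferentiableAt.differentiableWithinAt ?_
      exact ((hd g hgd).div (hd S hSd) hSz).mul (by fun_prop)
    · have h0 : z ≠ 0 := by rintro rfl; norm_num at h1
      rw [hfm z h0, norm_mul, ← mul_assoc, mul_comm _ (2 : ℝ)]
      have hz' := hstrip z hz
      gcongr
      · refine (norm_sub_le _ _).trans ?_
        have a1 := norm_cgauss_le_of_strip hα (le_refl ‖c‖) hz'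
        have a2 := norm_cgauss_le_of_strip hα (c := 0) (K := ‖c‖) (by simp) hz'
        linarith
      · rw [hm, norm_div]
        have b1 := norm_sinh_add_le ν (-τ) z
        have b2 := abs_sinh_le_norm_sinh (ν * z.re) (ν * z.im)
        rw [← mul_eq_re_add_im] at b2
        have b3 := cosh_le_mul_abs_sinh hν h1
        have b4 : 0 < Real.sinh ν := Real.sinh_pos_iff.2 hν
        have b5 := Real.cosh_pos (ν * z.re)
        have b6 : 0 < 1 + 1 / Real.sinh ν := by positivity
        have b7 : 0 < |Real.sinh (ν * z.re)| := by
          by_contra hcon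
          nlinarith [abs_nonneg (Real.sinh (ν * z.re))]
        rw [div_le_iff₀ (b7.trans_le b2)]
        nlinarith
  -- On the lower line the two quotients, with shifts -τ and τ, add up to the constant 2 cos τ.
  have hsum : ∀ (c : ℂ) (x : ℝ), cgauss α c (x + (-1 * y : ℝ) * Complex.I) *
      m (-τ) (x + (-1 * y : ℝ) * Complex.I) + cgauss α c (x + (-1 * y : ℝ) * Complex.I) *
      m τ (x + (-1 * y : ℝ) * Complex.I) =
      2 * Complex.cos (τ : ℝ) * cgauss α c (x + (-1 * y : ℝ) * Complex.I) := by
    intro c x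
    have h0 := hne (-1) (by simp) x
    simp only [hm]
    rw [Complex.sinh_add, Complex.sinh_add, Complex.ofReal_neg, neg_mul (τ : ℂ), Complex.cosh_neg,
      Complex.sinh_neg, Complex.cosh_mul_I]
    have key : ∀ G S C p q : ℂ, S ≠ 0 →
        G * ((S * p + C * -q) / S) + G * ((S * p + C * q) / S) = 2 * p * G := by
      intro G S C p q hS
      field_simp
      ring
    exact key _ _ _ _ _ h0
  -- The last bracket is the promised l: the pole contribution, written as a difference of the c = 0
  -- integrals over the two lines and never evaluated.
  have hL : ∀ c : ℂ, (∫ x : ℝ, cgauss α c (x + (1 * y : ℝ) * Complex.I) *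
        m (-τ) (x + (1 * y : ℝ) * Complex.I)) +
      (∫ x : ℝ, cgauss α c (x + (-1 * y : ℝ) * Complex.I) * m τ (x + (-1 * y : ℝ) * Complex.I)) =
      2 * Complex.cos (τ : ℝ) * (∫ x : ℝ, cgauss α c x) +
      ((∫ x : ℝ, cgauss α 0 (x + (1 * y : ℝ) * Complex.I) *
        m (-τ) (x + (1 * y : ℝ) * Complex.I)) -
      ∫ x : ℝ, cgauss α 0 (x + (-1 * y : ℝ) * Complex.I) *
        m (-τ) (x + (-1 * y : ℝ) * Complex.I)) := by
    intro c
    have h1 := hshift c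
    have i1 : ∀ c t, _ := fun c t => hint c 1 t (by simp)
    have i2 : ∀ c t, _ := fun c t => hint c (-1) t (by simp)
    have h2 := integral_add (i2 c (-τ)) (i2 c τ)
    simp only [hsum] at h2
    rw [integral_const_mul, integral_cgauss_line hα] at h2
    simp only [one_mul, neg_one_mul, sub_mul] at h1 h2 i1 i2 ⊢
    rw [integral_sub (i1 c _) (i1 0 _), integral_sub (i2 c _) (i2 0 _)] at h1
    linear_combination h1 - h2
  refine Exists.intro _ fun c => Eq.trans ?_ (hL c)
  congr 2 <;> funext x
  · have e1 : (ν * x - (ν * y : ℝ) * Complex.I : ℂ) =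
        ν * (x + (1 * y : ℝ) * Complex.I) + (-τ : ℝ) * Complex.I := by rw [hτ]; push_cast; ring
    have e2 : (ν * x + (ν * y : ℝ) * Complex.I : ℂ) = ν * (x + (1 * y : ℝ) * Complex.I) := by
      push_cast; ring
    rw [e1, e2, one_mul]
  · have e1 : (ν * x + (ν * y : ℝ) * Complex.I : ℂ) =
        ν * (x + (-1 * y : ℝ) * Complex.I) + (τ : ℝ) * Complex.I := by rw [hτ]; push_cast; ring
    have e2 : (ν * x - (ν * y : ℝ) * Complex.I : ℂ) = ν * (x + (-1 * y : ℝ) * Complex.I) := by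
      push_cast; ring
    have e3 : (x - y * Complex.I : ℂ) = x + (-1 * y : ℝ) * Complex.I := by push_cast; ring
    rw [e1, e2, e3]

/-! ### Operators on `L²` given by maps of functions -/

-- For a map given by a pointwise formula, additivity and homogeneity hold exactly on functions.
-- Only compatibility with almost everywhere equality and the norm bound remain to be checked.
open scoped NNReal in
theorem exists_clm_of_ae {μ ν : Measure ℝ} (T : (ℝ → ℂ) → ℝ → ℂ)
    (hae : ∀ f g, f =ᵐ[ν] g → T f =ᵐ[μ] T g) (hadd : ∀ f g, T (f + g) = T f + T g)
    (hsmul : ∀ (c : ℂ) f, T (c • f) = c • T f) (C : ℝ≥0)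
    (hT : ∀ f, MemLp f 2 ν → MemLp (T f) 2 μ ∧ eLpNorm (T f) 2 μ ≤ C * eLpNorm f 2 ν) :
    ∃ L : Lp ℂ 2 ν →L[ℂ] Lp ℂ 2 μ, ∀ f, L f =ᵐ[μ] T f := by
  let L₀ : Lp ℂ 2 ν →ₗ[ℂ] Lp ℂ 2 μ :=
    { toFun := fun f => (hT f (Lp.memLp f)).1.toLp _
      map_add' := by
        intro f g
        rw [← MemLp.toLp_add]
        exact MemLp.toLp_congr _ _ ((hae _ _ (Lp.coeFn_add f g)).trans (by rw [hadd]))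
      map_smul' := by
        intro c f
        rw [RingHom.id_apply, ← MemLp.toLp_const_smul]
        exact MemLp.toLp_congr _ _ ((hae _ _ (Lp.coeFn_smul c f)).trans (by rw [hsmul])) }
  refine ⟨L₀.mkContinuous C fun f => ?_, fun f => (hT f (Lp.memLp f)).1.coeFn_toLp⟩
  change ‖(hT f (Lp.memLp f)).1.toLp _‖ ≤ _
  rw [Lp.norm_toLp, Lp.norm_def, ← ENNReal.coe_toReal, ← ENNReal.toReal_mul]
  exact ENNReal.toReal_mono (ENNReal.mul_ne_top ENNReal.coe_ne_top (Lp.eLpNorm_ne_top f))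
    (hT f (Lp.memLp f)).2

open Classical in
/-- The class in `L²(ℝ)` of a square integrable function. -/
def toL2 (f : ℝ → ℂ) : PositionSpace := if h : MemLp f 2 volume then h.toLp f else 0

theorem toL2_eq {f : ℝ → ℂ} (h : MemLp f 2 volume) : toL2 f = h.toLp f := dif_pos h

theorem toL2_ae {f : ℝ → ℂ} (h : MemLp f 2 volume) : toL2 f =ᵐ[volume] f := by
  rw [toL2_eq h]; exact h.coeFn_toLp

/-- Square integrability is inherited from F, so the default value 0 of `toL2` does not intervene.
-/
theorem eq_toL2 {f : ℝ → ℂ} {F : PositionSpace} (h : F =ᵐ[volume] f) : F = toL2 f := by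
  have hf : MemLp f 2 volume := (memLp_congr_ae h).1 (Lp.memLp F)
  exact Lp.ext (h.trans (toL2_ae hf).symm)

theorem inner_eq_integral (f g : PositionSpace) : inner ℂ f g = ∫ x, conj (f x) * g x := by
  rw [L2.inner_def]
  congr 1 with x
  simp [mul_comm]

theorem inner_toL2 {f g : ℝ → ℂ} (hf : MemLp f 2 volume) (hg : MemLp g 2 volume) :
    inner ℂ (toL2 f) (toL2 g) = ∫ x, conj (f x) * g x := by
  rw [inner_eq_integral]
  refine integral_congr_ae ?_
  filter_upwards [toL2_ae hf, toL2_ae hg] with x h1 h2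
  rw [h1, h2]

/-- Bounded continuous complex-valued functions on the line. -/
structure IsMultiplier (m : ℝ → ℂ) : Prop where
  cont : Continuous m
  bdd : ∃ C : ℝ, ∀ x, ‖m x‖ ≤ C

theorem IsMultiplier.conj {m : ℝ → ℂ} (hm : IsMultiplier m) :
    IsMultiplier fun x => conj (m x) :=
  ⟨Complex.continuous_conj.comp hm.cont, by simpa using hm.bdd⟩

theorem IsMultiplier.comp_neg {m : ℝ → ℂ} (hm : IsMultiplier m) :
    IsMultiplier fun x => m (-x) :=
  ⟨hm.cont.comp continuous_neg, hm.bdd.imp fun _ h x => h (-x)⟩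

theorem IsMultiplier.memLp {m f : ℝ → ℂ} {μ : Measure ℝ} (hm : IsMultiplier m)
    (hf : MemLp f 2 μ) : MemLp (fun x => m x * f x) 2 μ := by
  obtain ⟨C, hC⟩ := hm.bdd
  exact hf.of_le_mul (hm.cont.aestronglyMeasurable.mul hf.1) (c := C)
    (ae_of_all _ fun x => by rw [norm_mul]; gcongr; exact hC x)

theorem IsMultiplier.exists_clm {m : ℝ → ℂ} (hm : IsMultiplier m) :
    ∃ L : PositionSpace →L[ℂ] PositionSpace, ∀ f, L f =ᵐ[volume] fun x => m x * f x := by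
  obtain ⟨C, hC⟩ := hm.bdd
  refine exists_clm_of_ae (fun f x => m x * f x) (fun f g h => ?_) (fun f g => ?_) (fun c f => ?_)
    C.toNNReal fun f hf => ⟨hm.memLp hf, ?_⟩
  · filter_upwards [h] with x hx
    rw [hx]
  · funext x; simp [mul_add]
  · funext x; simp; ring
  · exact eLpNorm_le_mul_eLpNorm_of_ae_le_mul (ae_of_all _ fun x => by
      rw [norm_mul]; gcongr; exact hC x) 2

open Classical in
/-- Multiplication by a bounded continuous function. -/
def mulOp (m : ℝ → ℂ) : PositionSpace →L[ℂ] PositionSpace :=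
  if hm : IsMultiplier m then hm.exists_clm.choose else 0

theorem mulOp_ae {m : ℝ → ℂ} (hm : IsMultiplier m) (f : PositionSpace) :
    mulOp m f =ᵐ[volume] fun x => m x * f x := by
  rw [mulOp, dif_pos hm]; exact hm.exists_clm.choose_spec f

theorem mulOp_toL2 {m f : ℝ → ℂ} (hm : IsMultiplier m) (hf : MemLp f 2 volume) :
    mulOp m (toL2 f) = toL2 fun x => m x * f x := by
  refine eq_toL2 ?_
  filter_upwards [mulOp_ae hm (toL2 f), toL2_ae hf] with x h1 h2
  rw [h1, h2]

theorem adjoint_mulOp {m : ℝ → ℂ} (hm : IsMultiplier m) :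
    (mulOp m).adjoint = mulOp fun x => conj (m x) := by
  symm
  rw [ContinuousLinearMap.eq_adjoint_iff]
  intro f g
  rw [inner_eq_integral, inner_eq_integral]
  refine integral_congr_ae ?_
  filter_upwards [mulOp_ae hm g, mulOp_ae hm.conj f] with x h1 h2
  rw [h1, h2, map_mul, Complex.conj_conj]
  ring

/-- The reflection `f(x) ↦ f(-x)`. -/
def reflOp : PositionSpace →L[ℂ] PositionSpace :=
  (Lp.compMeasurePreservingₗᵢ ℂ (fun x : ℝ => -x)
    (Measure.measurePreserving_neg volume)).toContinuousLinearMap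

theorem reflOp_ae (f : PositionSpace) : reflOp f =ᵐ[volume] fun x => f (-x) :=
  Lp.coeFn_compMeasurePreserving f (Measure.measurePreserving_neg volume)

theorem memLp_comp_neg {f : ℝ → ℂ} (hf : MemLp f 2 volume) :
    MemLp (fun x => f (-x)) 2 volume :=
  hf.comp_measurePreserving (Measure.measurePreserving_neg volume)

theorem ae_comp_neg {p : ℝ → Prop} (h : ∀ᵐ x, p x) : ∀ᵐ x, p (-x) :=
  (Measure.measurePreserving_neg (volume : Measure ℝ)).quasiMeasurePreserving.ae h

theorem reflOp_toL2 {f : ℝ → ℂ} (hf : MemLp f 2 volume) :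
    reflOp (toL2 f) = toL2 fun x => f (-x) := by
  refine eq_toL2 ?_
  filter_upwards [reflOp_ae (toL2 f), ae_comp_neg (toL2_ae hf)] with x h1 h2
  rw [h1, h2]

theorem reflOp_reflOp (f : PositionSpace) : reflOp (reflOp f) = f := by
  refine Lp.ext ?_
  filter_upwards [reflOp_ae (reflOp f), ae_comp_neg (reflOp_ae f)] with x h1 h2
  rw [h1, h2, neg_neg]

theorem inner_reflOp_left (f g : PositionSpace) :
    inner ℂ (reflOp f) g = inner ℂ f (reflOp g) := by
  have h := LinearIsometry.inner_map_map (Lp.compMeasurePreservingₗᵢ ℂ (fun x : ℝ => -x)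
    (Measure.measurePreserving_neg volume)) f (reflOp g)
  change inner ℂ (reflOp f) (reflOp (reflOp g)) = _ at h
  rwa [reflOp_reflOp] at h

theorem reflOp_mulOp {m : ℝ → ℂ} (hm : IsMultiplier m) (f : PositionSpace) :
    reflOp (mulOp m f) = mulOp (fun x => m (-x)) (reflOp f) := by
  refine Lp.ext ?_
  filter_upwards [reflOp_ae (mulOp m f), ae_comp_neg (mulOp_ae hm f),
    mulOp_ae hm.comp_neg (reflOp f), reflOp_ae f] with x h1 h2 h3 h4
  rw [h1, h2, h3, h4]

/-! ### The Fourier transform with kernel `(2π)^{-1/2} e^{irk}` -/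

-- The L² transform is not defined by an integral, so the two sides are compared by pairing with
-- smooth compactly supported g. On the left the transform passes to g as for tempered
-- distributions; on the right it does so by Fubini.
open FourierTransform SchwartzMap in
theorem fourierInv_toLp_ae {f : ℝ → ℂ} (h1 : Integrable f) (h2 : MemLp f 2 volume) :
    (𝓕⁻ (h2.toLp f) : Lp ℂ 2 (volume : Measure ℝ)) =ᵐ[volume] (𝓕⁻ f : ℝ → ℂ) := by
  have hcont : Continuous (𝓕⁻ f : ℝ → ℂ) :=
    VectorFourier.fourierIntegral_continuous (L := -innerₗ ℝ) Real.continuous_fourierChar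
      (by simpa using! continuous_inner.neg) h1
  refine ae_eq_of_integral_contDiff_smul_eq
    ((Lp.memLp _).locallyIntegrable (by norm_num)) hcont.locallyIntegrable fun g hg hgc => ?_
  have hg₁ : HasCompactSupport (Complex.ofRealCLM ∘ g) := hgc.comp_left rfl
  have hg₂ : ContDiff ℝ ∞ (Complex.ofRealCLM ∘ g) := by fun_prop
  set G : 𝓢(ℝ, ℂ) := hg₁.toSchwartzMap hg₂ with hG
  have hGx : ∀ x, G x = (g x : ℂ) := fun x => rfl
  have e1 : ∫ x, g x • (𝓕⁻ (h2.toLp f) : Lp ℂ 2 (volume : Measure ℝ)) x =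
      Lp.toTemperedDistribution (𝓕⁻ (h2.toLp f)) G := by
    simp [hGx]
  rw [e1, ← Lp.fourierInv_toTemperedDistribution_eq, TemperedDistribution.fourierInv_apply,
    Lp.toTemperedDistribution_apply]
  have e2 : ∫ x, (𝓕⁻ G) x • (h2.toLp f) x = ∫ x, (𝓕⁻ (G : ℝ → ℂ)) x • f x := by
    refine integral_congr_ae ?_
    filter_upwards [h2.coeFn_toLp] with x hx
    rw [hx, fourierInv_coe]
  rw [e2]
  have e3 := VectorFourier.integral_fourierIntegral_smul_eq_flip (L := -innerₗ ℝ)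
    (μ := volume) (ν := volume) (f := (G : ℝ → ℂ)) (g := f) Real.continuous_fourierChar
    (by simpa using! continuous_inner.neg) G.integrable h1
  refine e3.trans ?_
  congr 1 with x
  rw [hGx]
  have : (-innerₗ ℝ : ℝ →ₗ[ℝ] ℝ →ₗ[ℝ] ℝ).flip = -innerₗ ℝ := by
    ext; simp
  rw [this]
  rfl

-- A test function g is the Fourier transform of 𝓕⁻g; moving that transform onto f gives ∫ g f = 0.
open FourierTransform SchwartzMap in
theorem ae_eq_zero_of_fourier_eq_zero {f : ℝ → ℂ} (h1 : Integrable f)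
    (h : ∀ w : ℝ, 𝓕 f w = 0) : f =ᵐ[volume] 0 := by
  refine ae_eq_zero_of_integral_contDiff_smul_eq_zero h1.locallyIntegrable fun g hg hgc => ?_
  have hg₁ : HasCompactSupport (Complex.ofRealCLM ∘ g) := hgc.comp_left rfl
  have hg₂ : ContDiff ℝ ∞ (Complex.ofRealCLM ∘ g) := by fun_prop
  set G : 𝓢(ℝ, ℂ) := hg₁.toSchwartzMap hg₂ with hG
  have e3 := VectorFourier.integral_fourierIntegral_smul_eq_flip (L := innerₗ ℝ)
    (μ := volume) (ν := volume) (f := (𝓕⁻ G : 𝓢(ℝ, ℂ))) (g := f) Real.continuous_fourierChar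
    (by simpa using! continuous_inner) (𝓕⁻ G).integrable h1
  rw [flip_innerₗ] at e3
  have e4 : ∀ x, VectorFourier.fourierIntegral Real.fourierChar volume (innerₗ ℝ)
      (𝓕⁻ G : 𝓢(ℝ, ℂ)) x = (g x : ℂ) := by
    intro x
    change 𝓕 ((𝓕⁻ G : 𝓢(ℝ, ℂ)) : ℝ → ℂ) x = _
    rw [← fourier_coe, FourierTransform.fourier_fourierInv_eq]
    rfl
  have e5 : ∀ x, VectorFourier.fourierIntegral Real.fourierChar volume (innerₗ ℝ) f x = 0 := h
  simpa [e4, e5] using e3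

-- The dilation with a = 1/(2π) turns the normalisation e^{2πirk} into (2π)^{-1/2} e^{irk}.
open scoped NNReal ENNReal in
theorem exists_scaling {a : ℝ} (ha : 0 < a) :
    ∃ L : PositionSpace →L[ℂ] PositionSpace,
      (∀ f, L f =ᵐ[volume] fun x => (√a : ℂ) * f (a * x)) ∧ ∀ f, ‖L f‖ = ‖f‖ := by
  have hq : Measure.QuasiMeasurePreserving (fun x : ℝ => a * x) volume volume := by
    refine ⟨by fun_prop, ?_⟩
    rw [Real.map_volume_mul_left ha.ne']
    exact Measure.smul_absolutelyContinuous
  have hnorm : ∀ f : ℝ → ℂ, AEStronglyMeasurable f volume →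
      eLpNorm (fun x => (√a : ℂ) * f (a * x)) 2 volume = eLpNorm f 2 volume := by
    intro f hf
    have h1 : (fun x => (√a : ℂ) * f (a * x)) = (√a : ℂ) • (f ∘ fun x => a * x) := by
      funext x; simp
    rw [h1, eLpNorm_const_smul, ← eLpNorm_map_measure, Real.map_volume_mul_left ha.ne',
      eLpNorm_smul_measure_of_ne_top (by norm_num), smul_eq_mul, ← mul_assoc]
    · have : ‖(√a : ℂ)‖ₑ * ENNReal.ofReal |a⁻¹| ^ (1 / (2 : ℝ≥0∞)).toReal = 1 := by
        have htwo : (1 / (2 : ℝ≥0∞)).toReal = 1 / 2 := by simp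
        rw [htwo, ← ofReal_norm, ENNReal.ofReal_rpow_of_pos (by positivity),
          ← ENNReal.ofReal_mul (norm_nonneg _), ← ENNReal.ofReal_one]
        congr 1
        rw [Complex.norm_real, Real.norm_of_nonneg (Real.sqrt_nonneg _),
          abs_of_pos (inv_pos.2 ha)]
        rw [← Real.sqrt_eq_rpow, ← Real.sqrt_mul ha.le, mul_inv_cancel₀ ha.ne', Real.sqrt_one]
      rw [this, one_mul]
    · rw [Real.map_volume_mul_left ha.ne']
      exact hf.smul_measure _
    · fun_prop
  have hex : ∃ L : PositionSpace →L[ℂ] PositionSpace,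
      ∀ f, L f =ᵐ[volume] fun x => (√a : ℂ) * f (a * x) := by
    refine exists_clm_of_ae (fun f x => (√a : ℂ) * f (a * x)) (fun f g h => ?_) (fun f g => ?_)
      (fun c f => ?_) 1 fun f hf => ⟨⟨?_, ?_⟩, ?_⟩
    · filter_upwards [hq.ae h] with x hx
      rw [hx]
    · funext x; simp [mul_add]
    · funext x; simp; ring
    · exact (hf.1.comp_quasiMeasurePreserving hq).const_mul _
    · rw [hnorm f hf.1]; exact hf.2
    · rw [hnorm f hf.1]; simp
  obtain ⟨L, hL⟩ := hex
  refine ⟨L, hL, fun f => ?_⟩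
  rw [Lp.norm_def, Lp.norm_def, eLpNorm_congr_ae (hL f), hnorm _ (Lp.aestronglyMeasurable f)]

theorem fourier_scale_pos : 0 < (2 * Real.pi)⁻¹ := by positivity

/-- The unitary Fourier transform with kernel `(2π)^{-1/2} e^{irk}`. -/
def fourierOp : PositionSpace →L[ℂ] PositionSpace :=
  (exists_scaling fourier_scale_pos).choose ∘L
    ((Lp.fourierTransformₗᵢ ℝ ℂ).symm.toContinuousLinearEquiv : PositionSpace →L[ℂ] PositionSpace)

theorem norm_fourierOp (f : PositionSpace) : ‖fourierOp f‖ = ‖f‖ := by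
  rw [fourierOp, ContinuousLinearMap.comp_apply,
    (exists_scaling fourier_scale_pos).choose_spec.2]
  exact (Lp.fourierTransformₗᵢ ℝ ℂ).symm.norm_map f

theorem adjoint_fourierOp_apply (f : PositionSpace) : fourierOp.adjoint (fourierOp f) = f := by
  have := (ContinuousLinearMap.norm_map_iff_adjoint_comp_self fourierOp).1 norm_fourierOp
  exact DFunLike.congr_fun this f

open FourierTransform in
theorem fourierOp_toL2 {f : ℝ → ℂ} (h1 : Integrable f) (h2 : MemLp f 2 volume) :
    fourierOp (toL2 f) =ᵐ[volume] fun r : ℝ =>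
      ((1 / √(2 * Real.pi) : ℝ) : ℂ) * ∫ k : ℝ, Complex.exp (Complex.I * r * k) * f k := by
  have hq : Measure.QuasiMeasurePreserving (fun x : ℝ => (2 * Real.pi)⁻¹ * x) volume volume := by
    refine ⟨by fun_prop, ?_⟩
    rw [Real.map_volume_mul_left fourier_scale_pos.ne']
    exact Measure.smul_absolutelyContinuous
  filter_upwards [(exists_scaling fourier_scale_pos).choose_spec.1 (𝓕⁻ (toL2 f)),
    hq.ae (fourierInv_toLp_ae h1 h2)] with r hr1 hr2
  have e : fourierOp (toL2 f) = (exists_scaling fourier_scale_pos).choose (𝓕⁻ (toL2 f)) := rfl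
  rw [e, hr1, toL2_eq h2, hr2, Real.fourierInv_eq']
  congr 1
  · simp
  · congr 1 with k
    rw [smul_eq_mul]
    congr 2
    have : 2 * Real.pi * inner ℝ k ((2 * Real.pi)⁻¹ * r) = r * k := by
      simp; field_simp
    rw [this]; push_cast; ring

/-! ### Gaussians in `L²` -/

/-- The Gaussian `exp (-x²/2 + c x)` on the real line. -/
def gaussFn (c : ℂ) (x : ℝ) : ℂ := cgauss (1 / 2) c x

theorem continuous_gaussFn (c : ℂ) : Continuous (gaussFn c) :=
  (continuous_cgauss _ c).comp Complex.continuous_ofReal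

theorem exp_mul_gaussFn (d c : ℂ) (x : ℝ) :
    Complex.exp (d * x) * gaussFn c x = gaussFn (c + d) x := by
  rw [gaussFn, gaussFn, cgauss, cgauss, ← Complex.exp_add]
  congr 1; ring

theorem conj_gaussFn_mul (a b : ℂ) (x : ℝ) :
    conj (gaussFn a x) * gaussFn b x = cgauss 1 (conj a + b) x := by
  rw [gaussFn, gaussFn, cgauss, cgauss, cgauss, ← Complex.exp_conj, ← Complex.exp_add]
  congr 1
  simp only [map_add, map_mul, map_neg, map_pow, Complex.conj_ofReal]
  push_cast; ring

theorem gaussFn_neg (c : ℂ) (x : ℝ) : gaussFn c (-x) = gaussFn (-c) x := by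
  rw [gaussFn, gaussFn, cgauss, cgauss]
  congr 1; push_cast; ring

theorem integrable_gaussFn (c : ℂ) : Integrable (gaussFn c) := by
  have h := integrable_cgauss (α := 1 / 2) (by norm_num) c 0
  simp only [Complex.ofReal_zero, zero_mul, add_zero] at h
  exact h

theorem memLp_gaussFn (c : ℂ) : MemLp (gaussFn c) 2 volume := by
  rw [memLp_two_iff_integrable_sq_norm (continuous_gaussFn c).aestronglyMeasurable]
  have h := (integrable_cgauss one_pos (conj c + c) 0).norm
  refine h.congr (ae_of_all _ fun x => ?_)
  simp only [Complex.ofReal_zero, zero_mul, add_zero]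
  rw [← conj_gaussFn_mul, norm_mul, RCLike.norm_conj, sq]

theorem integral_gaussFn (c : ℂ) :
    ∫ x, gaussFn c x = (√(2 * Real.pi) : ℝ) * Complex.exp (c ^ 2 / 2) := by
  have h := integral_cexp_quadratic (b := -((1 / 2 : ℝ) : ℂ)) (by simp) c 0
  simp only [add_zero, zero_sub] at h
  refine h.trans ?_
  congr 1
  · rw [Real.sqrt_eq_rpow, Complex.ofReal_cpow (by positivity)]
    push_cast
    congr 1
    field_simp
  · congr 1
    push_cast
    field_simp
    norm_num

theorem fourierOp_gaussFn (c : ℂ) : fourierOp (toL2 (gaussFn c)) =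
    toL2 fun r => Complex.exp (c ^ 2 / 2) * gaussFn (Complex.I * c) r := by
  refine eq_toL2 ((fourierOp_toL2 (integrable_gaussFn c) (memLp_gaussFn c)).trans
    (ae_of_all _ fun r => ?_))
  simp only [exp_mul_gaussFn]
  rw [integral_gaussFn, ← mul_assoc, ← Complex.ofReal_mul, one_div_mul_cancel (by positivity),
    Complex.ofReal_one, one_mul, gaussFn, cgauss, ← Complex.exp_add]
  congr 1
  push_cast
  linear_combination (r ^ 2 / 2 : ℂ) * Complex.I_sq

theorem toL2_const_mul {f : ℝ → ℂ} (hf : MemLp f 2 volume) (c : ℂ) :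
    toL2 (fun x => c * f x) = c • toL2 f := by
  symm
  refine eq_toL2 ?_
  filter_upwards [Lp.coeFn_smul c (toL2 f), toL2_ae hf] with x h1 h2
  rw [h1, Pi.smul_apply, h2, smul_eq_mul]

theorem memLp_fun_add {f g : ℝ → ℂ} (hf : MemLp f 2 volume) (hg : MemLp g 2 volume) :
    MemLp (fun x => f x + g x) 2 volume := hf.add hg

theorem toL2_add {f g : ℝ → ℂ} (hf : MemLp f 2 volume) (hg : MemLp g 2 volume) :
    toL2 (fun x => f x + g x) = toL2 f + toL2 g := by
  symm
  refine eq_toL2 ?_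
  filter_upwards [Lp.coeFn_add (toL2 f) (toL2 g), toL2_ae hf, toL2_ae hg] with x h1 h2 h3
  rw [h1, Pi.add_apply, h2, h3]

/-- Surjectivity of U is not needed: the Gaussian with parameter c is a multiple of the image of the
one with parameter -ic, and U*U = 1. -/
theorem adjoint_fourierOp_gaussFn (c : ℂ) : fourierOp.adjoint (toL2 (gaussFn c)) =
    toL2 fun k => Complex.exp (c ^ 2 / 2) * gaussFn (-(Complex.I * c)) k := by
  have h := fourierOp_gaussFn (-(Complex.I * c))
  have e1 : Complex.I * -(Complex.I * c) = c := by
    linear_combination -c * Complex.I_sq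
  have e2 : (-(Complex.I * c)) ^ 2 / 2 = -(c ^ 2 / 2) := by
    linear_combination (c ^ 2 / 2) * Complex.I_sq
  rw [e1, e2, toL2_const_mul (memLp_gaussFn c)] at h
  have h2 : toL2 (gaussFn c) =
      fourierOp (Complex.exp (c ^ 2 / 2) • toL2 (gaussFn (-(Complex.I * c)))) := by
    rw [map_smul, h, smul_smul, ← Complex.exp_add, add_neg_cancel, Complex.exp_zero, one_smul]
  rw [h2, adjoint_fourierOp_apply, toL2_const_mul (memLp_gaussFn _)]

open FourierTransform in
/-- Modulated Gaussians times a fixed nonvanishing weight span a dense subspace of `L²(ℝ)`. -/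
theorem eq_zero_of_inner_gaussFn {m : ℝ → ℂ} (hm0 : ∀ x, m x ≠ 0)
    (hm : ∀ c, MemLp (fun x => m x * gaussFn c x) 2 volume) {h : PositionSpace}
    (hh : ∀ b : ℂ, inner ℂ (toL2 fun x => m x * gaussFn b x) h = 0) : h = 0 := by
  have hint : Integrable fun x => conj (m x * gaussFn 0 x) * h x :=
    (hm 0).star.integrable_mul (Lp.memLp h)
  have hz := ae_eq_zero_of_fourier_eq_zero hint fun w => by
    -- For b = 2πiw the pairing is the Fourier transform at w of conj(m · `gaussFn 0`) · h, so this
    -- integrable function vanishes almost everywhere.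
    have h1 := hh (Complex.I * (2 * Real.pi * w : ℝ))
    rw [inner_eq_integral] at h1
    rw [Real.fourier_eq']
    refine Eq.trans (integral_congr_ae ?_) h1
    filter_upwards [toL2_ae (hm (Complex.I * (2 * Real.pi * w : ℝ)))] with x hx
    rw [hx, smul_eq_mul, ← mul_assoc, ← zero_add (Complex.I * _), ← exp_mul_gaussFn]
    congr 1
    simp only [map_mul, ← Complex.exp_conj, Complex.conj_I, Complex.conj_ofReal]
    have : ((-2 * Real.pi * inner ℝ x w : ℝ) : ℂ) * Complex.I =
        -Complex.I * (2 * Real.pi * w : ℝ) * x := by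
      simp; ring
    rw [this]; ring
  refine Lp.ext ?_
  filter_upwards [hz, Lp.coeFn_zero ℂ 2 (volume : Measure ℝ)] with x hx h0
  rw [h0]
  refine (mul_eq_zero.1 hx).resolve_left ?_
  rw [← ne_eq, map_ne_zero]
  exact mul_ne_zero (hm0 x) (Complex.exp_ne_zero _)

theorem clm_ext_gaussFn {m : ℝ → ℂ} (hm0 : ∀ x, m x ≠ 0)
    (hm : ∀ c, MemLp (fun x => m x * gaussFn c x) 2 volume)
    {S T : PositionSpace →L[ℂ] PositionSpace}
    (h : ∀ b : ℂ, S (toL2 fun x => m x * gaussFn b x) = T (toL2 fun x => m x * gaussFn b x)) :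
    S = T := by
  have hadj : (S - T).adjoint = 0 := by
    ext1 g
    refine eq_zero_of_inner_gaussFn hm0 hm fun b => ?_
    rw [ContinuousLinearMap.adjoint_inner_right, sub_apply, h b, sub_self,
      inner_zero_left]
  have := congrArg ContinuousLinearMap.adjoint hadj
  rwa [ContinuousLinearMap.adjoint_adjoint, map_zero, sub_eq_zero] at this

theorem clm_ext_inner_gaussFn {m : ℝ → ℂ} (hm0 : ∀ x, m x ≠ 0)
    (hm : ∀ c, MemLp (fun x => m x * gaussFn c x) 2 volume)
    {S T : PositionSpace →L[ℂ] PositionSpace}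
    (h : ∀ a b : ℂ,
      inner ℂ (toL2 fun x => m x * gaussFn a x) (S (toL2 fun x => m x * gaussFn b x)) =
      inner ℂ (toL2 fun x => m x * gaussFn a x) (T (toL2 fun x => m x * gaussFn b x))) :
    S = T := by
  refine clm_ext_gaussFn hm0 hm fun b => ?_
  rw [← sub_eq_zero]
  refine eq_zero_of_inner_gaussFn hm0 hm fun a => ?_
  rw [inner_sub_right, h a b, sub_self]

theorem fourierOp_reflOp (f : PositionSpace) :
    fourierOp (reflOp f) = reflOp (fourierOp f) := by
  have hm : ∀ c, MemLp (fun x => (1 : ℂ) * gaussFn c x) 2 volume := by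
    simpa using memLp_gaussFn
  have h : fourierOp ∘L reflOp = reflOp ∘L fourierOp := by
    refine clm_ext_gaussFn (m := fun _ => 1) (by simp) hm fun b => ?_
    simp only [one_mul, ContinuousLinearMap.comp_apply]
    have e := reflOp_toL2 (memLp_gaussFn b)
    simp only [gaussFn_neg] at e
    change reflOp (toL2 (gaussFn b)) = toL2 (gaussFn (-b)) at e
    change fourierOp (reflOp (toL2 (gaussFn b))) = reflOp (fourierOp (toL2 (gaussFn b)))
    rw [e, fourierOp_gaussFn, fourierOp_gaussFn,
      reflOp_toL2 ((memLp_gaussFn _).const_mul _)]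
    simp only [gaussFn_neg, neg_sq, mul_neg]
  exact DFunLike.congr_fun h f

/-! ### Phases and amplitudes -/

/-- `cosh z` for `δ = 1` and `sinh z` for `δ = -1`. -/
def kap (δ : ℝ) (z : ℂ) : ℂ := (Complex.exp z + δ * Complex.exp (-z)) / 2

/-- The modulus of `kap δ (x / 2 + iθ / 2)`. -/
def den (δ θ x : ℝ) : ℝ := √((Real.cosh x + δ * Real.cos θ) / 2)

/-- The phase of `kap δ (ν x + iθ / 2)`. -/
def phaseFn (δ θ ν x : ℝ) : ℂ := kap δ (ν * x + (θ / 2 : ℝ) * Complex.I) / den δ θ (2 * ν * x)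

/-- The function `e^{ηk} / den δ θ (2ηk)`. -/
def amplFn (δ θ η k : ℝ) : ℂ := Complex.exp (η * k) / den δ θ (2 * η * k)

theorem kap_one (z : ℂ) : kap 1 z = Complex.cosh z := by simp [kap, Complex.cosh]

theorem kap_neg_one (z : ℂ) : kap (-1) z = Complex.sinh z := by
  simp [kap, Complex.sinh, sub_eq_add_neg]

theorem continuous_kap (δ : ℝ) : Continuous (kap δ) := by unfold kap; fun_prop

theorem conj_kap (δ : ℝ) (z : ℂ) : conj (kap δ z) = kap δ (conj z) := by
  simp [kap, ← Complex.exp_conj, Complex.conj_ofNat]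

theorem kap_neg {δ : ℝ} (hδ : δ = 1 ∨ δ = -1) (z : ℂ) : kap δ (-z) = δ * kap δ z := by
  rcases hδ with rfl | rfl <;> simp [kap] <;> ring

theorem cosh_add_mul_cos_pos {δ θ : ℝ} (hδ : δ = 1 ∨ δ = -1) (h0 : 0 < θ) (hπ : θ < Real.pi)
    (x : ℝ) : Real.cosh x * (1 - |Real.cos θ|) ≤ Real.cosh x + δ * Real.cos θ ∧
      0 < 1 - |Real.cos θ| := by
  have h1 : |Real.cos θ| < 1 := by
    have h2 := Real.sin_pos_of_pos_of_lt_pi h0 hπ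
    rw [← sq_lt_one_iff_abs_lt_one]
    nlinarith [Real.sin_sq_add_cos_sq θ]
  have h3 : |δ * Real.cos θ| = |Real.cos θ| := by rcases hδ with rfl | rfl <;> simp
  have h4 := neg_abs_le (δ * Real.cos θ)
  have h5 := Real.one_le_cosh x
  refine ⟨?_, by linarith⟩
  rw [h3] at h4
  nlinarith [abs_nonneg (Real.cos θ)]

section

variable {δ θ : ℝ}

theorem cosh_add_pos (hδ : δ = 1 ∨ δ = -1) (h0 : 0 < θ) (hπ : θ < Real.pi) (x : ℝ) :
    0 < Real.cosh x + δ * Real.cos θ := by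
  have := cosh_add_mul_cos_pos hδ h0 hπ x
  exact (mul_pos (Real.cosh_pos x) this.2).trans_le this.1

theorem den_pos (hδ : δ = 1 ∨ δ = -1) (h0 : 0 < θ) (hπ : θ < Real.pi) (x : ℝ) :
    0 < den δ θ x := Real.sqrt_pos.2 (half_pos (cosh_add_pos hδ h0 hπ x))

theorem den_ne_zero (hδ : δ = 1 ∨ δ = -1) (h0 : 0 < θ) (hπ : θ < Real.pi) (x : ℝ) :
    (den δ θ x : ℂ) ≠ 0 := Complex.ofReal_ne_zero.2 (den_pos hδ h0 hπ x).ne'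

theorem den_sq (hδ : δ = 1 ∨ δ = -1) (h0 : 0 < θ) (hπ : θ < Real.pi) (x : ℝ) :
    den δ θ x ^ 2 = (Real.cosh x + δ * Real.cos θ) / 2 :=
  Real.sq_sqrt (half_pos (cosh_add_pos hδ h0 hπ x)).le

theorem continuous_den (δ θ : ℝ) : Continuous (den δ θ) := by
  unfold den
  have := Real.continuous_cosh
  fun_prop

theorem den_neg (δ θ x : ℝ) : den δ θ (-x) = den δ θ x := by simp [den]

theorem norm_kap (hδ : δ = 1 ∨ δ = -1) (h0 : 0 < θ) (hπ : θ < Real.pi) (x : ℝ) :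
    ‖kap δ (x + (θ / 2 : ℝ) * Complex.I)‖ = den δ θ (2 * x) := by
  rw [← sq_eq_sq₀ (norm_nonneg _) (den_pos hδ h0 hπ _).le, den_sq hδ h0 hπ, Real.cosh_two_mul]
  have hc := Real.cos_sq (θ / 2)
  have hs := Real.sin_sq_eq_half_sub (θ / 2)
  rw [mul_div_cancel₀ θ two_ne_zero] at hc hs
  rcases hδ with rfl | rfl
  · rw [kap_one, normSq_cosh_add_mul_I]
    linarith [Real.cosh_sq x]
  · rw [kap_neg_one, normSq_sinh_add_mul_I]
    linarith [Real.cosh_sq x]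

theorem norm_phaseFn (hδ : δ = 1 ∨ δ = -1) (h0 : 0 < θ) (hπ : θ < Real.pi) (ν x : ℝ) :
    ‖phaseFn δ θ ν x‖ = 1 := by
  have h1 := norm_kap hδ h0 hπ (ν * x)
  have h2 := den_pos hδ h0 hπ (2 * ν * x)
  rw [Complex.ofReal_mul, ← mul_assoc] at h1
  rw [phaseFn, norm_div, h1, Complex.norm_real, Real.norm_of_nonneg h2.le, div_self h2.ne']

/-- `kap δ` has parity δ, and x + iy and -x + iy are related by conjugation and a sign. Conjugating
the phase is therefore reflection up to δ. -/
theorem conj_phaseFn (hδ : δ = 1 ∨ δ = -1) (ν x : ℝ) :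
    conj (phaseFn δ θ ν x) = δ * phaseFn δ θ ν (-x) := by
  rw [phaseFn, phaseFn, map_div₀, conj_kap, Complex.conj_ofReal, mul_neg, den_neg, ← mul_div_assoc,
    ← kap_neg hδ]
  congr 2
  simp [Complex.conj_ofNat]
  ring

theorem phaseFn_mul_conj (hδ : δ = 1 ∨ δ = -1) (h0 : 0 < θ) (hπ : θ < Real.pi) (ν x : ℝ) :
    phaseFn δ θ ν x * conj (phaseFn δ θ ν x) = 1 := by
  rw [Complex.mul_conj, Complex.normSq_eq_norm_sq, norm_phaseFn hδ h0 hπ]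
  simp

theorem isMultiplier_phaseFn (hδ : δ = 1 ∨ δ = -1) (h0 : 0 < θ) (hπ : θ < Real.pi) (ν : ℝ) :
    IsMultiplier (phaseFn δ θ ν) := by
  refine ⟨?_, 1, fun x => (norm_phaseFn hδ h0 hπ ν x).le⟩
  have := continuous_kap δ
  have := continuous_den δ θ
  unfold phaseFn
  exact Continuous.div (by fun_prop) (by fun_prop) fun x => den_ne_zero hδ h0 hπ _

theorem isMultiplier_amplFn (hδ : δ = 1 ∨ δ = -1) (h0 : 0 < θ) (hπ : θ < Real.pi) (η : ℝ) :
    IsMultiplier (amplFn δ θ η) := by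
  constructor
  · have := continuous_den δ θ
    unfold amplFn
    exact Continuous.div (by fun_prop) (by fun_prop) fun x => den_ne_zero hδ h0 hπ _
  -- From e^{2ηx} ≤ 2 cosh(2ηx) and `den`² ≥ cosh(2ηx)(1 - |cos θ|)/2.
  · refine ⟨√(4 / (1 - |Real.cos θ|)), fun x => ?_⟩
    obtain ⟨h1, h2⟩ := cosh_add_mul_cos_pos hδ h0 hπ (2 * η * x)
    have h3 := den_pos hδ h0 hπ (2 * η * x)
    rw [amplFn, norm_div, Complex.norm_real, Real.norm_of_nonneg h3.le, Complex.norm_exp]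
    refine Real.le_sqrt_of_sq_le ?_
    rw [div_pow, den_sq hδ h0 hπ, div_le_div_iff₀ (half_pos (cosh_add_pos hδ h0 hπ _)) h2]
    have h4 : Real.exp ((η * x : ℂ).re) ^ 2 ≤ 2 * Real.cosh (2 * η * x) := by
      rw [← Real.exp_nat_mul, Real.cosh_eq]
      have : ((2 : ℕ) : ℝ) * (η * x : ℂ).re = 2 * η * x := by simp; ring
      rw [this]
      linarith [Real.exp_pos (-(2 * η * x))]
    calc _ ≤ 2 * Real.cosh (2 * η * x) * (1 - |Real.cos θ|) := by gcongr
      _ ≤ _ := by linarith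

/-- The weighted Gaussian. -/
def weightedGauss (δ θ η : ℝ) (c : ℂ) (x : ℝ) : ℂ := den δ θ (2 * η * x) * gaussFn c x

theorem cosh_mul_gaussFn (η : ℝ) (c : ℂ) (x : ℝ) : Complex.cosh (2 * η * x) * gaussFn c x =
    (gaussFn (c + 2 * η) x + gaussFn (c - 2 * η) x) / 2 := by
  rw [sub_eq_add_neg, ← exp_mul_gaussFn, ← exp_mul_gaussFn, Complex.cosh, neg_mul]
  ring

theorem memLp_weightedGauss (hδ : δ = 1 ∨ δ = -1) (h0 : 0 < θ) (hπ : θ < Real.pi) (η : ℝ)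
    (c : ℂ) : MemLp (weightedGauss δ θ η c) 2 volume := by
  have h1 : MemLp (fun x => (gaussFn (c + 2 * η) x + gaussFn (c - 2 * η) x) * (1 / 2 : ℂ)) 2
      volume := ((memLp_gaussFn _).add (memLp_gaussFn _)).mul_const _
  refine h1.of_le ?_ (ae_of_all _ fun x => ?_)
  · have := continuous_den δ θ
    have := continuous_gaussFn c
    unfold weightedGauss
    exact Continuous.aestronglyMeasurable (by fun_prop)
  · rw [mul_one_div, ← cosh_mul_gaussFn, weightedGauss, norm_mul, norm_mul]
    gcongr
    have h2 := den_pos hδ h0 hπ (2 * η * x)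
    have h3 : (2 * η * x : ℂ) = ((2 * η * x : ℝ) : ℂ) := by push_cast; ring
    rw [h3, ← Complex.ofReal_cosh, Complex.norm_real, Complex.norm_real,
      Real.norm_of_nonneg h2.le, Real.norm_of_nonneg (Real.cosh_pos _).le]
    refine le_of_sq_le_sq ?_ (Real.cosh_pos _).le
    rw [den_sq hδ h0 hπ]
    have h4 : δ * Real.cos θ ≤ 1 := by
      rcases hδ with rfl | rfl
      · linarith [Real.cos_le_one θ]
      · linarith [Real.neg_one_le_cos θ]
    nlinarith [Real.one_le_cosh (2 * η * x)]

/-- The Fourier transform `e^{(ir + c)² / 2}` of `gaussFn c`. -/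
def gaussHat (c : ℂ) (r : ℝ) : ℂ := Complex.exp (c ^ 2 / 2) * gaussFn (Complex.I * c) r

theorem memLp_gaussHat (c : ℂ) : MemLp (gaussHat c) 2 volume := (memLp_gaussFn _).const_mul _

theorem gaussHat_eq (c : ℂ) (r : ℝ) :
    gaussHat c r = Complex.exp ((Complex.I * r + c) ^ 2 / 2) := by
  rw [gaussHat, gaussFn, cgauss, ← Complex.exp_add]
  congr 1
  push_cast
  linear_combination (-r ^ 2 / 2 : ℂ) * Complex.I_sq

theorem fourierOp_gaussFn' (c : ℂ) : fourierOp (toL2 (gaussFn c)) = toL2 (gaussHat c) :=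
  fourierOp_gaussFn c

theorem adjoint_fourierOp_gaussFn' (c : ℂ) :
    fourierOp.adjoint (toL2 (gaussFn c)) = toL2 fun k => gaussHat c (-k) := by
  rw [adjoint_fourierOp_gaussFn]
  congr 1 with k
  rw [gaussHat, gaussFn_neg]

theorem integral_conj_gaussHat_mul (a b : ℂ) :
    ∫ x, conj (gaussHat a x) * gaussHat b x = ∫ x, conj (gaussFn a x) * gaussFn b x := by
  rw [← inner_toL2 (memLp_gaussHat a) (memLp_gaussHat b),
    ← inner_toL2 (memLp_gaussFn a) (memLp_gaussFn b), ← fourierOp_gaussFn', ← fourierOp_gaussFn',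
    ← ContinuousLinearMap.adjoint_inner_left, adjoint_fourierOp_apply]

/-- Shifting the two parameters by η in opposite directions amounts to moving the variable to the
line Im z = η. This turns the cross terms of the Gram matrix into contour integrals. -/
theorem conj_gaussHat_mul (a b : ℂ) (η x : ℝ) :
    conj (gaussHat (a + η) x) * gaussHat (b - η) x =
      conj (Complex.exp (a ^ 2 / 2)) * Complex.exp (b ^ 2 / 2) *
        cgauss 1 (Complex.I * (b - conj a)) (x + η * Complex.I) := by
  rw [gaussHat_eq, gaussHat_eq, cgauss, ← Complex.exp_conj, ← Complex.exp_conj, ← Complex.exp_add,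
    ← Complex.exp_add, ← Complex.exp_add]
  congr 1
  simp only [map_add, map_mul, map_div₀, map_pow, Complex.conj_ofReal, Complex.conj_I,
    Complex.conj_ofNat]
  push_cast
  linear_combination ((x : ℂ) ^ 2 + η ^ 2 + η * (conj a - b)) * Complex.I_sq

end

/-! ### Gram matrices of weighted Gaussians and of their images -/

/-- Because νη = θ/2, the offset iθ/2 in `kap` is exactly the effect of the contour height η. Only
sinh has a zero in the strip, hence l = 0 for δ = 1. -/
theorem integral_cross_kap {δ θ ν η : ℝ} (hδ : δ = 1 ∨ δ = -1) (hν : 0 < ν) (hη : 0 < η)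
    (hπ : θ < Real.pi) (hθ : 2 * (ν * η) = θ) : ∃ l : ℂ, (δ = 1 → l = 0) ∧ ∀ c : ℂ,
    (∫ x : ℝ, cgauss 1 c (x + η * Complex.I) *
      (kap δ (ν * x - (θ / 2 : ℝ) * Complex.I) / kap δ (ν * x + (θ / 2 : ℝ) * Complex.I))) +
    (∫ x : ℝ, cgauss 1 c (x - η * Complex.I) *
      (kap δ (ν * x + (θ / 2 : ℝ) * Complex.I) / kap δ (ν * x - (θ / 2 : ℝ) * Complex.I))) =
    2 * Real.cos θ * (∫ x : ℝ, cgauss 1 c x) + l := by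
  have e : θ / 2 = ν * η := by linarith
  have e' : ν * η < Real.pi / 2 := by linarith
  rw [e]
  rcases hδ with rfl | rfl
  · refine ⟨0, fun _ => rfl, fun c => ?_⟩
    simp only [kap_one]
    rw [integral_cross_cosh one_pos c hν (by rwa [abs_of_pos hη]), hθ, add_zero, Complex.ofReal_cos]
  · obtain ⟨l, hl⟩ := integral_cross_sinh one_pos hν hη e'
    refine ⟨l, fun h => by norm_num at h, fun c => ?_⟩
    simp only [kap_neg_one]
    rw [hl c, hθ, Complex.ofReal_cos]

/-- The image of a weighted Gaussian under the operators below, up to reflection. -/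
def scatGauss (δ ε θ ν η : ℝ) (c : ℂ) (x : ℝ) : ℂ :=
  (phaseFn δ θ ν x * gaussHat (c + η) x +
    ε * (conj (phaseFn δ θ ν x) * gaussHat (c - η) x)) / 2

theorem memLp_scatGauss {δ θ : ℝ} (hδ : δ = 1 ∨ δ = -1) (h0 : 0 < θ) (hπ : θ < Real.pi)
    (ε ν η : ℝ) (c : ℂ) : MemLp (scatGauss δ ε θ ν η c) 2 volume := by
  have hq := isMultiplier_phaseFn hδ h0 hπ ν
  have := ((hq.memLp (memLp_gaussHat (c + η))).add
    ((hq.conj.memLp (memLp_gaussHat (c - η))).const_mul (ε : ℂ))).mul_const (1 / 2 : ℂ)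
  convert! this using 2
  simp [scatGauss]
  ring

/-- `den`² = (cosh(2ηx) + ε cos θ)/2, and the exponentials e^{±2ηx} are absorbed by the Gaussians,
half in each factor. -/
theorem integral_conj_weightedGauss_mul {ε θ : ℝ} (hε : ε = 1 ∨ ε = -1) (h0 : 0 < θ)
    (hπ : θ < Real.pi) (η : ℝ) (a b : ℂ) :
    ∫ x, conj (weightedGauss ε θ η a x) * weightedGauss ε θ η b x =
      ((∫ x, conj (gaussFn (a + η) x) * gaussFn (b + η) x) +
        (∫ x, conj (gaussFn (a - η) x) * gaussFn (b - η) x)) / 4 +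
      ε * Real.cos θ / 2 * ∫ x, conj (gaussFn a x) * gaussFn b x := by
  have hint : ∀ c d : ℂ, Integrable fun x => conj (gaussFn c x) * gaussFn d x := fun c d =>
    (memLp_gaussFn c).star.integrable_mul (memLp_gaussFn d)
  have hadd : Integrable fun x => conj (gaussFn (a + η) x) * gaussFn (b + η) x +
    conj (gaussFn (a - η) x) * gaussFn (b - η) x := (hint _ _).add (hint _ _)
  rw [← integral_add (hint _ _) (hint _ _), div_eq_mul_one_div _ (4 : ℂ), ← integral_mul_const,
    ← integral_const_mul, ← integral_add (hadd.mul_const _) ((hint _ _).const_mul _)]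
  congr 1 with x
  have h1 : (den ε θ (2 * η * x) : ℂ) ^ 2 = (Complex.cosh (2 * η * x) + ε * Real.cos θ) / 2 := by
    rw [← Complex.ofReal_pow, den_sq hε h0 hπ]
    push_cast; ring
  have h2 := exp_mul_gaussFn η b x
  have h3 := exp_mul_gaussFn (-η) b x
  have h4 := congrArg conj (exp_mul_gaussFn η a x)
  have h5 := congrArg conj (exp_mul_gaussFn (-η) a x)
  simp only [map_mul, ← Complex.exp_conj, map_neg, Complex.conj_ofReal] at h4 h5
  rw [← sub_eq_add_neg] at h3 h5
  rw [← h2, ← h3, ← h4, ← h5, weightedGauss, weightedGauss, map_mul, Complex.conj_ofReal]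
  have h6 : Complex.exp (2 * η * x) = Complex.exp (η * x) ^ 2 := by
    rw [← Complex.exp_nat_mul]; congr 1; push_cast; ring
  have h7 : Complex.exp (-(2 * η * x)) = Complex.exp (-η * x) ^ 2 := by
    rw [← Complex.exp_nat_mul]; congr 1; push_cast; ring
  rw [Complex.cosh, h6, h7] at h1
  linear_combination (conj (gaussFn a x) * gaussFn b x) * h1

/-- Expand the product. Diagonal terms lose their phase and are Plancherel integrals. Cross terms
carry a squared phase, a quotient of `kap` values, and by `integral_cross_kap` sum to 2 cos θ times
a Gaussian integral plus a constant. With the prefactor ε/4 this is the cos θ term of the weighted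
Gram matrix, and the constant remains as l. -/
theorem integral_conj_scatGauss_mul {δ ε θ ν η : ℝ} (hδ : δ = 1 ∨ δ = -1) (hε : ε = 1 ∨ ε = -1)
    (hν : 0 < ν) (hη : 0 < η) (hπ : θ < Real.pi) (hθ : 2 * (ν * η) = θ) :
    ∃ l : ℂ, (δ = 1 → l = 0) ∧ ∀ a b : ℂ,
    ∫ x, conj (scatGauss δ ε θ ν η a x) * scatGauss δ ε θ ν η b x =
      (∫ x, conj (weightedGauss ε θ η a x) * weightedGauss ε θ η b x) +
      l * (conj (Complex.exp (a ^ 2 / 2)) * Complex.exp (b ^ 2 / 2)) := by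
  have h0 : 0 < θ := by rw [← hθ]; positivity
  obtain ⟨l, hl0, hl⟩ := integral_cross_kap hδ hν hη hπ hθ
  refine ⟨ε / 4 * l, fun h => by rw [hl0 h, mul_zero], fun a b => ?_⟩
  set q := phaseFn δ θ ν with hq
  have hqm := isMultiplier_phaseFn hδ h0 hπ ν
  have hqq : ∀ x, q x * conj (q x) = 1 := phaseFn_mul_conj hδ h0 hπ ν
  have hqne : ∀ x, q x ≠ 0 := fun x h => by simpa [h] using hqq x
  have hε2 : (ε : ℂ) * ε = 1 := by rcases hε with rfl | rfl <;> simp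
  have hI : ∀ c d : ℂ, Integrable fun x => conj (gaussHat c x) * gaussHat d x := fun c d =>
    (memLp_gaussHat c).star.integrable_mul (memLp_gaussHat d)
  have hI1 : ∀ c d : ℂ, Integrable fun x => conj (q x * gaussHat c x) *
      (conj (q x) * gaussHat d x) := fun c d =>
    (hqm.memLp (memLp_gaussHat c)).star.integrable_mul (hqm.conj.memLp (memLp_gaussHat d))
  have hI2 : ∀ c d : ℂ, Integrable fun x => conj (conj (q x) * gaussHat c x) *
      (q x * gaussHat d x) := fun c d =>
    (hqm.conj.memLp (memLp_gaussHat c)).star.integrable_mul (hqm.memLp (memLp_gaussHat d))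
  set K := conj (Complex.exp (a ^ 2 / 2)) * Complex.exp (b ^ 2 / 2) with hK
  set c := Complex.I * (b - conj a) with hc
  have hratio : ∀ x : ℝ, kap δ (ν * x - (θ / 2 : ℝ) * Complex.I) /
      kap δ (ν * x + (θ / 2 : ℝ) * Complex.I) = conj (q x) * conj (q x) := by
    intro x
    have hd := den_ne_zero hδ h0 hπ (2 * ν * x)
    have e1 : kap δ (ν * x + (θ / 2 : ℝ) * Complex.I) = q x * den δ θ (2 * ν * x) := by
      rw [hq, phaseFn, div_mul_cancel₀ _ hd]
    have e2 : kap δ (ν * x - (θ / 2 : ℝ) * Complex.I) = conj (q x) * den δ θ (2 * ν * x) := by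
      rw [← Complex.conj_ofReal (den _ _ _), ← map_mul, ← e1, conj_kap]
      simp [sub_eq_add_neg, Complex.conj_ofNat]
    rw [e1, e2, mul_div_mul_right _ _ hd, div_eq_iff (hqne x), mul_assoc, mul_comm _ (q x), hqq,
      mul_one]
  have hratio' : ∀ x : ℝ, kap δ (ν * x + (θ / 2 : ℝ) * Complex.I) /
      kap δ (ν * x - (θ / 2 : ℝ) * Complex.I) = q x * q x := by
    intro x
    rw [← inv_div, hratio, mul_inv, inv_eq_of_mul_eq_one_left (hqq x)]
  have hX1 : ∫ x, conj (q x * gaussHat (a + η) x) * (conj (q x) * gaussHat (b - η) x) =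
      K * ∫ x : ℝ, cgauss 1 c (x + η * Complex.I) *
        (kap δ (ν * x - (θ / 2 : ℝ) * Complex.I) / kap δ (ν * x + (θ / 2 : ℝ) * Complex.I)) := by
    rw [← integral_const_mul]
    congr 1 with x
    rw [hratio, map_mul]
    linear_combination (conj (q x) * conj (q x)) * conj_gaussHat_mul a b η x
  have hX2 : ∫ x, conj (conj (q x) * gaussHat (a - η) x) * (q x * gaussHat (b + η) x) =
      K * ∫ x : ℝ, cgauss 1 c (x - η * Complex.I) *
        (kap δ (ν * x + (θ / 2 : ℝ) * Complex.I) / kap δ (ν * x - (θ / 2 : ℝ) * Complex.I)) := by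
    rw [← integral_const_mul]
    congr 1 with x
    have := conj_gaussHat_mul a b (-η) x
    simp only [Complex.ofReal_neg, neg_mul, ← sub_eq_add_neg, sub_neg_eq_add] at this
    rw [hratio', map_mul, Complex.conj_conj]
    linear_combination (q x * q x) * this
  have hadd : Integrable fun x => conj (gaussHat (a + η) x) * gaussHat (b + η) x +
    conj (gaussHat (a - η) x) * gaussHat (b - η) x := (hI _ _).add (hI _ _)
  have hadd' : Integrable fun x =>
      conj (q x * gaussHat (a + η) x) * (conj (q x) * gaussHat (b - η) x) +
      conj (conj (q x) * gaussHat (a - η) x) * (q x * gaussHat (b + η) x) :=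
    (hI1 _ _).add (hI2 _ _)
  have hsum : ∫ x, conj (scatGauss δ ε θ ν η a x) * scatGauss δ ε θ ν η b x =
      ((∫ x, conj (gaussHat (a + η) x) * gaussHat (b + η) x) +
        (∫ x, conj (gaussHat (a - η) x) * gaussHat (b - η) x)) * (1 / 4) +
      ((∫ x, conj (q x * gaussHat (a + η) x) * (conj (q x) * gaussHat (b - η) x)) +
        ∫ x, conj (conj (q x) * gaussHat (a - η) x) * (q x * gaussHat (b + η) x)) * (ε / 4) := by
    rw [← integral_add (hI _ _) (hI _ _), ← integral_add (hI1 _ _) (hI2 _ _),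
      ← integral_mul_const, ← integral_mul_const,
      ← integral_add (hadd.mul_const _) (hadd'.mul_const _)]
    congr 1 with x
    rw [scatGauss, scatGauss]
    simp only [map_add, map_mul, map_div₀, Complex.conj_ofReal, Complex.conj_conj,
      Complex.conj_ofNat]
    rw [← hq]
    linear_combination (conj (gaussHat (a + η) x) * gaussHat (b + η) x / 4 +
      ε * ε * conj (gaussHat (a - η) x) * gaussHat (b - η) x / 4) * hqq x +
      conj (gaussHat (a - η) x) * gaussHat (b - η) x / 4 * hε2
  have hbase : ∫ x, conj (gaussFn a x) * gaussFn b x = K * ∫ x : ℝ, cgauss 1 c x := by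
    rw [← integral_conj_gaussHat_mul, ← integral_const_mul]
    congr 1 with x
    simpa using conj_gaussHat_mul a b 0 x
  rw [hsum, hX1, hX2, ← mul_add, hl c, integral_conj_gaussHat_mul, integral_conj_gaussHat_mul,
    integral_conj_weightedGauss_mul hε h0 hπ, hbase]
  ring

/-! ### The bound state -/

/-- The function `1 / (2 den 1 θ (2νr))`. -/
def boundState (θ ν r : ℝ) : ℂ := ((1 / (2 * den 1 θ (2 * ν * r)) : ℝ) : ℂ)

/-- With E = e^{2νr} the squared bound state is E/(E² + 2E cos θ + 1), and the denominator is (E +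
cos θ)² + sin²θ. -/
theorem hasDerivAt_arctan_exp {θ : ℝ} (h0 : 0 < θ) (hπ : θ < Real.pi) (ν r : ℝ) :
    HasDerivAt (fun r => Real.arctan ((Real.exp (2 * ν * r) + Real.cos θ) / Real.sin θ))
      (2 * ν * Real.sin θ * (1 / (2 * den 1 θ (2 * ν * r))) ^ 2) r := by
  have hs := Real.sin_pos_of_pos_of_lt_pi h0 hπ
  have h1 : HasDerivAt (fun r : ℝ => 2 * ν * r) (2 * ν * 1) r := (hasDerivAt_id r).const_mul _
  have h2 := ((h1.exp.add_const (Real.cos θ)).div_const (Real.sin θ)).arctan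
  convert! h2 using 1
  have hp := cosh_add_pos (δ := 1) (Or.inl rfl) h0 hπ (2 * ν * r)
  rw [div_pow, mul_pow, den_sq (Or.inl rfl) h0 hπ]
  have he := Real.exp_pos (2 * ν * r)
  have hc : Real.cosh (2 * ν * r) = (Real.exp (2 * ν * r) + (Real.exp (2 * ν * r))⁻¹) / 2 := by
    rw [Real.cosh_eq, Real.exp_neg]
  rw [hc] at hp ⊢
  set E := Real.exp (2 * ν * r)
  have h3 : 0 < 1 + ((E + Real.cos θ) / Real.sin θ) ^ 2 := by positivity
  have h4 : E ^ 2 + 1 + 2 * E * Real.cos θ = Real.sin θ ^ 2 + (E + Real.cos θ) ^ 2 := by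
    linear_combination -Real.sin_sq_add_cos_sq θ
  have h5 : (E + E⁻¹) / 2 + 1 * Real.cos θ = (Real.sin θ ^ 2 + (E + Real.cos θ) ^ 2) / (2 * E) := by
    rw [← h4]; field_simp
  have h6 : 0 < Real.sin θ ^ 2 + (E + Real.cos θ) ^ 2 := by positivity
  rw [h5]
  field_simp

open Filter Topology in
theorem integral_boundState_sq {θ ν : ℝ} (h0 : 0 < θ) (hπ : θ < Real.pi) (hν : 0 < ν) :
    Integrable (fun r : ℝ => (1 / (2 * den 1 θ (2 * ν * r))) ^ 2) ∧
      ∫ r : ℝ, (1 / (2 * den 1 θ (2 * ν * r))) ^ 2 = θ / (2 * ν * Real.sin θ) := by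
  have hs := Real.sin_pos_of_pos_of_lt_pi h0 hπ
  set f : ℝ → ℝ := fun r => 2 * ν * Real.sin θ * (1 / (2 * den 1 θ (2 * ν * r))) ^ 2 with hf
  have hd := fun r => hasDerivAt_arctan_exp h0 hπ ν r
  have hcont : Continuous f := by
    have := continuous_den 1 θ
    refine Continuous.mul (by fun_prop) (Continuous.pow (Continuous.div (by fun_prop) (by fun_prop)
      fun r => ?_) 2)
    have := den_pos (δ := 1) (Or.inl rfl) h0 hπ (2 * ν * r)
    positivity
  have hnn : ∀ r, 0 ≤ f r := fun r => by positivity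
  have hint : Integrable f := by
    -- The integrand is nonnegative with an arctangent as primitive, so π bounds all its integrals.
    refine integrable_of_intervalIntegral_norm_bounded (l := atTop) (a := fun n : ℝ => -n)
      (b := id) Real.pi (fun n => hcont.locallyIntegrable.integrableOn_isCompact isCompact_Icc
        |>.mono_set Ioc_subset_Icc_self) tendsto_neg_atTop_atBot tendsto_id
        (Eventually.of_forall fun n => ?_)
    have h1 : ∫ x in (-n)..id n, ‖f x‖ = ∫ x in (-n)..id n, f x := by
      congr 1 with x
      exact Real.norm_of_nonneg (hnn x)
    rw [h1, intervalIntegral.integral_eq_sub_of_hasDerivAt (fun x _ => hd x)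
      (hcont.intervalIntegrable _ _)]
    have h2 := Real.arctan_lt_pi_div_two
      ((Real.exp (2 * ν * id n) + Real.cos θ) / Real.sin θ)
    have h3 := Real.neg_pi_div_two_lt_arctan
      ((Real.exp (2 * ν * (-n)) + Real.cos θ) / Real.sin θ)
    linarith
  have hbot : Tendsto (fun r => Real.arctan ((Real.exp (2 * ν * r) + Real.cos θ) / Real.sin θ))
      atBot (𝓝 (Real.pi / 2 - θ)) := by
    -- At -∞ the primitive tends to arctan(cot θ) = π/2 - θ, and at +∞ to π/2; the difference is θ.
    have h1 : Real.arctan ((0 + Real.cos θ) / Real.sin θ) = Real.pi / 2 - θ := by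
      rw [zero_add, ← Real.arctan_tan (x := Real.pi / 2 - θ) (by linarith) (by linarith),
        Real.tan_pi_div_two_sub, Real.tan_eq_sin_div_cos, inv_div]
    rw [← h1]
    refine (Real.continuous_arctan.tendsto _).comp (Tendsto.div_const (Tendsto.add_const _ ?_) _)
    exact Real.tendsto_exp_atBot.comp (tendsto_id.const_mul_atBot (by positivity))
  have htop : Tendsto (fun r => Real.arctan ((Real.exp (2 * ν * r) + Real.cos θ) / Real.sin θ))
      atTop (𝓝 (Real.pi / 2)) := by
    refine (tendsto_nhds_of_tendsto_nhdsWithin Real.tendsto_arctan_atTop).comp ?_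
    refine Tendsto.atTop_div_const hs (tendsto_atTop_add_const_right _ _ ?_)
    exact Real.tendsto_exp_atTop.comp (tendsto_id.const_mul_atTop (by positivity))
  have hI := integral_of_hasDerivAt_of_tendsto hd hint hbot htop
  rw [integral_const_mul] at hI
  have hc : 2 * ν * Real.sin θ ≠ 0 := by positivity
  refine ⟨(integrable_const_mul_iff (Ne.isUnit hc) _).1 hint, ?_⟩
  rw [eq_div_iff hc, mul_comm, hI]
  ring

theorem memLp_boundState {θ ν : ℝ} (h0 : 0 < θ) (hπ : θ < Real.pi) (hν : 0 < ν) :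
    MemLp (boundState θ ν) 2 volume := by
  have hcont : Continuous (boundState θ ν) := by
    have := continuous_den 1 θ
    refine Complex.continuous_ofReal.comp (Continuous.div (by fun_prop) (by fun_prop) fun r => ?_)
    have := den_pos (δ := 1) (Or.inl rfl) h0 hπ (2 * ν * r)
    positivity
  rw [memLp_two_iff_integrable_sq_norm hcont.aestronglyMeasurable]
  refine (integral_boundState_sq h0 hπ hν).1.congr (ae_of_all _ fun r => ?_)
  simp only [boundState, Complex.norm_real, Real.norm_eq_abs, sq_abs]

theorem inner_boundState {θ ν : ℝ} (h0 : 0 < θ) (hπ : θ < Real.pi) (hν : 0 < ν) :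
    inner ℂ (toL2 (boundState θ ν)) (toL2 (boundState θ ν)) =
      ((θ / (2 * ν * Real.sin θ) : ℝ) : ℂ) := by
  rw [inner_toL2 (memLp_boundState h0 hπ hν) (memLp_boundState h0 hπ hν),
    ← (integral_boundState_sq h0 hπ hν).2, ← integral_complex_ofReal]
  congr 1 with r
  rw [boundState, Complex.conj_ofReal]
  push_cast; ring

/-- The weight cancels the bound state up to ½, leaving a Gaussian integral. Its dependence e^{b²/2}
on b is that of the pole term in `integral_conj_scatGauss_mul`, which identifies the latter as rank
one. -/
theorem inner_boundState_weightedGauss {θ ν : ℝ} (h0 : 0 < θ) (hπ : θ < Real.pi) (hν : 0 < ν)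
    (b : ℂ) : inner ℂ (toL2 (boundState θ ν)) (toL2 (weightedGauss 1 θ ν b)) =
      (√(2 * Real.pi) / 2 : ℝ) * Complex.exp (b ^ 2 / 2) := by
  rw [inner_toL2 (memLp_boundState h0 hπ hν) (memLp_weightedGauss (Or.inl rfl) h0 hπ ν b)]
  have h1 : ∀ r, conj (boundState θ ν r) * weightedGauss 1 θ ν b r = 1 / 2 * gaussFn b r := by
    intro r
    have := den_ne_zero (δ := 1) (Or.inl rfl) h0 hπ (2 * ν * r)
    rw [boundState, weightedGauss, Complex.conj_ofReal]
    push_cast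
    field_simp
  simp_rw [h1]
  rw [integral_const_mul, integral_gaussFn]
  push_cast; ring

/-! ### The scattering operators -/

/-- The operator `½ (u U a + ε ū U a(-·))` with `u = phaseFn 1 θ ν` and `a = amplFn ε θ η`. -/
def scatOp (ε θ ν η : ℝ) : PositionSpace →L[ℂ] PositionSpace :=
  (1 / 2 : ℂ) • (mulOp (phaseFn 1 θ ν) ∘L fourierOp ∘L mulOp (amplFn ε θ η) +
    (ε : ℂ) • (mulOp (fun r => conj (phaseFn 1 θ ν r)) ∘L fourierOp ∘L
      mulOp (fun k => amplFn ε θ η (-k))))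

theorem scatOp_apply (ε θ ν η : ℝ) (f : PositionSpace) : scatOp ε θ ν η f =
    (1 / 2 : ℂ) • (mulOp (phaseFn 1 θ ν) (fourierOp (mulOp (amplFn ε θ η) f)) +
      (ε : ℂ) • mulOp (fun r => conj (phaseFn 1 θ ν r)) (fourierOp
        (mulOp (fun k => amplFn ε θ η (-k)) f))) := rfl

section

variable {ε θ ν η : ℝ}

theorem amplFn_mul_weightedGauss (hε : ε = 1 ∨ ε = -1) (h0 : 0 < θ) (hπ : θ < Real.pi) (c : ℂ)
    (x : ℝ) : amplFn ε θ η x * weightedGauss ε θ η c x = gaussFn (c + η) x := by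
  have h := den_ne_zero hε h0 hπ (2 * η * x)
  rw [amplFn, weightedGauss, ← exp_mul_gaussFn]
  field_simp

theorem amplFn_neg_mul_weightedGauss (hε : ε = 1 ∨ ε = -1) (h0 : 0 < θ) (hπ : θ < Real.pi)
    (c : ℂ) (x : ℝ) : amplFn ε θ η (-x) * weightedGauss ε θ η c x = gaussFn (c - η) x := by
  have h := den_ne_zero hε h0 hπ (2 * η * x)
  rw [amplFn, weightedGauss, sub_eq_add_neg, ← exp_mul_gaussFn, mul_neg, den_neg]
  push_cast
  rw [mul_neg, neg_mul]
  field_simp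

theorem scatOp_weightedGauss (hε : ε = 1 ∨ ε = -1) (h0 : 0 < θ) (hπ : θ < Real.pi) (c : ℂ) :
    scatOp ε θ ν η (toL2 (weightedGauss ε θ η c)) = toL2 (scatGauss 1 ε θ ν η c) := by
  have hw := memLp_weightedGauss hε h0 hπ η c
  have ha := isMultiplier_amplFn hε h0 hπ η
  have hu := isMultiplier_phaseFn (δ := 1) (Or.inl rfl) h0 hπ ν
  rw [scatOp_apply, mulOp_toL2 ha hw, mulOp_toL2 ha.comp_neg hw]
  simp only [amplFn_mul_weightedGauss hε h0 hπ, amplFn_neg_mul_weightedGauss hε h0 hπ]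
  change (1 / 2 : ℂ) • (mulOp _ (fourierOp (toL2 (gaussFn (c + η)))) +
    (ε : ℂ) • mulOp _ (fourierOp (toL2 (gaussFn (c - η))))) = _
  have m1 := hu.memLp (memLp_gaussHat (c + η))
  have m2 := hu.conj.memLp (memLp_gaussHat (c - η))
  rw [fourierOp_gaussFn', fourierOp_gaussFn', mulOp_toL2 hu (memLp_gaussHat _),
    mulOp_toL2 hu.conj (memLp_gaussHat _), ← toL2_const_mul m2, ← toL2_add m1 (m2.const_mul _),
    ← toL2_const_mul (memLp_fun_add m1 (m2.const_mul _))]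
  congr 1 with x
  rw [scatGauss]; ring

theorem conj_amplFn (ε θ η k : ℝ) : conj (amplFn ε θ η k) = amplFn ε θ η k := by
  rw [amplFn, map_div₀, Complex.conj_ofReal, ← Complex.exp_conj]
  simp

theorem adjoint_scatOp_apply (hε : ε = 1 ∨ ε = -1) (h0 : 0 < θ) (hπ : θ < Real.pi)
    (f : PositionSpace) : (scatOp ε θ ν η).adjoint f =
    (1 / 2 : ℂ) • (mulOp (amplFn ε θ η) (fourierOp.adjoint
        (mulOp (fun r => conj (phaseFn 1 θ ν r)) f)) +
      (ε : ℂ) • mulOp (fun k => amplFn ε θ η (-k)) (fourierOp.adjoint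
        (mulOp (phaseFn 1 θ ν) f))) := by
  have ha := isMultiplier_amplFn hε h0 hπ η
  have hu := isMultiplier_phaseFn (δ := 1) (Or.inl rfl) h0 hπ ν
  rw [scatOp, map_smulₛₗ, map_add, map_smulₛₗ]
  simp only [ContinuousLinearMap.adjoint_comp, adjoint_mulOp ha, adjoint_mulOp ha.comp_neg,
    adjoint_mulOp hu, adjoint_mulOp hu.conj, conj_amplFn, Complex.conj_conj, Complex.conj_ofReal]
  have : conj (1 / 2 : ℂ) = 1 / 2 := by simp [Complex.conj_ofNat]
  rw [this]
  rfl

theorem phaseFn_mul_weightedGauss (h0 : 0 < θ) (hπ : θ < Real.pi) (c : ℂ) (x : ℝ) :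
    phaseFn 1 θ ν x * weightedGauss 1 θ ν c x =
      (Complex.exp ((θ / 2 : ℝ) * Complex.I) * gaussFn (c + ν) x +
        Complex.exp (-((θ / 2 : ℝ) * Complex.I)) * gaussFn (c - ν) x) / 2 := by
  have h := den_ne_zero (δ := 1) (Or.inl rfl) h0 hπ (2 * ν * x)
  rw [phaseFn, weightedGauss, sub_eq_add_neg, ← exp_mul_gaussFn, ← exp_mul_gaussFn,
    ← mul_assoc, div_mul_cancel₀ _ h, kap, neg_add, Complex.exp_add, Complex.exp_add, neg_mul]
  push_cast; ring

theorem conj_phaseFn_mul_weightedGauss (h0 : 0 < θ) (hπ : θ < Real.pi) (c : ℂ) (x : ℝ) :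
    conj (phaseFn 1 θ ν x) * weightedGauss 1 θ ν c x =
      (Complex.exp (-((θ / 2 : ℝ) * Complex.I)) * gaussFn (c + ν) x +
        Complex.exp ((θ / 2 : ℝ) * Complex.I) * gaussFn (c - ν) x) / 2 := by
  have h := phaseFn_mul_weightedGauss (ν := ν) h0 hπ (-c) (-x)
  have e : weightedGauss 1 θ ν (-c) (-x) = weightedGauss 1 θ ν c x := by
    rw [weightedGauss, weightedGauss, gaussFn_neg, neg_neg, mul_neg, den_neg]
  rw [e] at h
  rw [conj_phaseFn (Or.inl rfl), Complex.ofReal_one, one_mul, h, gaussFn_neg, gaussFn_neg]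
  have e1 : -(-c + ν) = c - ν := by ring
  have e2 : -(-c - ν) = c + ν := by ring
  rw [e1, e2]; ring

/-- The numerator of u is a sum of two exponentials, which shift the Gaussian by ±ν and leave
factors e^{±iθ/2}. After U* these factors combine with the e^{±ηk} of the amplitudes into `kap ε`
(ηk ± iθ/2). Position and momentum thus exchange (1, ν) and (ε, η). -/
theorem adjoint_scatOp_weightedGauss (hε : ε = 1 ∨ ε = -1) (h0 : 0 < θ) (hπ : θ < Real.pi)
    (c : ℂ) : (scatOp ε θ ν η).adjoint (toL2 (weightedGauss 1 θ ν c)) =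
      (ε : ℂ) • reflOp (toL2 (scatGauss ε 1 θ η ν c)) := by
  have hw := memLp_weightedGauss (δ := 1) (Or.inl rfl) h0 hπ ν c
  have ha := isMultiplier_amplFn hε h0 hπ η
  have hu := isMultiplier_phaseFn (δ := 1) (Or.inl rfl) h0 hπ ν
  set p := Complex.exp ((θ / 2 : ℝ) * Complex.I) with hp
  set p' := Complex.exp (-((θ / 2 : ℝ) * Complex.I)) with hp'
  have hU : ∀ s t : ℂ, fourierOp.adjoint
      (toL2 fun x => (s * gaussFn (c + ν) x + t * gaussFn (c - ν) x) / 2) =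
      toL2 fun k => (s * gaussHat (c + ν) (-k) + t * gaussHat (c - ν) (-k)) / 2 := by
    intro s t
    have m1 := memLp_gaussFn (c + ν)
    have m2 := memLp_gaussFn (c - ν)
    have n1 := memLp_comp_neg (memLp_gaussHat (c + ν))
    have n2 := memLp_comp_neg (memLp_gaussHat (c - ν))
    have e1 : toL2 (fun x => (s * gaussFn (c + ν) x + t * gaussFn (c - ν) x) / 2) =
        (1 / 2 : ℂ) • (s • toL2 (gaussFn (c + ν)) + t • toL2 (gaussFn (c - ν))) := by
      rw [← toL2_const_mul m1, ← toL2_const_mul m2,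
        ← toL2_add (m1.const_mul _) (m2.const_mul _),
        ← toL2_const_mul (memLp_fun_add (m1.const_mul _) (m2.const_mul _))]
      congr 1 with x
      ring
    rw [e1, map_smul, map_add, map_smul, map_smul, adjoint_fourierOp_gaussFn',
      adjoint_fourierOp_gaussFn', ← toL2_const_mul n1, ← toL2_const_mul n2,
      ← toL2_add (n1.const_mul _) (n2.const_mul _),
      ← toL2_const_mul (memLp_fun_add (n1.const_mul _) (n2.const_mul _))]
    congr 1 with x
    ring
  have hm : ∀ s t : ℂ, MemLp (fun k => (s * gaussHat (c + ν) (-k) +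
      t * gaussHat (c - ν) (-k)) / 2) 2 volume := by
    intro s t
    have n1 := memLp_comp_neg (memLp_gaussHat (c + ν))
    have n2 := memLp_comp_neg (memLp_gaussHat (c - ν))
    convert! ((n1.const_mul s).add (n2.const_mul t)).mul_const (1 / 2 : ℂ) using 2
    simp; ring
  rw [adjoint_scatOp_apply hε h0 hπ, mulOp_toL2 hu hw, mulOp_toL2 hu.conj hw]
  simp only [phaseFn_mul_weightedGauss h0 hπ, conj_phaseFn_mul_weightedGauss h0 hπ]
  rw [hU, hU, mulOp_toL2 ha (hm _ _), mulOp_toL2 ha.comp_neg (hm _ _),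
    ← toL2_const_mul (ha.comp_neg.memLp (hm _ _)),
    ← toL2_add (ha.memLp (hm _ _)) ((ha.comp_neg.memLp (hm _ _)).const_mul _),
    ← toL2_const_mul (memLp_fun_add (ha.memLp (hm _ _))
      ((ha.comp_neg.memLp (hm _ _)).const_mul _)),
    reflOp_toL2 (memLp_scatGauss hε h0 hπ _ _ _ _),
    ← toL2_const_mul (memLp_comp_neg (memLp_scatGauss hε h0 hπ _ _ _ _))]
  congr 1 with k
  have h := den_ne_zero hε h0 hπ (2 * η * k)
  have hc := conj_phaseFn (θ := θ) hε η (-k)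
  have hε2 : (ε : ℂ) * ε = 1 := by rcases hε with rfl | rfl <;> simp
  rw [neg_neg] at hc
  have e1 : phaseFn ε θ η k = (Complex.exp (η * k) * p +
      ε * (Complex.exp (-(η * k)) * p')) / 2 / den ε θ (2 * η * k) := by
    rw [phaseFn, kap, neg_add, Complex.exp_add, Complex.exp_add]
  have e2 : ε * phaseFn ε θ η (-k) = (Complex.exp (η * k) * p' +
      ε * (Complex.exp (-(η * k)) * p)) / 2 / den ε θ (2 * η * k) := by
    rw [phaseFn, kap, neg_add, Complex.exp_add, Complex.exp_add, mul_neg, den_neg]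
    push_cast
    rw [mul_neg, neg_neg, hp, hp']
    push_cast
    linear_combination (Complex.exp (η * k) * Complex.exp (-(θ / 2 * Complex.I)) / 2 /
      den ε θ (2 * η * k)) * hε2
  have e3 : amplFn ε θ η (-k) = Complex.exp (-(η * k)) / den ε θ (2 * η * k) := by
    rw [amplFn, mul_neg, den_neg]
    push_cast
    rw [mul_neg]
  rw [scatGauss, hc, e3, amplFn, Complex.ofReal_one]
  linear_combination (-gaussHat (c + ν) (-k) / 2) * e2 - (gaussHat (c - ν) (-k) / 2) * e1 +
    (-gaussHat (c - ν) (-k) * phaseFn ε θ η k / 2) * hε2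

end

section

variable {ε θ ν η : ℝ}

/-- The phase in position space is that of cosh for both values of ε, so no pole term occurs. -/
theorem adjoint_scatOp_scatOp (hε : ε = 1 ∨ ε = -1) (hν : 0 < ν) (hη : 0 < η) (hπ : θ < Real.pi)
    (hθ : 2 * (ν * η) = θ) :
    (scatOp ε θ ν η).adjoint ∘L scatOp ε θ ν η = ContinuousLinearMap.id ℂ PositionSpace := by
  have h0 : 0 < θ := by rw [← hθ]; positivity
  obtain ⟨l, hl0, hl⟩ := integral_conj_scatGauss_mul (δ := 1) (Or.inl rfl) hε hν hη hπ hθ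
  refine clm_ext_inner_gaussFn (m := fun x => (den ε θ (2 * η * x) : ℂ))
    (fun x => den_ne_zero hε h0 hπ _) (memLp_weightedGauss hε h0 hπ η) fun a b => ?_
  change inner ℂ (toL2 (weightedGauss ε θ η a)) ((scatOp ε θ ν η).adjoint
    (scatOp ε θ ν η (toL2 (weightedGauss ε θ η b)))) =
    inner ℂ (toL2 (weightedGauss ε θ η a)) (toL2 (weightedGauss ε θ η b))
  have hs := memLp_scatGauss (δ := 1) (Or.inl rfl) h0 hπ ε ν η
  have hw := memLp_weightedGauss hε h0 hπ η
  rw [ContinuousLinearMap.adjoint_inner_right, scatOp_weightedGauss hε h0 hπ,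
    scatOp_weightedGauss hε h0 hπ, inner_toL2 (hs a) (hs b), inner_toL2 (hw a) (hw b), hl a b,
    hl0 rfl, zero_mul, add_zero]

/-- Here the phase is that of `kap ε`, so the pole term is present when ε = -1. -/
theorem scatOp_adjoint_scatOp (hε : ε = 1 ∨ ε = -1) (hν : 0 < ν) (hη : 0 < η) (hπ : θ < Real.pi)
    (hθ : 2 * (ν * η) = θ) : ∃ l : ℂ, (ε = 1 → l = 0) ∧
    scatOp ε θ ν η ∘L (scatOp ε θ ν η).adjoint = ContinuousLinearMap.id ℂ PositionSpace +
      l • InnerProductSpace.rankOne ℂ (toL2 (boundState θ ν)) (toL2 (boundState θ ν)) := by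
  have h0 : 0 < θ := by rw [← hθ]; positivity
  obtain ⟨l, hl0, hl⟩ := integral_conj_scatGauss_mul (δ := ε) (ε := 1) hε (Or.inl rfl) hη hν hπ
    (by linarith)
  set K : ℂ := ((√(2 * Real.pi) / 2 : ℝ) : ℂ) with hK
  have hK0 : K ≠ 0 := by
    rw [hK, Complex.ofReal_ne_zero]
    positivity
  -- Each pairing of the bound state with a weighted Gaussian brings one factor K.
  refine ⟨l / K ^ 2, fun h => by rw [hl0 h, zero_div], ?_⟩
  refine clm_ext_inner_gaussFn (m := fun x => (den 1 θ (2 * ν * x) : ℂ))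
    (fun x => den_ne_zero (Or.inl rfl) h0 hπ _) (memLp_weightedGauss (Or.inl rfl) h0 hπ ν)
    fun a b => ?_
  change inner ℂ (toL2 (weightedGauss 1 θ ν a)) (scatOp ε θ ν η ((scatOp ε θ ν η).adjoint
    (toL2 (weightedGauss 1 θ ν b)))) =
    inner ℂ (toL2 (weightedGauss 1 θ ν a)) (toL2 (weightedGauss 1 θ ν b) +
      (l / K ^ 2) • InnerProductSpace.rankOne ℂ (toL2 (boundState θ ν)) (toL2 (boundState θ ν))
        (toL2 (weightedGauss 1 θ ν b)))
  have hs := memLp_scatGauss hε h0 hπ 1 η ν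
  have hw := memLp_weightedGauss (δ := 1) (Or.inl rfl) h0 hπ ν
  rw [← ContinuousLinearMap.adjoint_inner_left, adjoint_scatOp_weightedGauss hε h0 hπ,
    adjoint_scatOp_weightedGauss hε h0 hπ, inner_smul_left, inner_smul_right, inner_reflOp_left,
    reflOp_reflOp, inner_toL2 (hs a) (hs b), hl a b, inner_add_right, inner_toL2 (hw a) (hw b),
    InnerProductSpace.rankOne_apply, inner_smul_right, inner_smul_right,
    inner_boundState_weightedGauss h0 hπ hν, ← inner_conj_symm,
    inner_boundState_weightedGauss h0 hπ hν, map_mul, Complex.conj_ofReal, Complex.conj_ofReal,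
    ← hK]
  have hε2 : (ε : ℂ) * ε = 1 := by rcases hε with rfl | rfl <;> simp
  rw [← mul_assoc, hε2, one_mul]
  field_simp

/-- Dividing the phase factors by `den` gives 1/cosh(νz) on the lines Im z = ±η. The pairing with an
image is then a difference of integrals of Gaussian/cosh over these two lines, which agree by a
contour shift. The minus sign is that of ε. -/
theorem scatOp_adjoint_boundState (hν : 0 < ν) (hη : 0 < η) (hπ : θ < Real.pi)
    (hθ : 2 * (ν * η) = θ) : (scatOp (-1) θ ν η).adjoint (toL2 (boundState θ ν)) = 0 := by
  have h0 : 0 < θ := by rw [← hθ]; positivity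
  have hε : (-1 : ℝ) = 1 ∨ (-1 : ℝ) = -1 := Or.inr rfl
  refine eq_zero_of_inner_gaussFn (m := fun x => (den (-1) θ (2 * η * x) : ℂ))
    (fun x => den_ne_zero hε h0 hπ _) (memLp_weightedGauss hε h0 hπ η) fun a => ?_
  change inner ℂ (toL2 (weightedGauss (-1) θ η a)) _ = 0
  rw [ContinuousLinearMap.adjoint_inner_right, scatOp_weightedGauss hε h0 hπ,
    inner_toL2 (memLp_scatGauss (Or.inl rfl) h0 hπ _ _ _ _) (memLp_boundState h0 hπ hν)]
  have hη' : ν * |η| < Real.pi / 2 := by rw [abs_of_pos hη]; linarith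
  have hη'' : ν * |-η| < Real.pi / 2 := by rwa [abs_neg]
  set c : ℂ := -(Complex.I * conj a) with hc
  have i1 := integral_cgauss_div_cosh (α := 1 / 2) (by norm_num) c hν hη'
  have i2 := integral_cgauss_div_cosh (α := 1 / 2) (by norm_num) c hν hη''
  have hI : ∀ y : ℝ, |y| = η → Integrable fun x : ℝ => cgauss (1 / 2) c (x + y * Complex.I) /
      Complex.cosh (ν * (x + y * Complex.I)) := by
    intro y hy
    have hy' : ν * |y| < Real.pi / 2 := by rw [hy]; linarith
    have hcos : 0 < Real.cos (ν * |y|) := Real.cos_pos_of_mem_Ioo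
      ⟨by nlinarith [Real.pi_pos, abs_nonneg y], hy'⟩
    have := integrable_cgauss_mul (α := 1 / 2) (by norm_num) c y (1 / Real.cos (ν * |y|))
      (m := fun z => 1 / Complex.cosh (ν * z)) ?_ fun x => ?_
    · simpa only [mul_one_div] using this
    · exact Continuous.div (by fun_prop) (by fun_prop)
        fun x => cosh_mul_ne_zero hν hy' (by simp)
    · have h1 := cos_mul_cosh_le_norm_cosh hν hy' (z := x + y * Complex.I) (by simp)
      rw [norm_div, norm_one]
      exact one_div_le_one_div_of_le hcos
        (le_trans (le_mul_of_one_le_right hcos.le (Real.one_le_cosh _)) h1)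
  have key : ∀ x : ℝ, conj (scatGauss 1 (-1) θ ν η a x) * boundState θ ν x =
      conj (Complex.exp (a ^ 2 / 2)) / 4 *
        (cgauss (1 / 2) c (x + η * Complex.I) / Complex.cosh (ν * (x + η * Complex.I)) -
          cgauss (1 / 2) c (x + (-η : ℝ) * Complex.I) /
            Complex.cosh (ν * (x + (-η : ℝ) * Complex.I))) := by
    intro x
    have hd := den_ne_zero (δ := 1) (Or.inl rfl) h0 hπ (2 * ν * x)
    have hG : ∀ y : ℝ, conj (gaussHat (a + y) x) =
        conj (Complex.exp (a ^ 2 / 2)) * cgauss (1 / 2) c (x + y * Complex.I) := by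
      intro y
      rw [gaussHat_eq, cgauss, ← Complex.exp_conj, ← Complex.exp_conj, ← Complex.exp_add]
      congr 1
      simp only [map_add, map_mul, map_div₀, map_pow, Complex.conj_ofReal, Complex.conj_I,
        Complex.conj_ofNat]
      push_cast
      rw [hc]
      linear_combination ((x : ℂ) ^ 2 / 2 + y ^ 2 / 2 + y * conj a) * Complex.I_sq
    have hq := phaseFn_mul_conj (δ := 1) (Or.inl rfl) h0 hπ ν x
    have e1 : Complex.cosh (ν * (x + η * Complex.I)) = phaseFn 1 θ ν x * den 1 θ (2 * ν * x) := by
      rw [phaseFn, div_mul_cancel₀ _ hd, kap_one, ← hθ]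
      congr 1
      push_cast; ring
    have e2 : Complex.cosh (ν * (x + (-η : ℝ) * Complex.I)) =
        conj (phaseFn 1 θ ν x) * den 1 θ (2 * ν * x) := by
      rw [← Complex.conj_ofReal (den _ _ _), ← map_mul, ← e1, ← Complex.cosh_conj]
      simp
    have hG1 := hG η
    have hG2 := hG (-η)
    rw [Complex.ofReal_neg, ← sub_eq_add_neg] at hG2
    rw [e1, e2, scatGauss, boundState]
    simp only [map_add, map_mul, map_div₀, Complex.conj_ofReal, Complex.conj_conj,
      Complex.conj_ofNat, hG1, hG2]
    have hq1 : phaseFn 1 θ ν x ≠ 0 := left_ne_zero_of_mul_eq_one hq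
    have hq2 : conj (phaseFn 1 θ ν x) ≠ 0 := right_ne_zero_of_mul_eq_one hq
    push_cast
    generalize cgauss (1 / 2) c (x + η * Complex.I) = X
    generalize cgauss (1 / 2) c (x + -η * Complex.I) = Y
    generalize conj (Complex.exp (a ^ 2 / 2)) = Z
    generalize conj (phaseFn 1 θ ν x) = Q' at *
    generalize phaseFn 1 θ ν x = Q at *
    field_simp
    linear_combination (4 * Z * Q' * X - 4 * Z * Q * Y) * hq
  simp_rw [key]
  rw [integral_const_mul, integral_sub (hI η (abs_of_pos hη)) (hI (-η) (by
    rw [abs_neg, abs_of_pos hη])), i1, i2, sub_self, mul_zero]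

theorem scatOp_neg_one_adjoint (hν : 0 < ν) (hη : 0 < η) (hπ : θ < Real.pi)
    (hθ : 2 * (ν * η) = θ) :
    scatOp (-1) θ ν η ∘L (scatOp (-1) θ ν η).adjoint = ContinuousLinearMap.id ℂ PositionSpace -
      (inner ℂ (toL2 (boundState θ ν)) (toL2 (boundState θ ν)))⁻¹ •
        InnerProductSpace.rankOne ℂ (toL2 (boundState θ ν)) (toL2 (boundState θ ν)) := by
  have h0 : 0 < θ := by rw [← hθ]; positivity
  obtain ⟨l, -, hl⟩ := scatOp_adjoint_scatOp (ε := -1) (Or.inr rfl) hν hη hπ hθ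
  set Ψ := toL2 (boundState θ ν) with hΨ
  have hi : inner ℂ Ψ Ψ ≠ 0 := by
    rw [hΨ, inner_boundState h0 hπ hν, Complex.ofReal_ne_zero]
    have := Real.sin_pos_of_pos_of_lt_pi h0 hπ
    positivity
  -- Evaluated at Ψ the rank one formula reads 0 = Ψ + l(Ψ,Ψ)Ψ, which determines l without a residue
  -- computation.
  have h1 := DFunLike.congr_fun hl Ψ
  rw [ContinuousLinearMap.comp_apply, scatOp_adjoint_boundState hν hη hπ hθ, map_zero] at h1
  have h2 := congrArg (fun v => inner ℂ Ψ v) h1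
  simp only [inner_zero_right, add_apply, smul_apply, ContinuousLinearMap.id_apply,
    InnerProductSpace.rankOne_apply, inner_add_right, inner_smul_right] at h2
  have h3 : l = -(inner ℂ Ψ Ψ)⁻¹ := by
    field_simp
    apply mul_right_cancel₀ hi
    linear_combination -h2
  rw [hl, h3, neg_smul, sub_eq_add_neg]

theorem scatOp_one_adjoint (hν : 0 < ν) (hη : 0 < η) (hπ : θ < Real.pi)
    (hθ : 2 * (ν * η) = θ) :
    scatOp 1 θ ν η ∘L (scatOp 1 θ ν η).adjoint = ContinuousLinearMap.id ℂ PositionSpace := by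
  obtain ⟨l, hl0, hl⟩ := scatOp_adjoint_scatOp (ε := 1) (Or.inl rfl) hν hη hπ hθ
  rw [hl, hl0 rfl, zero_smul, add_zero]

/-- As ū(r) = u(-r) and U commutes with the reflection, reflection exchanges the two summands. -/
theorem reflOp_scatOp (hε : ε = 1 ∨ ε = -1) (h0 : 0 < θ) (hπ : θ < Real.pi) (f : PositionSpace) :
    reflOp (scatOp ε θ ν η f) = (ε : ℂ) • scatOp ε θ ν η (reflOp f) := by
  have ha := isMultiplier_amplFn hε h0 hπ η
  have hu := isMultiplier_phaseFn (δ := 1) (Or.inl rfl) h0 hπ ν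
  have hc : (fun r => conj (phaseFn 1 θ ν r)) = fun r => phaseFn 1 θ ν (-r) := by
    funext r
    rw [conj_phaseFn (Or.inl rfl), Complex.ofReal_one, one_mul]
  have hε2 : (ε : ℂ) * ε = 1 := by rcases hε with rfl | rfl <;> simp
  rw [scatOp_apply, scatOp_apply, hc]
  simp only [map_smul, map_add, reflOp_mulOp hu, reflOp_mulOp hu.comp_neg, ← fourierOp_reflOp,
    reflOp_mulOp ha, reflOp_mulOp ha.comp_neg, neg_neg]
  match_scalars
  · linear_combination (-1 / 2 : ℂ) * hε2
  · ring

theorem reflOp_boundState (h0 : 0 < θ) (hπ : θ < Real.pi) (hν : 0 < ν) :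
    reflOp (toL2 (boundState θ ν)) = toL2 (boundState θ ν) := by
  rw [reflOp_toL2 (memLp_boundState h0 hπ hν)]
  congr 1 with x
  rw [boundState, boundState, mul_neg, den_neg]

end

/-! ### Extension by zero from the half line -/

open scoped NNReal in
theorem exists_zeroExt : ∃ L : HalfLineSpace →L[ℂ] PositionSpace,
    ∀ f, L f =ᵐ[volume] (Ioi (0 : ℝ)).indicator f := by
  refine exists_clm_of_ae (fun f => (Ioi (0 : ℝ)).indicator f) (fun f g h => ?_) (fun f g => ?_)
    (fun c f => ?_) 1 fun f hf => ⟨(memLp_indicator_iff_restrict measurableSet_Ioi).2 hf, ?_⟩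
  · exact (ae_eq_restrict_iff_indicator_ae_eq measurableSet_Ioi).1 h
  · exact indicator_add _ _ _
  · exact indicator_const_smul (Ioi (0 : ℝ)) c f
  · rw [eLpNorm_indicator_eq_eLpNorm_restrict measurableSet_Ioi]
    simp

/-- Extension by zero of functions on the half line. -/
def zeroExt : HalfLineSpace →L[ℂ] PositionSpace := exists_zeroExt.choose

theorem zeroExt_ae (f : HalfLineSpace) : zeroExt f =ᵐ[volume] (Ioi (0 : ℝ)).indicator f :=
  exists_zeroExt.choose_spec f

theorem exists_restrOp : ∃ L : PositionSpace →L[ℂ] HalfLineSpace,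
    ∀ f, L f =ᵐ[volume.restrict (Ioi (0 : ℝ))] f := by
  refine exists_clm_of_ae (fun f => f) (fun f g h => ae_restrict_of_ae h) (fun f g => rfl)
    (fun c f => rfl) 1 fun f hf => ⟨hf.restrict _, ?_⟩
  simpa using eLpNorm_mono_measure f Measure.restrict_le_self

/-- Restriction of functions to the half line. -/
def restrOp : PositionSpace →L[ℂ] HalfLineSpace := exists_restrOp.choose

theorem restrOp_ae (f : PositionSpace) : restrOp f =ᵐ[volume.restrict (Ioi (0 : ℝ))] f :=
  exists_restrOp.choose_spec f

theorem adjoint_zeroExt : zeroExt.adjoint = restrOp := by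
  symm
  rw [ContinuousLinearMap.eq_adjoint_iff]
  intro f g
  rw [inner_eq_integral, L2.inner_def]
  have h1 : ∫ x, conj (f x) * zeroExt g x = ∫ x, (Ioi (0 : ℝ)).indicator (fun x =>
      conj (f x) * g x) x := by
    refine integral_congr_ae ?_
    filter_upwards [zeroExt_ae g] with x hx
    rw [hx]
    by_cases h : x ∈ Ioi (0 : ℝ) <;> simp [h]
  rw [h1, integral_indicator measurableSet_Ioi]
  refine integral_congr_ae ?_
  filter_upwards [restrOp_ae f] with x hx
  rw [hx]
  simp [mul_comm]

theorem zeroExt_memLp {f : ℝ → ℂ} (hf : MemLp f 2 (volume.restrict (Ioi (0 : ℝ))))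
    (h0 : ∀ x ∉ Ioi (0 : ℝ), f x = 0) : zeroExt (hf.toLp f) = toL2 f := by
  refine eq_toL2 ?_
  filter_upwards [zeroExt_ae (hf.toLp f),
    (ae_restrict_iff' measurableSet_Ioi).1 hf.coeFn_toLp] with x h1 h2
  rw [h1]
  by_cases h : x ∈ Ioi (0 : ℝ)
  · rw [indicator_of_mem h, h2 h]
  · rw [indicator_of_notMem h, h0 x h]

/-- Extension by zero followed by multiplication with `m`. -/
def halfOp (m : ℝ → ℂ) : HalfLineSpace →L[ℂ] PositionSpace := mulOp m ∘L zeroExt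

section

variable {m : ℝ → ℂ}

theorem halfOp_ae (hm : IsMultiplier m) (f : HalfLineSpace) :
    halfOp m f =ᵐ[volume] (Ioi (0 : ℝ)).indicator fun x => m x * f x := by
  filter_upwards [mulOp_ae hm (zeroExt f), zeroExt_ae f] with x h1 h2
  rw [halfOp, ContinuousLinearMap.comp_apply, h1, h2]
  by_cases h : x ∈ Ioi (0 : ℝ) <;> simp [h]

theorem adjoint_halfOp (hm : IsMultiplier m) :
    (halfOp m).adjoint = restrOp ∘L mulOp fun x => conj (m x) := by
  rw [halfOp, ContinuousLinearMap.adjoint_comp, adjoint_zeroExt, adjoint_mulOp hm]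

theorem adjoint_halfOp_ae (hm : IsMultiplier m) (f : PositionSpace) :
    (halfOp m).adjoint f =ᵐ[volume.restrict (Ioi (0 : ℝ))] fun x => conj (m x) * f x := by
  rw [adjoint_halfOp hm]
  filter_upwards [restrOp_ae (mulOp (fun x => conj (m x)) f),
    ae_restrict_of_ae (mulOp_ae hm.conj f)] with x h1 h2
  rw [ContinuousLinearMap.comp_apply, h1, h2]

theorem adjoint_halfOp_halfOp (hm : IsMultiplier m) (h1 : ∀ x, m x * conj (m x) = 1)
    (f : HalfLineSpace) : (halfOp m).adjoint (halfOp m f) = f := by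
  refine Lp.ext ?_
  filter_upwards [adjoint_halfOp_ae hm (halfOp m f), ae_restrict_of_ae (halfOp_ae hm f),
    ae_restrict_mem measurableSet_Ioi] with x h2 h3 h4
  rw [h2, h3, indicator_of_mem h4, ← mul_assoc, mul_comm (conj _), h1, one_mul]

theorem adjoint_halfOp_reflOp_halfOp (hm : IsMultiplier m) (f : HalfLineSpace) :
    (halfOp m).adjoint (reflOp (halfOp m f)) = 0 := by
  refine Lp.ext ?_
  filter_upwards [adjoint_halfOp_ae hm (reflOp (halfOp m f)),
    ae_restrict_of_ae (reflOp_ae (halfOp m f)), ae_restrict_of_ae (ae_comp_neg (halfOp_ae hm f)),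
    ae_restrict_mem measurableSet_Ioi, Lp.coeFn_zero ℂ 2 (volume.restrict (Ioi (0 : ℝ)))]
    with x h2 h3 h4 h5 h6
  have h7 : -x ∉ Ioi (0 : ℝ) := by
    have : 0 < x := h5
    simp [this.le]
  rw [h2, h3, h4, h6, indicator_of_notMem h7, mul_zero, Pi.zero_apply]

theorem halfOp_adjoint_ae (hm : IsMultiplier m) (h1 : ∀ x, m x * conj (m x) = 1)
    (f : PositionSpace) : halfOp m ((halfOp m).adjoint f) =ᵐ[volume] (Ioi (0 : ℝ)).indicator f := by
  filter_upwards [halfOp_ae hm ((halfOp m).adjoint f),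
    (ae_restrict_iff' measurableSet_Ioi).1 (adjoint_halfOp_ae hm f)] with x h2 h3
  rw [h2]
  by_cases h : x ∈ Ioi (0 : ℝ)
  · rw [indicator_of_mem h, indicator_of_mem h, h3 h, ← mul_assoc, h1, one_mul]
  · rw [indicator_of_notMem h, indicator_of_notMem h]

/-- The two terms are the restrictions of f to the positive and the negative half line. -/
theorem halfOp_adjoint_add_refl (hm : IsMultiplier m) (h1 : ∀ x, m x * conj (m x) = 1)
    (f : PositionSpace) : halfOp m ((halfOp m).adjoint f) +
      reflOp (halfOp m ((halfOp m).adjoint (reflOp f))) = f := by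
  refine Lp.ext ?_
  have hne : ∀ᵐ x : ℝ, x ≠ 0 := by simp [ae_iff]
  filter_upwards [halfOp_adjoint_ae hm h1 f, ae_comp_neg (halfOp_adjoint_ae hm h1 (reflOp f)),
    reflOp_ae (halfOp m ((halfOp m).adjoint (reflOp f))), ae_comp_neg (reflOp_ae f), hne,
    Lp.coeFn_add (halfOp m ((halfOp m).adjoint f))
      (reflOp (halfOp m ((halfOp m).adjoint (reflOp f))))] with x h2 h3 h4 h5 h6 h7
  rw [h7, Pi.add_apply, h2, h4, h3]
  rcases lt_or_gt_of_ne h6 with h | h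
  · have a : x ∉ Ioi (0 : ℝ) := by simp [h.le]
    have b : -x ∈ Ioi (0 : ℝ) := by simp [h]
    rw [indicator_of_notMem a, indicator_of_mem b, h5, neg_neg, zero_add]
  · have a : x ∈ Ioi (0 : ℝ) := h
    have b : -x ∉ Ioi (0 : ℝ) := by simp [h.le]
    rw [indicator_of_notMem b, indicator_of_mem a, add_zero]

end

/-! ### The transform as a bounded operator -/

/-- The operator `S_ε (1 - σ N) X_ε` on the half line, with `S_ε` the scattering operator, `N` the
reflection and `X_ε` the extension by zero followed by multiplication with a phase. -/
def channelOp (σ ε θ ν η : ℝ) : HalfLineSpace →L[ℂ] PositionSpace :=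
  scatOp ε θ ν η ∘L (halfOp (phaseFn ε θ η) - (σ : ℂ) • (reflOp ∘L halfOp (phaseFn ε θ η)))

/-- The even part in `ε` of the operators `channelOp`. -/
def plusOp (σ θ ν η : ℝ) : HalfLineSpace →L[ℂ] PositionSpace :=
  (1 / 2 : ℂ) • (channelOp σ 1 θ ν η + channelOp σ (-1) θ ν η)

/-- The odd part in `ε` of the operators `channelOp`. -/
def minusOp (σ θ ν η : ℝ) : HalfLineSpace →L[ℂ] PositionSpace :=
  (σ / 2 : ℂ) • (channelOp σ 1 θ ν η - channelOp σ (-1) θ ν η)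

/-- The bounded extension of the integral transform. -/
def transformOp (σ θ ν η : ℝ) : MomentumSpace →L[ℂ] PositionSpace :=
  plusOp σ θ ν η ∘L WithLp.fstL 2 ℂ HalfLineSpace HalfLineSpace +
    minusOp σ θ ν η ∘L WithLp.sndL 2 ℂ HalfLineSpace HalfLineSpace

section

variable {σ ε θ ν η : ℝ}

theorem channelOp_apply (f : HalfLineSpace) : channelOp σ ε θ ν η f =
    scatOp ε θ ν η (halfOp (phaseFn ε θ η) f - (σ : ℂ) • reflOp (halfOp (phaseFn ε θ η) f)) := rfl

theorem transformOp_apply (x : MomentumSpace) :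
    transformOp σ θ ν η x = plusOp σ θ ν η x.fst + minusOp σ θ ν η x.snd := rfl

theorem adjoint_channelOp_apply (h : PositionSpace) : (channelOp σ ε θ ν η).adjoint h =
    (halfOp (phaseFn ε θ η)).adjoint ((scatOp ε θ ν η).adjoint h -
      (σ : ℂ) • reflOp ((scatOp ε θ ν η).adjoint h)) := by
  refine ext_inner_left ℂ fun f => ?_
  rw [ContinuousLinearMap.adjoint_inner_right, ContinuousLinearMap.adjoint_inner_right,
    channelOp_apply, ← ContinuousLinearMap.adjoint_inner_right, inner_sub_left, inner_sub_right,
    inner_smul_left, inner_smul_right, inner_reflOp_left, Complex.conj_ofReal]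

/-- The scattering operator is isometric, and X and NX are isometries with orthogonal ranges, being
supported on opposite half lines; this is the factor 2. -/
theorem inner_channelOp (hσ : σ = 1 ∨ σ = -1) (hε : ε = 1 ∨ ε = -1) (hν : 0 < ν) (hη : 0 < η)
    (hπ : θ < Real.pi) (hθ : 2 * (ν * η) = θ) (f g : HalfLineSpace) :
    inner ℂ (channelOp σ ε θ ν η f) (channelOp σ ε θ ν η g) = 2 * inner ℂ f g := by
  have h0 : 0 < θ := by rw [← hθ]; positivity
  have hm := isMultiplier_phaseFn hε h0 hπ η
  have hS : ∀ v, (scatOp ε θ ν η).adjoint (scatOp ε θ ν η v) = v :=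
    fun v => DFunLike.congr_fun (adjoint_scatOp_scatOp hε hν hη hπ hθ) v
  have h1 := adjoint_halfOp_halfOp hm (phaseFn_mul_conj hε h0 hπ η) g
  have h2 := adjoint_halfOp_reflOp_halfOp hm g
  have hσ2 : (σ : ℂ) * σ = 1 := by rcases hσ with rfl | rfl <;> simp
  rw [← ContinuousLinearMap.adjoint_inner_right, adjoint_channelOp_apply, channelOp_apply, hS]
  simp only [map_sub, map_smul, reflOp_reflOp, h1, h2, smul_zero, sub_zero, zero_sub, smul_neg,
    sub_neg_eq_add, smul_smul, hσ2, one_smul, inner_add_right]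
  ring

/-- N S_ε = ε S_ε N and N(1 - σN) = -σ(1 - σN). The two channels thus have opposite parities, which
makes their ranges orthogonal. -/
theorem reflOp_channelOp (hσ : σ = 1 ∨ σ = -1) (hε : ε = 1 ∨ ε = -1) (h0 : 0 < θ)
    (hπ : θ < Real.pi) (f : HalfLineSpace) :
    reflOp (channelOp σ ε θ ν η f) = (-(ε * σ) : ℂ) • channelOp σ ε θ ν η f := by
  have hσ2 : (σ : ℂ) * σ = 1 := by rcases hσ with rfl | rfl <;> simp
  rw [channelOp_apply, reflOp_scatOp hε h0 hπ]
  simp only [map_sub, map_smul, reflOp_reflOp]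
  match_scalars
  · linear_combination (-ε : ℂ) * hσ2
  · ring

theorem inner_channelOp_one_neg_one (hσ : σ = 1 ∨ σ = -1) (h0 : 0 < θ)
    (hπ : θ < Real.pi) (f g : HalfLineSpace) :
    inner ℂ (channelOp σ 1 θ ν η f) (channelOp σ (-1) θ ν η g) = 0 := by
  have hσ2 : (σ : ℂ) * σ = 1 := by rcases hσ with rfl | rfl <;> simp
  have h1 := inner_reflOp_left (channelOp σ 1 θ ν η f) (reflOp (channelOp σ (-1) θ ν η g))
  rw [reflOp_reflOp, reflOp_channelOp hσ (Or.inl rfl) h0 hπ,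
    reflOp_channelOp hσ (Or.inr rfl) h0 hπ, inner_smul_left, inner_smul_right] at h1
  simp only [map_neg, map_mul, Complex.conj_ofReal, Complex.ofReal_one, Complex.ofReal_neg,
    map_one] at h1
  linear_combination (-1 / 2 : ℂ) * h1 -
    (1 / 2 : ℂ) * inner ℂ (channelOp σ 1 θ ν η f) (channelOp σ (-1) θ ν η g) * hσ2

/-- With A = XX* and A + NAN = 1 one finds (1 - σN)A(1 - σN) = 1 - σN. -/
theorem channelOp_adjoint (hσ : σ = 1 ∨ σ = -1) (hε : ε = 1 ∨ ε = -1) (h0 : 0 < θ)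
    (hπ : θ < Real.pi) (h : PositionSpace) :
    channelOp σ ε θ ν η ((channelOp σ ε θ ν η).adjoint h) =
      scatOp ε θ ν η ((scatOp ε θ ν η).adjoint h) -
        (σ * ε : ℂ) • reflOp (scatOp ε θ ν η ((scatOp ε θ ν η).adjoint h)) := by
  have hm := isMultiplier_phaseFn hε h0 hπ η
  have hσ2 : (σ : ℂ) * σ = 1 := by rcases hσ with rfl | rfl <;> simp
  have hε2 : (ε : ℂ) * ε = 1 := by rcases hε with rfl | rfl <;> simp
  rw [adjoint_channelOp_apply, channelOp_apply, reflOp_scatOp hε h0 hπ, smul_smul, mul_assoc, hε2,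
    mul_one, ← (scatOp ε θ ν η).map_smul (σ : ℂ), ← (scatOp ε θ ν η).map_sub]
  congr 1
  set w := (scatOp ε θ ν η).adjoint h
  have h1 := halfOp_adjoint_add_refl hm (phaseFn_mul_conj hε h0 hπ η) w
  have h2 := halfOp_adjoint_add_refl hm (phaseFn_mul_conj hε h0 hπ η) (reflOp w)
  rw [reflOp_reflOp] at h2
  conv_rhs => rw [← h2]
  nth_rewrite 5 [← h1]
  simp only [map_sub, map_smul]
  match_scalars <;> first | ring1 | linear_combination hσ2

theorem adjoint_transformOp_apply (h : PositionSpace) : (transformOp σ θ ν η).adjoint h =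
    WithLp.toLp 2 ((plusOp σ θ ν η).adjoint h, (minusOp σ θ ν η).adjoint h) := by
  refine ext_inner_left ℂ fun f => ?_
  rw [ContinuousLinearMap.adjoint_inner_right, transformOp_apply, inner_add_left,
    WithLp.prod_inner_apply, ContinuousLinearMap.adjoint_inner_right,
    ContinuousLinearMap.adjoint_inner_right]
  rfl

/-- Given C_ε*C_ε = 2 and orthogonal ranges, the diagonal entries are (2 + 2)/4 = 1 and the mixed
ones are multiples of 2 - 2. -/
theorem inner_transformOp (hσ : σ = 1 ∨ σ = -1) (hν : 0 < ν) (hη : 0 < η)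
    (hπ : θ < Real.pi) (hθ : 2 * (ν * η) = θ) (x y : MomentumSpace) :
    inner ℂ (transformOp σ θ ν η x) (transformOp σ θ ν η y) = inner ℂ x y := by
  have h0 : 0 < θ := by rw [← hθ]; positivity
  have hσ2 : (σ : ℂ) * σ = 1 := by rcases hσ with rfl | rfl <;> simp
  have e1 := inner_channelOp hσ (Or.inl rfl) hν hη hπ hθ
  have e2 := inner_channelOp hσ (Or.inr rfl) hν hη hπ hθ
  have e3 := inner_channelOp_one_neg_one (ν := ν) (η := η) hσ h0 hπ
  have e4 : ∀ f g, inner ℂ (channelOp σ (-1) θ ν η f) (channelOp σ 1 θ ν η g) = 0 := fun f g => by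
    rw [← inner_conj_symm, e3, map_zero]
  rw [transformOp_apply, transformOp_apply, WithLp.prod_inner_apply]
  simp only [plusOp, minusOp, smul_apply, add_apply, sub_apply, inner_add_left, inner_add_right,
    inner_sub_left, inner_sub_right, inner_smul_left, inner_smul_right, e1, e2, e3, e4, map_div₀,
    Complex.conj_ofReal, Complex.conj_ofNat, map_one]
  change _ = inner ℂ x.fst y.fst + inner ℂ x.snd y.snd
  linear_combination inner ℂ x.snd y.snd * hσ2

theorem adjoint_transformOp_transformOp (hσ : σ = 1 ∨ σ = -1) (hν : 0 < ν) (hη : 0 < η)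
    (hπ : θ < Real.pi) (hθ : 2 * (ν * η) = θ) :
    (transformOp σ θ ν η).adjoint ∘L transformOp σ θ ν η =
      ContinuousLinearMap.id ℂ MomentumSpace := by
  ext1 x
  refine ext_inner_left ℂ fun y => ?_
  rw [ContinuousLinearMap.comp_apply, ContinuousLinearMap.adjoint_inner_right,
    inner_transformOp hσ hν hη hπ hθ, ContinuousLinearMap.id_apply]

/-- The sum of (1 - σN)/2 and (1 + σN)/2 gives the identity. Only the second, for ε = -1, meets the
bound state projection, and on an even function it acts as (1 + σ)/2. -/
theorem transformOp_adjoint_apply (hσ : σ = 1 ∨ σ = -1) (hν : 0 < ν) (hη : 0 < η)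
    (hπ : θ < Real.pi) (hθ : 2 * (ν * η) = θ) (h : PositionSpace) :
    transformOp σ θ ν η ((transformOp σ θ ν η).adjoint h) = h -
      ((1 + σ) / 2 * (inner ℂ (toL2 (boundState θ ν)) (toL2 (boundState θ ν)))⁻¹ : ℂ) •
        InnerProductSpace.rankOne ℂ (toL2 (boundState θ ν)) (toL2 (boundState θ ν)) h := by
  have h0 : 0 < θ := by rw [← hθ]; positivity
  have hσ2 : (σ : ℂ) * σ = 1 := by rcases hσ with rfl | rfl <;> simp
  have e1 := channelOp_adjoint (ν := ν) (η := η) hσ (Or.inl rfl) h0 hπ h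
  have e2 := channelOp_adjoint (ν := ν) (η := η) hσ (Or.inr rfl) h0 hπ h
  have s1 : scatOp 1 θ ν η ((scatOp 1 θ ν η).adjoint h) = h :=
    DFunLike.congr_fun (scatOp_one_adjoint hν hη hπ hθ) h
  have s2 : scatOp (-1) θ ν η ((scatOp (-1) θ ν η).adjoint h) = h -
      (inner ℂ (toL2 (boundState θ ν)) (toL2 (boundState θ ν)))⁻¹ •
        inner ℂ (toL2 (boundState θ ν)) h • toL2 (boundState θ ν) :=
    DFunLike.congr_fun (scatOp_neg_one_adjoint hν hη hπ hθ) h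
  rw [s1] at e1
  rw [s2] at e2
  simp only [map_sub, map_smul, reflOp_boundState h0 hπ hν] at e2
  have e3 : transformOp σ θ ν η ((transformOp σ θ ν η).adjoint h) = (1 / 2 : ℂ) •
      (channelOp σ 1 θ ν η ((channelOp σ 1 θ ν η).adjoint h) +
        channelOp σ (-1) θ ν η ((channelOp σ (-1) θ ν η).adjoint h)) := by
    have a1 : (plusOp σ θ ν η).adjoint h = (1 / 2 : ℂ) • ((channelOp σ 1 θ ν η).adjoint h +
        (channelOp σ (-1) θ ν η).adjoint h) := by
      rw [plusOp, LinearIsometryEquiv.map_smulₛₗ, map_add]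
      simp [Complex.conj_ofNat]
    have a2 : (minusOp σ θ ν η).adjoint h = (σ / 2 : ℂ) • ((channelOp σ 1 θ ν η).adjoint h -
        (channelOp σ (-1) θ ν η).adjoint h) := by
      rw [minusOp, LinearIsometryEquiv.map_smulₛₗ, map_sub]
      simp [Complex.conj_ofNat]
    rw [adjoint_transformOp_apply]
    change plusOp σ θ ν η ((plusOp σ θ ν η).adjoint h) +
      minusOp σ θ ν η ((minusOp σ θ ν η).adjoint h) = _
    rw [a1, a2, plusOp, minusOp]
    simp only [smul_apply, add_apply, sub_apply, map_add, map_sub, map_smul]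
    match_scalars <;> first | linear_combination (1 / 4 : ℂ) * hσ2 |
      linear_combination (-1 / 4 : ℂ) * hσ2
  rw [e3, e1, e2, InnerProductSpace.rankOne_apply]
  push_cast
  match_scalars <;> ring

end

/-! ### Kernels -/

/-- The integral kernel, up to `(2π)^{-1/2}`, of `S_ε X_ε`. -/
def waveKernel (ε θ ν η r k : ℝ) : ℂ :=
  1 / 2 * Complex.exp (Complex.I * r * k) * (phaseFn 1 θ ν r * amplFn ε θ η k +
    ε * conj (phaseFn 1 θ ν r) * amplFn ε θ η (-k)) * phaseFn ε θ η k

theorem IsHalfLineTest.eq_zero {f : ℝ → ℂ} (hf : IsHalfLineTest f) {x : ℝ}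
    (hx : x ∉ Ioi (0 : ℝ)) : f x = 0 :=
  image_eq_zero_of_notMem_tsupport fun h => hx (hf.support h)

section

variable {ε θ ν η : ℝ}

theorem continuous_waveKernel (hε : ε = 1 ∨ ε = -1) (h0 : 0 < θ) (hπ : θ < Real.pi) (r : ℝ) :
    Continuous (waveKernel ε θ ν η r) := by
  have h1 := (isMultiplier_amplFn hε h0 hπ η).cont
  have h2 := (isMultiplier_phaseFn hε h0 hπ η).cont
  unfold waveKernel
  fun_prop

theorem integrable_waveKernel_mul (hε : ε = 1 ∨ ε = -1) (h0 : 0 < θ) (hπ : θ < Real.pi)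
    {f : ℝ → ℂ} (hf : IsHalfLineTest f) (r : ℝ) :
    Integrable fun k => waveKernel ε θ ν η r k * f k :=
  ((continuous_waveKernel hε h0 hπ r).mul hf.smooth.continuous).integrable_of_hasCompactSupport
    hf.compact.mul_left

theorem halfOp_test {m f : ℝ → ℂ} (hm : IsMultiplier m) (hf : IsHalfLineTest f) :
    halfOp m (hf.memLp.toLp f) = toL2 fun k => m k * f k := by
  rw [halfOp, ContinuousLinearMap.comp_apply, zeroExt_memLp hf.memLp fun x hx => hf.eq_zero hx,
    mulOp_toL2 hm (hf.smooth.continuous.memLp_of_hasCompactSupport hf.compact)]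

theorem fourierOp_mulOp_halfOp_test {a m f : ℝ → ℂ} (ha : IsMultiplier a) (hm : IsMultiplier m)
    (hf : IsHalfLineTest f) : fourierOp (mulOp a (halfOp m (hf.memLp.toLp f))) =ᵐ[volume]
      fun r : ℝ => ((1 / √(2 * Real.pi) : ℝ) : ℂ) *
        ∫ k : ℝ, Complex.exp (Complex.I * r * k) * (a k * (m k * f k)) := by
  have h1 : MemLp (fun k => m k * f k) 2 volume :=
    hm.memLp (hf.smooth.continuous.memLp_of_hasCompactSupport hf.compact)
  have h2 : Integrable fun k => a k * (m k * f k) :=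
    (ha.cont.mul (hm.cont.mul hf.smooth.continuous)).integrable_of_hasCompactSupport
      hf.compact.mul_left.mul_left
  rw [halfOp_test hm hf, mulOp_toL2 ha h1]
  exact fourierOp_toL2 h2 (ha.memLp h1)

theorem scatOp_halfOp_test (hε : ε = 1 ∨ ε = -1) (h0 : 0 < θ) (hπ : θ < Real.pi)
    {f : ℝ → ℂ} (hf : IsHalfLineTest f) :
    scatOp ε θ ν η (halfOp (phaseFn ε θ η) (hf.memLp.toLp f)) =ᵐ[volume] fun r : ℝ =>
      ((1 / √(2 * Real.pi) : ℝ) : ℂ) * ∫ k, waveKernel ε θ ν η r k * f k := by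
  have ha := isMultiplier_amplFn hε h0 hπ η
  have hu := isMultiplier_phaseFn (δ := 1) (Or.inl rfl) h0 hπ ν
  have hm := isMultiplier_phaseFn hε h0 hπ η
  rw [scatOp_apply]
  set g := halfOp (phaseFn ε θ η) (hf.memLp.toLp f) with hg
  filter_upwards [Lp.coeFn_smul (1 / 2 : ℂ) (mulOp (phaseFn 1 θ ν) (fourierOp
      (mulOp (amplFn ε θ η) g)) + (ε : ℂ) • mulOp (fun r => conj (phaseFn 1 θ ν r)) (fourierOp
        (mulOp (fun k => amplFn ε θ η (-k)) g))),
    Lp.coeFn_add (mulOp (phaseFn 1 θ ν) (fourierOp (mulOp (amplFn ε θ η) g)))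
      ((ε : ℂ) • mulOp (fun r => conj (phaseFn 1 θ ν r)) (fourierOp
        (mulOp (fun k => amplFn ε θ η (-k)) g))),
    Lp.coeFn_smul (ε : ℂ) (mulOp (fun r => conj (phaseFn 1 θ ν r)) (fourierOp
        (mulOp (fun k => amplFn ε θ η (-k)) g))),
    mulOp_ae hu (fourierOp (mulOp (amplFn ε θ η) g)),
    mulOp_ae hu.conj (fourierOp (mulOp (fun k => amplFn ε θ η (-k)) g)),
    fourierOp_mulOp_halfOp_test ha hm hf, fourierOp_mulOp_halfOp_test ha.comp_neg hm hf]
    with r e1 e2 e3 e4 e5 e6 e7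
  rw [← hg] at e6 e7
  have hI : ∀ {a : ℝ → ℂ}, Continuous a → Integrable fun k : ℝ =>
      Complex.exp (Complex.I * r * k) * (a k * (phaseFn ε θ η k * f k)) := fun {a} h =>
    (Continuous.mul (by fun_prop) (h.mul (hm.cont.mul
      hf.smooth.continuous))).integrable_of_hasCompactSupport
        hf.compact.mul_left.mul_left.mul_left
  have key : ∫ k, waveKernel ε θ ν η r k * f k =
      1 / 2 * (phaseFn 1 θ ν r * ∫ k : ℝ, Complex.exp (Complex.I * r * k) *
        (amplFn ε θ η k * (phaseFn ε θ η k * f k))) + 1 / 2 * (ε * conj (phaseFn 1 θ ν r) *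
        ∫ k : ℝ, Complex.exp (Complex.I * r * k) *
          (amplFn ε θ η (-k) * (phaseFn ε θ η k * f k))) := by
    rw [← integral_const_mul, ← integral_const_mul, ← integral_const_mul, ← integral_const_mul,
      ← integral_add (((hI ha.cont).const_mul _).const_mul _)
        (((hI ha.comp_neg.cont).const_mul _).const_mul _)]
    congr 1 with k
    rw [waveKernel]
    ring
  rw [e1, Pi.smul_apply, e2, Pi.add_apply, e3, Pi.smul_apply, e4, e5, e6, e7, key]
  simp only [smul_eq_mul]
  ring

theorem kap_sub_ne_zero (hε : ε = 1 ∨ ε = -1) (h0 : 0 < θ) (hπ : θ < Real.pi) (x : ℝ) :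
    kap ε (x - (θ / 2 : ℝ) * Complex.I) ≠ 0 := by
  have h : kap ε (x - (θ / 2 : ℝ) * Complex.I) = conj (kap ε (x + (θ / 2 : ℝ) * Complex.I)) := by
    rw [conj_kap]; simp [sub_eq_add_neg, Complex.conj_ofNat]
  rw [h, ← norm_ne_zero_iff, RCLike.norm_conj, norm_kap hε h0 hπ]
  exact (den_pos hε h0 hπ _).ne'

/-- Phase over modulus is the inverse of the complex conjugate. -/
theorem phaseFn_div_den (hε : ε = 1 ∨ ε = -1) (h0 : 0 < θ) (hπ : θ < Real.pi) (k : ℝ) :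
    phaseFn ε θ η k / den ε θ (2 * η * k) = 1 / kap ε (η * k - (θ / 2 : ℝ) * Complex.I) := by
  have hd := den_ne_zero hε h0 hπ (2 * η * k)
  have hk := kap_sub_ne_zero hε h0 hπ (η * k)
  rw [Complex.ofReal_mul] at hk
  have h1 := phaseFn_mul_conj hε h0 hπ η k
  have h2 : conj (phaseFn ε θ η k) = kap ε (η * k - (θ / 2 : ℝ) * Complex.I) /
      den ε θ (2 * η * k) := by
    rw [phaseFn, map_div₀, conj_kap, Complex.conj_ofReal]
    simp [sub_eq_add_neg, Complex.conj_ofNat]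
  rw [h2, mul_div_assoc', div_eq_one_iff_eq hd] at h1
  rw [div_eq_div_iff hd hk, h1, one_mul]

theorem waveKernel_eq (hε : ε = 1 ∨ ε = -1) (h0 : 0 < θ) (hπ : θ < Real.pi) (r k : ℝ) :
    waveKernel ε θ ν η r k = 1 / (2 * den 1 θ (2 * ν * r)) * Complex.exp (Complex.I * r * k) *
      (Complex.cosh (ν * r + (θ / 2 : ℝ) * Complex.I) * Complex.exp (η * k) +
        ε * Complex.cosh (ν * r - (θ / 2 : ℝ) * Complex.I) * Complex.exp (-(η * k))) /
      kap ε (η * k - (θ / 2 : ℝ) * Complex.I) := by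
  have hd := den_ne_zero hε h0 hπ (2 * η * k)
  have hd' := den_ne_zero (δ := 1) (Or.inl rfl) h0 hπ (2 * ν * r)
  have h1 := phaseFn_div_den (η := η) hε h0 hπ k
  have h2 : phaseFn 1 θ ν r = Complex.cosh (ν * r + (θ / 2 : ℝ) * Complex.I) /
      den 1 θ (2 * ν * r) := by rw [phaseFn, kap_one]
  have h3 : conj (phaseFn 1 θ ν r) = Complex.cosh (ν * r - (θ / 2 : ℝ) * Complex.I) /
      den 1 θ (2 * ν * r) := by
    rw [h2, map_div₀, ← Complex.cosh_conj, Complex.conj_ofReal]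
    simp [sub_eq_add_neg, Complex.conj_ofNat]
  have h4 : amplFn ε θ η (-k) = Complex.exp (-(η * k)) / den ε θ (2 * η * k) := by
    rw [amplFn, mul_neg, den_neg]; push_cast; rw [mul_neg]
  rw [waveKernel, h3, h2, h4, amplFn]
  rw [div_eq_mul_one_div _ (kap _ _), ← h1]
  field_simp

end

/-- This is `kernelE_eq` with E = e^{ηk}, T = e^{iθ/2}, R = e^{νr}, W = e^{irk}, D = `den`. The two
channels have denominators cosh and sinh of ηk - iθ/2, whose product is half the sinh(2ηk - iθ) in
the denominator of Ψ_σ. -/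
theorem kernel_algebra {E T R W D σ : ℂ} (hE : E ≠ 0) (hT : T ≠ 0) (hR : R ≠ 0) (hW : W ≠ 0)
    (hD : D ≠ 0) (h1 : E ^ 2 + T ^ 2 ≠ 0) (h2 : E ^ 2 - T ^ 2 ≠ 0) :
    1 / (2 * D) / ((E ^ 2 - T ^ 2) * (E ^ 2 + T ^ 2) / (2 * E ^ 2 * T ^ 2)) *
      (W * (R⁻¹ * ((E ^ 2 - T ^ 2) * (E ^ 2 + T ^ 2) / (2 * E ^ 2 * T ^ 2)) +
          R * ((E ^ 2 - (E ^ 2)⁻¹) / 2)) +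
        σ * W⁻¹ * R⁻¹ * ((T ^ 2 - (T ^ 2)⁻¹) / 2)) =
    1 / 2 * (1 / (2 * D) * W * ((R * T + (R * T)⁻¹) / 2 * E + (R / T + T / R) / 2 * E⁻¹) /
          ((E ^ 2 + T ^ 2) / (2 * E * T)) +
        1 / (2 * D) * W * ((R * T + (R * T)⁻¹) / 2 * E + -1 * ((R / T + T / R) / 2) * E⁻¹) /
          ((E ^ 2 - T ^ 2) / (2 * E * T))) -
      σ / 2 * (1 / (2 * D) * W⁻¹ * ((R / T + T / R) / 2 * E + (R * T + (R * T)⁻¹) / 2 * E⁻¹) /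
          ((E ^ 2 + T ^ 2) / (2 * E * T)) -
        1 / (2 * D) * W⁻¹ * ((R / T + T / R) / 2 * E + -1 * ((R * T + (R * T)⁻¹) / 2) * E⁻¹) /
          ((E ^ 2 - T ^ 2) / (2 * E * T))) := by
  field_simp
  ring

section

variable {ρ κ : ℝ}

theorem sqrtWeightE_eq (hρ : 0 < ρ) (hκ : 0 < κ) (hρκ : Real.pi < ρ * κ) (r : ℝ) :
    sqrtWeightE ρ κ r =
      1 / (2 * den 1 (Real.pi ^ 2 / (ρ * κ)) (2 * (Real.pi / ρ) * r)) := by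
  set θ := Real.pi ^ 2 / (ρ * κ) with hθ
  have h0 : 0 < θ := by positivity
  have hπ : θ < Real.pi := by
    rw [hθ, div_lt_iff₀ (by positivity)]
    nlinarith [Real.pi_pos]
  have hz : ((Real.pi / ρ : ℂ) * (r + Complex.I * (Real.pi / (2 * κ)))) =
      ((Real.pi / ρ * r : ℝ) : ℂ) + (θ / 2 : ℝ) * Complex.I := by
    rw [hθ]
    push_cast
    have : (ρ : ℂ) ≠ 0 := by exact_mod_cast hρ.ne'
    have : (κ : ℂ) ≠ 0 := by exact_mod_cast hκ.ne'
    field_simp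
  have hd := den_pos (δ := 1) (Or.inl rfl) h0 hπ (2 * (Real.pi / ρ) * r)
  rw [sqrtWeightE, weightE_eq, Complex.ofReal_re, hz, ← kap_one, Complex.normSq_eq_norm_sq,
    norm_kap (Or.inl rfl) h0 hπ, ← mul_assoc]
  rw [show ∀ d : ℝ, 1 / (4 * d ^ 2) = (1 / (2 * d)) ^ 2 from fun d => by ring]
  exact Real.sqrt_sq (by positivity)

theorem kernelE_eq (hρ : 0 < ρ) (hκ : 0 < κ) (hρκ : Real.pi < ρ * κ) {θ ν η : ℝ}
    (hθ : θ = Real.pi ^ 2 / (ρ * κ)) (hν : ν = Real.pi / ρ) (hη : η = Real.pi / (2 * κ))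
    (σ r k : ℝ) : kernelE ρ κ σ r k =
      1 / 2 * (waveKernel 1 θ ν η r k + waveKernel (-1) θ ν η r k) -
        σ / 2 * (waveKernel 1 θ ν η (-r) k - waveKernel (-1) θ ν η (-r) k) := by
  have h0 : 0 < θ := by rw [hθ]; positivity
  have hπ : θ < Real.pi := by
    rw [hθ, div_lt_iff₀ (by positivity)]
    nlinarith [Real.pi_pos]
  have hρ' : (ρ : ℂ) ≠ 0 := by exact_mod_cast hρ.ne'
  have hκ' : (κ : ℂ) ≠ 0 := by exact_mod_cast hκ.ne'
  have hd := den_ne_zero (δ := 1) (Or.inl rfl) h0 hπ (2 * ν * r)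
  have hk1 := kap_sub_ne_zero (ε := 1) (Or.inl rfl) h0 hπ (η * k)
  have hk2 := kap_sub_ne_zero (ε := -1) (Or.inr rfl) h0 hπ (η * k)
  rw [waveKernel_eq (Or.inl rfl) h0 hπ, waveKernel_eq (Or.inr rfl) h0 hπ,
    waveKernel_eq (Or.inl rfl) h0 hπ, waveKernel_eq (Or.inr rfl) h0 hπ, kernelE,
    sqrtWeightE_eq hρ hκ hρκ, ← hθ, ← hν, mul_neg, den_neg]
  set E := Complex.exp (η * k) with hE
  set T := Complex.exp ((θ / 2 : ℝ) * Complex.I) with hT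
  set R := Complex.exp (ν * r) with hR
  set W := Complex.exp (Complex.I * r * k) with hW
  have nE : E ≠ 0 := Complex.exp_ne_zero _
  have nT : T ≠ 0 := Complex.exp_ne_zero _
  have nR : R ≠ 0 := Complex.exp_ne_zero _
  have nW : W ≠ 0 := Complex.exp_ne_zero _
  have e1 : Complex.exp (-(η * k)) = E⁻¹ := Complex.exp_neg _
  have k1 : ∀ s : ℝ, kap s (η * k - (θ / 2 : ℝ) * Complex.I) =
      (E ^ 2 + s * T ^ 2) / (2 * E * T) := by
    intro s
    rw [kap, neg_sub, Complex.exp_sub, Complex.exp_sub, ← hE, ← hT]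
    field_simp
  have c1 : Complex.cosh (ν * r + (θ / 2 : ℝ) * Complex.I) = (R * T + (R * T)⁻¹) / 2 := by
    rw [Complex.cosh, Complex.exp_neg, Complex.exp_add]
  have c2 : Complex.cosh (ν * r - (θ / 2 : ℝ) * Complex.I) = (R / T + T / R) / 2 := by
    rw [Complex.cosh, neg_sub, Complex.exp_sub, Complex.exp_sub]
  have c3 : Complex.cosh (ν * (-r : ℝ) + (θ / 2 : ℝ) * Complex.I) = (R / T + T / R) / 2 := by
    rw [← c2, ← Complex.cosh_neg]; congr 1; push_cast; ring
  have c4 : Complex.cosh (ν * (-r : ℝ) - (θ / 2 : ℝ) * Complex.I) =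
      (R * T + (R * T)⁻¹) / 2 := by
    rw [← c1, ← Complex.cosh_neg]; congr 1; push_cast; ring
  have w1 : Complex.exp (Complex.I * (-r : ℝ) * k) = W⁻¹ := by
    rw [hW, ← Complex.exp_neg]; congr 1; push_cast; ring
  have w2 : Complex.exp (-(Complex.I * r * k)) = W⁻¹ := Complex.exp_neg _
  have r1 : Complex.exp (Real.pi * r / ρ) = R := by
    rw [hR, hν]; congr 1; push_cast; ring
  have r2 : Complex.exp (-(Real.pi * r / ρ)) = R⁻¹ := by rw [Complex.exp_neg, r1]
  have E2 : Complex.exp (2 * (η * k)) = E ^ 2 := by rw [hE, ← Complex.exp_nat_mul]; norm_num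
  have T2 : Complex.exp (θ * Complex.I) = T ^ 2 := by
    rw [hT, ← Complex.exp_nat_mul]; congr 1; push_cast; ring
  have s1 : Complex.sinh ((Real.pi / κ) * (k - Complex.I * Real.pi / ρ)) =
      (E ^ 2 - T ^ 2) * (E ^ 2 + T ^ 2) / (2 * E ^ 2 * T ^ 2) := by
    have : (Real.pi / κ : ℂ) * (k - Complex.I * Real.pi / ρ) =
        2 * (η * k) - θ * Complex.I := by
      rw [hη, hθ]; push_cast; field_simp
    rw [this, Complex.sinh, neg_sub, Complex.exp_sub, Complex.exp_sub, E2, T2]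
    field_simp
    ring
  have s2 : Complex.sinh ((Real.pi / κ) * k) = (E ^ 2 - (E ^ 2)⁻¹) / 2 := by
    have : (Real.pi / κ : ℂ) * k = 2 * (η * k) := by rw [hη]; push_cast; field_simp
    rw [this, Complex.sinh, Complex.exp_neg, E2]
  have s3 : Complex.sinh (Complex.I * Real.pi ^ 2 / (ρ * κ)) = (T ^ 2 - (T ^ 2)⁻¹) / 2 := by
    have : Complex.I * Real.pi ^ 2 / (ρ * κ) = θ * Complex.I := by rw [hθ]; push_cast; field_simp
    rw [this, Complex.sinh, Complex.exp_neg, T2]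
  rw [Complex.ofReal_mul, k1] at hk1 hk2
  have n1 : E ^ 2 + T ^ 2 ≠ 0 := by simpa using left_ne_zero_of_mul hk1
  have n2 : E ^ 2 - T ^ 2 ≠ 0 := by
    simpa [sub_eq_add_neg] using left_ne_zero_of_mul hk2
  rw [c1, c2, c3, c4, w1, w2, r1, r2, s1, s2, s3, e1, k1, k1]
  have := kernel_algebra (σ := σ) nE nT nR nW hd n1 n2
  push_cast
  simp only [one_mul, neg_one_mul, ← sub_eq_add_neg] at this ⊢
  exact this

end

/-! ### The transform extends the integral transform -/

theorem integral_sub_sub_add {μ : Measure ℝ} {a b c d : ℝ → ℂ} (ha : Integrable a μ)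
    (hb : Integrable b μ) (hc : Integrable c μ) (hd : Integrable d μ) :
    ∫ x, (a x - b x - c x + d x) ∂μ =
      ∫ x, a x ∂μ - ∫ x, b x ∂μ - ∫ x, c x ∂μ + ∫ x, d x ∂μ := by
  rw [integral_add (f := fun x => a x - b x - c x) ((ha.sub hb).sub hc) hd,
    integral_sub (f := fun x => a x - b x) (ha.sub hb) hc, integral_sub ha hb]

theorem coeFn_combination_ae {F G H K : PositionSpace} {f g h k : ℝ → ℂ} (hF : F =ᵐ[volume] f)
    (hG : G =ᵐ[volume] g) (hH : H =ᵐ[volume] h) (hK : K =ᵐ[volume] k) (a b c d : ℂ) :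
    (a • F + b • reflOp G + c • reflOp H + d • K : PositionSpace) =ᵐ[volume]
      fun x => a * f x + b * g (-x) + c * h (-x) + d * k x := by
  filter_upwards [hF, ae_comp_neg hG, ae_comp_neg hH, hK, reflOp_ae G, reflOp_ae H,
    Lp.coeFn_add (a • F + b • reflOp G + c • reflOp H) (d • K),
    Lp.coeFn_add (a • F + b • reflOp G) (c • reflOp H), Lp.coeFn_add (a • F) (b • reflOp G),
    Lp.coeFn_smul a F, Lp.coeFn_smul b (reflOp G), Lp.coeFn_smul c (reflOp H),
    Lp.coeFn_smul d K] with x h1 h2 h3 h4 h5 h6 h7 h8 h9 h10 h11 h12 h13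
  rw [h7, Pi.add_apply, h8, Pi.add_apply, h9, Pi.add_apply, h10, h11, h12, h13]
  simp only [Pi.smul_apply, smul_eq_mul, h1, h2, h3, h4, h5, h6]

section

variable {σ ε θ ν η : ℝ}

theorem channelOp_eq (hε : ε = 1 ∨ ε = -1) (h0 : 0 < θ) (hπ : θ < Real.pi) (f : HalfLineSpace) :
    channelOp σ ε θ ν η f = scatOp ε θ ν η (halfOp (phaseFn ε θ η) f) -
      (σ * ε : ℂ) • reflOp (scatOp ε θ ν η (halfOp (phaseFn ε θ η) f)) := by
  have hε2 : (ε : ℂ) * ε = 1 := by rcases hε with rfl | rfl <;> simp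
  rw [channelOp_apply, reflOp_scatOp hε h0 hπ, smul_smul, mul_assoc, hε2, mul_one, map_sub,
    map_smul]

/-- The functions `½ (S₊ X₊ f ± S₋ X₋ f)`. -/
def wavePart (s θ ν η : ℝ) (f : ℝ → ℂ) (r : ℝ) : ℂ :=
  ((1 / √(2 * Real.pi) : ℝ) : ℂ) *
    ∫ k, 1 / 2 * (waveKernel 1 θ ν η r k + s * waveKernel (-1) θ ν η r k) * f k

theorem wavePart_ae (h0 : 0 < θ) (hπ : θ < Real.pi) {f : ℝ → ℂ} (hf : IsHalfLineTest f) (s : ℝ) :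
    ((1 / 2 : ℂ) • (scatOp 1 θ ν η (halfOp (phaseFn 1 θ η) (hf.memLp.toLp f)) +
      (s : ℂ) • scatOp (-1) θ ν η (halfOp (phaseFn (-1) θ η) (hf.memLp.toLp f))) :
        PositionSpace) =ᵐ[volume] wavePart s θ ν η f := by
  set F := scatOp 1 θ ν η (halfOp (phaseFn 1 θ η) (hf.memLp.toLp f)) with hF
  set G := scatOp (-1) θ ν η (halfOp (phaseFn (-1) θ η) (hf.memLp.toLp f)) with hG
  filter_upwards [scatOp_halfOp_test (ν := ν) (η := η) (Or.inl rfl) h0 hπ hf,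
    scatOp_halfOp_test (ν := ν) (η := η) (Or.inr rfl) h0 hπ hf,
    Lp.coeFn_smul (1 / 2 : ℂ) (F + (s : ℂ) • G), Lp.coeFn_add F ((s : ℂ) • G),
    Lp.coeFn_smul (s : ℂ) G] with r h1 h2 h3 h4 h5
  rw [h3, Pi.smul_apply, h4, Pi.add_apply, h5, Pi.smul_apply, hF, h1, hG, h2, wavePart]
  have i1 := integrable_waveKernel_mul (ν := ν) (η := η) (Or.inl rfl) h0 hπ hf r
  have i2 := integrable_waveKernel_mul (ν := ν) (η := η) (Or.inr rfl) h0 hπ hf r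
  have key : ∫ k, 1 / 2 * (waveKernel 1 θ ν η r k + s * waveKernel (-1) θ ν η r k) * f k =
      1 / 2 * ∫ k, waveKernel 1 θ ν η r k * f k + s * (waveKernel (-1) θ ν η r k * f k) := by
    rw [← integral_const_mul]
    congr 1 with k
    ring
  rw [key, integral_add i1 (i2.const_mul _), integral_const_mul, smul_eq_mul, smul_eq_mul]
  ring

theorem integrable_wavePart (h0 : 0 < θ) (hπ : θ < Real.pi) {f : ℝ → ℂ} (hf : IsHalfLineTest f)
    (s r : ℝ) : Integrable fun k =>
      1 / 2 * (waveKernel 1 θ ν η r k + s * waveKernel (-1) θ ν η r k) * f k := by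
  have i1 := integrable_waveKernel_mul (ν := ν) (η := η) (Or.inl rfl) h0 hπ hf r
  have i2 := integrable_waveKernel_mul (ν := ν) (η := η) (Or.inr rfl) h0 hπ hf r
  refine ((i1.add (i2.const_mul (s : ℂ))).const_mul (1 / 2 : ℂ)).congr (ae_of_all _ fun k => ?_)
  simp only [Pi.add_apply]
  ring

theorem transformOp_testPair (hσ : σ = 1 ∨ σ = -1) (h0 : 0 < θ) (hπ : θ < Real.pi)
    {f g : ℝ → ℂ} (hf : IsHalfLineTest f) (hg : IsHalfLineTest g) :
    transformOp σ θ ν η (testPair hf hg) =ᵐ[volume] fun r =>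
      wavePart 1 θ ν η f r - σ * wavePart (-1) θ ν η f (-r) - wavePart 1 θ ν η g (-r) +
        σ * wavePart (-1) θ ν η g r := by
  have hσ2 : (σ : ℂ) * σ = 1 := by rcases hσ with rfl | rfl <;> simp
  have h1 : transformOp σ θ ν η (testPair hf hg) = plusOp σ θ ν η (hf.memLp.toLp f) +
    minusOp σ θ ν η (hg.memLp.toLp g) := rfl
  have h2 := coeFn_combination_ae (wavePart_ae (ν := ν) (η := η) h0 hπ hf 1)
    (wavePart_ae (ν := ν) (η := η) h0 hπ hf (-1)) (wavePart_ae (ν := ν) (η := η) h0 hπ hg 1)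
    -- The coefficients come from C_ε = (1 - σεN)S_εX_ε: sums over ε keep `wavePart 1` direct and
    -- reflect `wavePart (-1)`, differences do the opposite.
    (wavePart_ae (ν := ν) (η := η) h0 hπ hg (-1)) 1 (-σ) (-1) σ
  rw [h1, plusOp, minusOp]
  simp only [smul_apply, add_apply, sub_apply, channelOp_eq (Or.inl rfl) h0 hπ,
    channelOp_eq (Or.inr rfl) h0 hπ]
  refine Filter.EventuallyEq.trans (Filter.EventuallyEq.of_eq ?_)
    (h2.trans (ae_of_all _ fun r => ?_))
  · refine congrArg (fun F : PositionSpace => (F : ℝ → ℂ)) ?_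
    simp only [map_add, map_smul]
    push_cast
    match_scalars <;> first | ring1 | linear_combination (1 / 2 : ℂ) * hσ2 |
      linear_combination (-1 / 2 : ℂ) * hσ2
  · ring

end

theorem extendsTransform_transformOp {ρ κ θ ν η σ : ℝ} (hρ : 0 < ρ) (hκ : 0 < κ)
    (hρκ : Real.pi < ρ * κ) (hθ : θ = Real.pi ^ 2 / (ρ * κ)) (hν : ν = Real.pi / ρ)
    (hη : η = Real.pi / (2 * κ)) (hσ : σ = 1 ∨ σ = -1) (h0 : 0 < θ) (hπ : θ < Real.pi) :
    ExtendsTransform (kernelE ρ κ σ) (transformOp σ θ ν η) := by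
  intro f g hf hg
  refine (transformOp_testPair hσ h0 hπ hf hg).trans (ae_of_all _ fun r => ?_)
  have hI : ∀ {f : ℝ → ℂ}, IsHalfLineTest f → ∀ s r : ℝ, Integrable fun k =>
      1 / 2 * (waveKernel 1 θ ν η r k + s * waveKernel (-1) θ ν η r k) * f k :=
    fun hf s r => integrable_wavePart h0 hπ hf s r
  have key : ∫ k in Ioi (0 : ℝ), (kernelE ρ κ σ r k * f k + -kernelE ρ κ σ (-r) k * g k) =
      ∫ k, (1 / 2 * (waveKernel 1 θ ν η r k + (1 : ℝ) * waveKernel (-1) θ ν η r k) * f k -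
        σ * (1 / 2 * (waveKernel 1 θ ν η (-r) k + (-1 : ℝ) * waveKernel (-1) θ ν η (-r) k) * f k) -
        1 / 2 * (waveKernel 1 θ ν η (-r) k + (1 : ℝ) * waveKernel (-1) θ ν η (-r) k) * g k +
        σ * (1 / 2 * (waveKernel 1 θ ν η r k + (-1 : ℝ) * waveKernel (-1) θ ν η r k) * g k)) := by
    -- Test functions vanish off (0,∞), so the integral may run over the whole line, as in U.
    rw [setIntegral_eq_integral_of_forall_compl_eq_zero fun k hk => by
      rw [hf.eq_zero hk, hg.eq_zero hk, mul_zero, mul_zero, add_zero]]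
    congr 1 with k
    rw [kernelE_eq hρ hκ hρκ hθ hν hη, kernelE_eq hρ hκ hρκ hθ hν hη, neg_neg]
    push_cast
    ring
  rw [integralTransform, key, integral_sub_sub_add (hI hf _ _) ((hI hf _ _).const_mul _)
    (hI hg _ _) ((hI hg _ _).const_mul _), integral_const_mul, integral_const_mul]
  simp only [wavePart]
  ring

/-! ### Uniqueness of the extension -/

theorem isHalfLineTest_zero : IsHalfLineTest fun _ => 0 :=
  ⟨contDiff_const, HasCompactSupport.zero, by simp [tsupport]⟩

theorem halfLine_eq_zero {u : HalfLineSpace}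
    (h : ∀ f (hf : IsHalfLineTest f), inner ℂ (hf.memLp.toLp f) u = 0) : u = 0 := by
  have h1 : ∀ᵐ x ∂volume.restrict (Ioi (0 : ℝ)), x ∈ Ioi (0 : ℝ) → u x = 0 := by
    refine isOpen_Ioi.ae_eq_zero_of_integral_contDiff_smul_eq_zero
      (((Lp.memLp u).locallyIntegrable (by norm_num)).locallyIntegrableOn _)
      fun g hg hgc hgs => ?_
    have hf : IsHalfLineTest (Complex.ofRealCLM ∘ g) :=
      ⟨by fun_prop, hgc.comp_left rfl, (tsupport_comp_subset rfl g).trans hgs⟩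
    rw [← h _ hf, L2.inner_def]
    refine integral_congr_ae ?_
    filter_upwards [hf.memLp.coeFn_toLp] with x hx
    rw [hx]
    simp [mul_comm]
  refine Lp.ext ?_
  filter_upwards [h1, ae_restrict_mem measurableSet_Ioi,
    Lp.coeFn_zero ℂ 2 (volume.restrict (Ioi (0 : ℝ)))] with x h2 h3 h4
  rw [h2 h3, h4, Pi.zero_apply]

/-- Both components of (F - G)*h are orthogonal to all test functions, as seen by putting one entry
of the pair equal to zero; `halfLine_eq_zero` then gives (F - G)* = 0. -/
theorem ExtendsTransform.unique {Ψ : ℝ → ℝ → ℂ} {F G : MomentumSpace →L[ℂ] PositionSpace}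
    (hF : ExtendsTransform Ψ F) (hG : ExtendsTransform Ψ G) : F = G := by
  have hD : ∀ f g (hf : IsHalfLineTest f) (hg : IsHalfLineTest g),
      (F - G) (testPair hf hg) = 0 := fun f g hf hg => by
    rw [sub_apply, sub_eq_zero]
    exact Lp.ext ((hF f g hf hg).trans (hG f g hf hg).symm)
  have hz : isHalfLineTest_zero.memLp.toLp (fun _ => 0) = 0 := MemLp.toLp_zero _
  have hA : (F - G).adjoint = 0 := by
    ext1 h
    have hi : ∀ f g (hf : IsHalfLineTest f) (hg : IsHalfLineTest g),
        inner ℂ (hf.memLp.toLp f) ((F - G).adjoint h).fst +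
          inner ℂ (hg.memLp.toLp g) ((F - G).adjoint h).snd = 0 := fun f g hf hg => by
      have := ContinuousLinearMap.adjoint_inner_right (F - G) (testPair hf hg) h
      rwa [hD, inner_zero_left, WithLp.prod_inner_apply] at this
    have h1 : ((F - G).adjoint h).fst = 0 := halfLine_eq_zero fun f hf => by
      simpa only [hz, inner_zero_left, add_zero] using hi f _ hf isHalfLineTest_zero
    have h2 : ((F - G).adjoint h).snd = 0 := halfLine_eq_zero fun f hf => by
      simpa only [hz, inner_zero_left, zero_add] using hi _ f isHalfLineTest_zero hf
    exact WithLp.ofLp_injective 2 (Prod.ext h1 h2)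
  have := congrArg ContinuousLinearMap.adjoint hA
  rwa [ContinuousLinearMap.adjoint_adjoint, map_zero, sub_eq_zero] at this

end

/-! ### The theorem -/

theorem propositionB4 (ρ κ : ℝ) (hρ : 0 < ρ) (hκ : 0 < κ) (hρκ : Real.pi < ρ * κ) :
    -- each of the two transforms extends uniquely to a bounded operator
    (∃! F : MomentumSpace →L[ℂ] PositionSpace, ExtendsTransform (kernelE ρ κ (-1)) F) ∧
    (∃! F : MomentumSpace →L[ℂ] PositionSpace, ExtendsTransform (kernelE ρ κ 1) F) ∧
    -- the transform with `σ = -` is unitary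
    (∀ F : MomentumSpace →L[ℂ] PositionSpace, ExtendsTransform (kernelE ρ κ (-1)) F →
      F.adjoint ∘L F = ContinuousLinearMap.id ℂ MomentumSpace ∧
      F ∘L F.adjoint = ContinuousLinearMap.id ℂ PositionSpace) ∧
    -- `Ψ_e` is in the position space with `(Ψ_e, Ψ_e)` as given, and the transform with `σ = +` is
    -- isometric with `F F* = 1 - Ψ_e ⊗ Ψ_e / (Ψ_e, Ψ_e)`
    ∃ hΨ : MemLp (fun r : ℝ => (sqrtWeightE ρ κ r : ℂ)) 2 (volume : Measure ℝ),
      inner ℂ (hΨ.toLp _) (hΨ.toLp _) =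
        ((Real.pi / (2 * κ * Real.sin (Real.pi ^ 2 / (ρ * κ))) : ℝ) : ℂ) ∧
      ∀ F : MomentumSpace →L[ℂ] PositionSpace, ExtendsTransform (kernelE ρ κ 1) F →
        Isometry F ∧
        F ∘L F.adjoint = ContinuousLinearMap.id ℂ PositionSpace -
          (inner ℂ (hΨ.toLp _) (hΨ.toLp _))⁻¹ •
            InnerProductSpace.rankOne ℂ (hΨ.toLp _) (hΨ.toLp _) := by
  set θ := Real.pi ^ 2 / (ρ * κ) with hθ
  set ν := Real.pi / ρ with hν
  set η := Real.pi / (2 * κ) with hη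
  have h0 : 0 < θ := by positivity
  have hπ : θ < Real.pi := by
    rw [hθ, div_lt_iff₀ (by positivity)]
    nlinarith [Real.pi_pos]
  have hν0 : 0 < ν := by positivity
  have hη0 : 0 < η := by positivity
  have hνη : 2 * (ν * η) = θ := by
    rw [hν, hη, hθ]
    field_simp
  have hm : (-1 : ℝ) = 1 ∨ (-1 : ℝ) = -1 := Or.inr rfl
  have hp : (1 : ℝ) = 1 ∨ (1 : ℝ) = -1 := Or.inl rfl
  have em := extendsTransform_transformOp hρ hκ hρκ hθ hν hη hm h0 hπ
  have ep := extendsTransform_transformOp hρ hκ hρκ hθ hν hη hp h0 hπ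
  have hb : (fun r : ℝ => (sqrtWeightE ρ κ r : ℂ)) = boundState θ ν := by
    funext r
    rw [sqrtWeightE_eq hρ hκ hρκ, boundState]
  refine ⟨⟨_, em, fun F hF => hF.unique em⟩, ⟨_, ep, fun F hF => hF.unique ep⟩, fun F hF => ?_, ?_⟩
  · rw [hF.unique em]
    refine ⟨adjoint_transformOp_transformOp hm hν0 hη0 hπ hνη, ?_⟩
    ext1 h
    rw [ContinuousLinearMap.comp_apply, transformOp_adjoint_apply hm hν0 hη0 hπ hνη]
    -- For σ = -1 the factor (1 + σ)/2 is zero.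
    simp
  · rw [hb]
    refine ⟨memLp_boundState h0 hπ hν0, ?_, fun F hF => ?_⟩
    · rw [← toL2_eq, inner_boundState h0 hπ hν0]
      congr 1
      rw [div_eq_div_iff (by have := Real.sin_pos_of_pos_of_lt_pi h0 hπ; positivity)
        (by have := Real.sin_pos_of_pos_of_lt_pi h0 hπ; positivity)]
      -- By θ = 2νη the norm θ/(2ν sin θ) equals η/sin θ.
      rw [hν, ← hνη, hν, hη]
      field_simp
    · rw [hF.unique ep, ← toL2_eq]
      refine ⟨AddMonoidHomClass.isometry_of_norm _
        ((ContinuousLinearMap.norm_map_iff_adjoint_comp_self _).2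
          (adjoint_transformOp_transformOp hp hν0 hη0 hπ hνη)), ?_⟩
      ext1 h
      rw [ContinuousLinearMap.comp_apply, transformOp_adjoint_apply hp hν0 hη0 hπ hνη]
      norm_num
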